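/- **Corollary 4.4 (Tsirelson's examples are divisible).** *Operators.* For real Hilbert spaces $G_1,G_2$ let $\mathcal S(G_1,G_2)$ be the set of bounded operators $A:G_1\to G_2$ with bounded inverse such that $I-(A^*A)^{1/2}$ is Hilbert–Schmidt, and for a real Hilbert space $G$ let $\mathcal S(G)$ be the set of positive bounded operators $A$ on $G$ with bounded inverse such that $I-A$ is Hilbert–Schmidt. For subspaces $G_1,G_2$ of a real Hilbert space $G$ write $G=G_1\uplus G_2$ if $G_1$ and $G_2$ generate $G$ and there is $A\in\mathcal S(G)$ with $\langle Ax,Ay\rangle=0$ for all $x\in G_1$, $y\in G_2$. *Sum systems.* A (two parameter) sum system consists of real Hilbert spaces $G_{(a,b)}$, $0\le a<b<\infty$, embedded with their inner products in a single linear space, with $G_{(a,b)}\subset G_{(a',b')}$ whenever $(a,b)\subset(a',b')$, and a one parameter semigroup $\{S_t\}_{t>0}$ of linear maps on that space such that for all $s,t>0$: (i) $S_s|_{G_{(0,t)}}\in\mathcal S(G_{(0,t)},G_{(s,s+t)})$; (ii) $G_{(0,s+t)}=G_{(0,s)}\uplus G_{(s,s+t)}$; (iii) for every $x\in G_{(a,b)}$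 there is $\epsilon>0$ such that $S_tx\to x$ in $G_{(a,b+\epsilon)}$ as $t\to0^+$. Let $G_{(0,\infty)}$ be the closure of $\bigcup_{t>0}G_{(0,t)}$, and let $A_{s,t}:G_{(0,s)}\oplus G_{(s,s+t)}\to G_{(0,s+t)}$ be the map $x\oplus y\mapsto x+y$. *Additive units.* A real additive unit is a family $x_t\in G_{(0,t)}$, $t>0$, such that $t\mapsto\langle x_t,v\rangle$ is measurable for all $v\in G_{(0,\infty)}$ and $x_s+S_sx_t=x_{s+t}$ for all $s,t>0$. An imaginary additive unit is a family $y_t\in G_{(0,t)}$, $t>0$, with the same measurability property and $(A_{s,t}^*)^{-1}(y_s\oplus S_sy_t)=y_{s+t}$ for all $s,t>0$. For $0<s_1<s_2<s$ put $x_{s_1,s_2}=S_{s_1}x_{s_2-s_1}$, $y_{s_1,s_2}=S_{s_1}y_{s_2-s_1}$ and $y'_{s,s_1,s_2}=(A^*)^{-1}(0\oplus y_{s_1,s_2}\oplus0)$, where $A:G_{(0,s_1)}\oplus G_{(s_1,s_2)}\oplus G_{(s_2,s)}\to G_{(0,s)}$ is $x\oplus y\oplus z\mapsto x+y+z$. *Divisibility.*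 A sum system is divisible if every $S_t|_{G_{(a,b)}}:G_{(a,b)}\to G_{(a+t,b+t)}$ is unitary and, for every $s>0$, $$G_{(0,s)}=\overline{\operatorname{span}}\{x_{s_1,s_2}\}\qquad\text{and}\qquad G_{(0,s)}=\overline{\operatorname{span}}\{y'_{s,s_1,s_2}\},$$ where $0<s_1<s_2<s$ and $x$, respectively $y$, runs over all real, respectively imaginary, additive units. *Tsirelson's examples.* Let $\alpha\in\mathbb R$ and let $B\in L^1(\mathbb R)$ be an even real function, continuous on $\mathbb R\setminus\{0\}$, positive definite in the sense that $\iint f(s)f(t)B(s-t)\,ds\,dt\ge0$ for all $f\in L^2(\mathbb R)$, nonnegative, nonincreasing and convex on $(0,\infty)$, and such that for some $\epsilon>0$ $$B(t)=\frac1{t\,\ln^{\alpha}(1/t)}\qquad\text{for all }t\in(0,\epsilon).$$ (Integrability forces $\alpha>1$.) For $0\le a<b$ let $G_{(a,b)}$ be the completion of $L^2(a,b)$ for the scalar product $$\langle f,g\rangle=\iint f(s)g(t)B(s-t)\,ds\,dt ,$$ all of these regarded as subspaces of the completion of $L^2(\mathbb R)$ for the same scalar product, and let $S_t$ be the continuous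 extension of the shift $(S_tf)(s)=f(s-t)$. *Statement.* For every such $\alpha$ and $B$, $(G_{(a,b)},S_t)$ is a sum system and it is divisible. -/

import Mathlib

open MeasureTheory Filter Topology Set
open scoped RealInnerProductSpace

noncomputable section

/-! ## Operators: Hilbert-Schmidt operators and the classes `𝒮(G)`, `𝒮(G₁, G₂)` -/

section Operators

variable {E F : Type*} [NormedAddCommGroup E] [InnerProductSpace ℝ E]
  [NormedAddCommGroup F] [InnerProductSpace ℝ F]

/-- `T` is Hilbert-Schmidt: `∑ ‖T eᵢ‖² < ∞` for some (equivalently, every) orthonormal basis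
(an orthonormal basis is indexed here by the set of its own vectors). -/
def IsHilbertSchmidt (T : E →L[ℝ] F) : Prop :=
  ∃ (w : Set E) (b : HilbertBasis w ℝ E), Summable fun i : w => ‖T (b i)‖ ^ 2

/-- The class `𝒮(G)`: positive operators with a bounded inverse such that `I - A` is
Hilbert-Schmidt. -/
def InPosS (A : E →L[ℝ] E) : Prop :=
  A.IsPositive ∧ A.IsInvertible ∧ IsHilbertSchmidt (ContinuousLinearMap.id ℝ E - A)

/-- The class `𝒮(G₁, G₂)`: bounded operators with a bounded inverse such that
`I - (A* A)^{1/2}` is Hilbert-Schmidt. The square root is the (unique) positive operator `R` with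
`R² = A* A`. -/
def InS [CompleteSpace E] [CompleteSpace F] (A : E →L[ℝ] F) : Prop :=
  A.IsInvertible ∧ ∃ R : E →L[ℝ] E, R.IsPositive ∧
    R ∘L R = (ContinuousLinearMap.adjoint A) ∘L A ∧
    IsHilbertSchmidt (ContinuousLinearMap.id ℝ E - R)

end Operators

section Subspaces

variable {V : Type*} [NormedAddCommGroup V] [InnerProductSpace ℝ V]

/-- `G₁ ⊎ G₂ = K`: the subspaces `G₁`, `G₂` of the Hilbert space `K` are quasi-orthogonal (some
`A ∈ 𝒮(K)` makes `A G₁` and `A G₂` orthogonal), and they generate `K`. -/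
def IsQuasiOrthogonalSum (G₁ G₂ K : Submodule ℝ V) : Prop :=
  G₁ ≤ K ∧ G₂ ≤ K ∧
  (∃ A : K →L[ℝ] K, InPosS A ∧
    ∀ x y : K, (x : V) ∈ G₁ → (y : V) ∈ G₂ → ⟪A x, A y⟫ = 0) ∧
  (G₁ ⊔ G₂).topologicalClosure = K

/-- The inclusion of a subspace into a bigger one, as a bounded operator. -/
def inclL {G₁ K : Submodule ℝ V} (h : G₁ ≤ K) : G₁ →L[ℝ] K :=
  G₁.subtypeL.codRestrict K (fun x => h x.2)

/-- The map `x ⊕ y ↦ x + y` from the Hilbert space direct sum `G₁ ⊕ G₂` to `K`. -/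
def sumMap₂ {G₁ G₂ K : Submodule ℝ V} (h₁ : G₁ ≤ K) (h₂ : G₂ ≤ K) :
    WithLp 2 (G₁ × G₂) →L[ℝ] K :=
  ((inclL h₁).coprod (inclL h₂)) ∘L
    (WithLp.prodContinuousLinearEquiv 2 ℝ G₁ G₂ : WithLp 2 (G₁ × G₂) →L[ℝ] G₁ × G₂)

/-- The map `x ⊕ y ⊕ z ↦ x + y + z` from the Hilbert space direct sum `G₁ ⊕ G₂ ⊕ G₃` to `K`. -/
def sumMap₃ {G₁ G₂ G₃ K : Submodule ℝ V} (h₁ : G₁ ≤ K) (h₂ : G₂ ≤ K) (h₃ : G₃ ≤ K) :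
    WithLp 2 (G₁ × WithLp 2 (G₂ × G₃)) →L[ℝ] K :=
  ((inclL h₁).coprod (sumMap₂ h₂ h₃)) ∘L
    (WithLp.prodContinuousLinearEquiv 2 ℝ G₁ (WithLp 2 (G₂ × G₃)) :
      WithLp 2 (G₁ × WithLp 2 (G₂ × G₃)) →L[ℝ] G₁ × WithLp 2 (G₂ × G₃))

end Subspaces

/-! ## Two parameter sum systems -/

/-- The data of a two parameter sum system: real Hilbert spaces `G a b` (for `0 ≤ a < b`; other
indices carry no information) inside a single space `V`, increasing in the interval `(a, b)` and
carrying the inner product of `V`, and linear maps `S t` on `V` that map `G 0 t` into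
`G s (s + t)`. The axioms of a sum system are in `IsSumSystem`. -/
structure SumSystemData (V : Type*) [NormedAddCommGroup V] [InnerProductSpace ℝ V] where
  /-- the Hilbert space attached to the interval `(a, b)` -/
  G : ℝ → ℝ → Submodule ℝ V
  complete : ∀ a b, CompleteSpace (G a b)
  mono : ∀ {a b a' b' : ℝ}, 0 ≤ a' → a' ≤ a → a < b → b ≤ b' → G a b ≤ G a' b'
  /-- the shift -/
  S : ℝ → V →ₗ[ℝ] V
  S_mem : ∀ {s t : ℝ}, 0 < s → 0 < t → ∀ x ∈ G 0 t, S s x ∈ G s (s + t)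

namespace SumSystemData

variable {V : Type*} [NormedAddCommGroup V] [InnerProductSpace ℝ V] (P : SumSystemData V)

instance (a b : ℝ) : CompleteSpace (P.G a b) := P.complete a b

/-- The axioms of a two parameter sum system. -/
structure IsSumSystem : Prop where
  /-- `S` is a one parameter semigroup -/
  semigroup : ∀ s t : ℝ, 0 < s → 0 < t → P.S (s + t) = P.S s ∘ₗ P.S t
  /-- the restriction of `S s` to `G_(0,t)` lies in `𝒮(G_(0,t), G_(s,s+t))` -/
  shift_inS : ∀ s t : ℝ, 0 < s → 0 < t →
    ∃ T : P.G 0 t →L[ℝ] P.G s (s + t), (∀ x, (T x : V) = P.S s x) ∧ InS T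
  /-- `G_(0,s+t) = G_(0,s) ⊎ G_(s,s+t)` -/
  quasi_sum : ∀ s t : ℝ, 0 < s → 0 < t →
    IsQuasiOrthogonalSum (P.G 0 s) (P.G s (s + t)) (P.G 0 (s + t))
  /-- local strong continuity of the shift -/
  local_continuous : ∀ a b : ℝ, 0 ≤ a → a < b → ∀ x ∈ P.G a b, ∃ ε > 0,
    (∀ᶠ t in 𝓝[>] (0 : ℝ), P.S t x ∈ P.G a (b + ε)) ∧
    Tendsto (fun t => P.S t x) (𝓝[>] (0 : ℝ)) (𝓝 x)

/-- Every restriction `S_t : G_(a,b) → G_(a+t,b+t)` is unitary, that is, isometric and onto. -/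
def IsUnitaryShift : Prop :=
  ∀ t a b : ℝ, 0 < t → 0 ≤ a → a < b →
    (∀ x ∈ P.G a b, ‖P.S t x‖ = ‖x‖) ∧ (P.G a b).map (P.S t) = P.G (a + t) (b + t)

/-- `G_(0,∞)`, the closed span of the spaces `G_(0,t)`. -/
def GTotal : Submodule ℝ V :=
  (⨆ t : Ioi (0 : ℝ), P.G 0 t).topologicalClosure

/-- The map `A_{s,t} : G_(0,s) ⊕ G_(s,s+t) → G_(0,s+t)`, `x ⊕ y ↦ x + y`. -/
def sumMap {s t : ℝ} (hs : 0 < s) (ht : 0 < t) :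
    WithLp 2 (P.G 0 s × P.G s (s + t)) →L[ℝ] P.G 0 (s + t) :=
  sumMap₂ (P.mono le_rfl le_rfl hs (by linarith)) (P.mono le_rfl hs.le (by linarith) le_rfl)

/-- The map `G_(0,s₁) ⊕ G_(s₁,s₂) ⊕ G_(s₂,s) → G_(0,s)`, `x ⊕ y ⊕ z ↦ x + y + z`. -/
def sumMapThree {s₁ s₂ s : ℝ} (h₁ : 0 < s₁) (h₁₂ : s₁ < s₂) (h₂ : s₂ < s) :
    WithLp 2 (P.G 0 s₁ × WithLp 2 (P.G s₁ s₂ × P.G s₂ s)) →L[ℝ] P.G 0 s :=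
  sumMap₃ (P.mono le_rfl le_rfl h₁ (by linarith)) (P.mono le_rfl h₁.le h₁₂ h₂.le)
    (P.mono le_rfl (by linarith) h₂ le_rfl)

theorem S_mem_sub {s₁ s₂ : ℝ} (h₁ : 0 < s₁) (h₁₂ : s₁ < s₂) {x : V}
    (hx : x ∈ P.G 0 (s₂ - s₁)) : P.S s₁ x ∈ P.G s₁ s₂ := by
  have h := P.S_mem h₁ (sub_pos.2 h₁₂) x hx
  rwa [add_sub_cancel] at h

/-- Real additive units: measurable families `x_t ∈ G_(0,t)`, `t > 0`, with
`x_s + S_s x_t = x_{s+t}`. -/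
structure IsRealAdditiveUnit (x : ℝ → V) : Prop where
  mem : ∀ t : ℝ, 0 < t → x t ∈ P.G 0 t
  measurable : ∀ v ∈ P.GTotal, Measurable fun t : Ioi (0 : ℝ) => ⟪x t, v⟫
  add : ∀ s t : ℝ, 0 < s → 0 < t → x s + P.S s (x t) = x (s + t)

/-- Imaginary additive units: measurable families `y_t ∈ G_(0,t)`, `t > 0`, with
`(A_{s,t}*)⁻¹ (y_s ⊕ S_s y_t) = y_{s+t}`. -/
structure IsImaginaryAdditiveUnit (y : ℝ → V) : Prop where
  mem : ∀ t : ℝ, 0 < t → y t ∈ P.G 0 t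
  measurable : ∀ v ∈ P.GTotal, Measurable fun t : Ioi (0 : ℝ) => ⟪y t, v⟫
  add : ∀ (s t : ℝ) (hs : 0 < s) (ht : 0 < t),
    ((ContinuousLinearMap.adjoint (P.sumMap hs ht)).inverse
      (WithLp.toLp 2 ((⟨y s, mem s hs⟩ : P.G 0 s),
        (⟨P.S s (y t), P.S_mem hs ht _ (mem t ht)⟩ : P.G s (s + t)))) : V) = y (s + t)

/-- For an imaginary additive unit `y` and `0 < s₁ < s₂ < s`, the vector
`y'_{s,s₁,s₂} = (A*)⁻¹ (0 ⊕ S_{s₁} y_{s₂-s₁} ⊕ 0) ∈ G_(0,s)`, where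
`A : G_(0,s₁) ⊕ G_(s₁,s₂) ⊕ G_(s₂,s) → G_(0,s)` is the sum map. -/
def imagVector {y : ℝ → V} (hy : P.IsImaginaryAdditiveUnit y) {s₁ s₂ s : ℝ}
    (h₁ : 0 < s₁) (h₁₂ : s₁ < s₂) (h₂ : s₂ < s) : P.G 0 s :=
  (ContinuousLinearMap.adjoint (P.sumMapThree h₁ h₁₂ h₂)).inverse
    (WithLp.toLp 2 ((0 : P.G 0 s₁), WithLp.toLp 2
      ((⟨P.S s₁ (y (s₂ - s₁)), P.S_mem_sub h₁ h₁₂ (hy.mem _ (sub_pos.2 h₁₂))⟩ : P.G s₁ s₂),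
        (0 : P.G s₂ s))))

/-- Divisible sum systems: sum systems with unitary shifts in which the vectors
`x_{s₁,s₂} = S_{s₁} x_{s₂-s₁}` given by the real additive units `x` span a dense subspace of every
`G_(0,s)`, and so do the vectors `y'_{s,s₁,s₂}` given by the imaginary additive units `y`. -/
structure IsDivisible : Prop where
  isSumSystem : P.IsSumSystem
  isUnitaryShift : P.IsUnitaryShift
  real_generate : ∀ s : ℝ, 0 < s →
    P.G 0 s = (Submodule.span ℝ {z : V | ∃ x : ℝ → V, P.IsRealAdditiveUnit x ∧
      ∃ s₁ s₂ : ℝ, 0 < s₁ ∧ s₁ < s₂ ∧ s₂ < s ∧ z = P.S s₁ (x (s₂ - s₁))}).topologicalClosure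
  imag_generate : ∀ s : ℝ, 0 < s →
    P.G 0 s = (Submodule.span ℝ {z : V | ∃ (y : ℝ → V) (hy : P.IsImaginaryAdditiveUnit y)
      (s₁ s₂ : ℝ) (h₁ : 0 < s₁) (h₁₂ : s₁ < s₂) (h₂ : s₂ < s),
      z = P.imagVector hy h₁ h₁₂ h₂}).topologicalClosure

end SumSystemData

/-! ## Tsirelson's examples -/

/-- `∬ f(s) g(t) B(s - t) ds dt` -/
def kernelForm (B f g : ℝ → ℝ) : ℝ :=
  ∫ p : ℝ × ℝ, f p.1 * g p.2 * B (p.1 - p.2)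

/-- The kernels `B` of Tsirelson's examples. The value `B 0` plays no role (`B` blows up
at `0`). -/
structure TsirelsonKernel (α : ℝ) where
  B : ℝ → ℝ
  integrable : Integrable B
  continuousOn : ContinuousOn B {0}ᶜ
  even : ∀ t, B (-t) = B t
  /-- positive definiteness, on `L²(ℝ)` -/
  posDef : ∀ f : ℝ → ℝ, MemLp f 2 → 0 ≤ kernelForm B f f
  nonneg : ∀ t, 0 < t → 0 ≤ B t
  antitone : AntitoneOn B (Ioi 0)
  convex : ConvexOn ℝ (Ioi 0) B
  near_zero : ∃ ε > 0, ∀ t ∈ Ioo 0 ε, B t = 1 / (t * Real.log (1 / t) ^ α)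

section KernelForm

variable {B : ℝ → ℝ}

theorem kernelForm_integrable (hB : Integrable B) {f g : ℝ → ℝ} (hf : MemLp f 2)
    (hg : MemLp g 2) :
    Integrable (fun p : ℝ × ℝ => f p.1 * g p.2 * B (p.1 - p.2)) := by
  have key : ∀ {u : ℝ → ℝ}, MemLp u 2 →
      Integrable (fun p : ℝ × ℝ => u p.2 ^ 2 * B (p.1 - p.2)) := fun {u} hu =>
    Integrable.convolution_integrand (L := ContinuousLinearMap.mul ℝ ℝ) hu.integrable_sq hB
  have key' : ∀ {u : ℝ → ℝ}, MemLp u 2 →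
      Integrable (fun p : ℝ × ℝ => u p.1 ^ 2 * B (p.1 - p.2)) := fun {u} hu => by
    have h := Integrable.convolution_integrand (L := ContinuousLinearMap.mul ℝ ℝ)
      (μ := volume) (ν := volume) hu.integrable_sq hB.comp_neg
    have h2 := h.swap
    refine h2.congr (Eventually.of_forall fun p => ?_)
    simp [Function.comp]
  have hm : AEStronglyMeasurable (fun p : ℝ × ℝ => f p.1 * g p.2 * B (p.1 - p.2)) volume := by
    refine (hf.1.comp_fst.mul hg.1.comp_snd).mul ?_
    exact hB.1.comp_quasiMeasurePreserving (quasiMeasurePreserving_sub volume volume)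
  refine ((key' hf).norm.add (key hg).norm).mono hm (Eventually.of_forall fun p => ?_)
  simp only [Pi.add_apply, norm_mul, norm_pow, Real.norm_eq_abs]
  rw [abs_of_nonneg (a := |f p.1| ^ 2 * _ + _) (by positivity), ← add_mul]
  refine mul_le_mul_of_nonneg_right ?_ (abs_nonneg _)
  nlinarith [sq_nonneg (|f p.1| - |g p.2|), sq_nonneg |f p.1|, sq_nonneg |g p.2|]

theorem kernelForm_congr {f f' g g' : ℝ → ℝ} (hf : f =ᵐ[volume] f') (hg : g =ᵐ[volume] g') :
    kernelForm B f g = kernelForm B f' g' := by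
  refine integral_congr_ae ?_
  have h1 : ∀ᵐ p : ℝ × ℝ, f p.1 = f' p.1 :=
    Measure.quasiMeasurePreserving_fst.ae hf
  have h2 : ∀ᵐ p : ℝ × ℝ, g p.2 = g' p.2 :=
    Measure.quasiMeasurePreserving_snd.ae hg
  filter_upwards [h1, h2] with p hp1 hp2
  rw [hp1, hp2]

theorem kernelForm_symm (he : ∀ t, B (-t) = B t) (f g : ℝ → ℝ) :
    kernelForm B f g = kernelForm B g f := by
  unfold kernelForm
  rw [Measure.volume_eq_prod, ← integral_prod_swap]
  refine integral_congr_ae (Eventually.of_forall fun p => ?_)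
  simp only [Prod.fst_swap, Prod.snd_swap]
  rw [← he, neg_sub]
  ring

theorem kernelForm_add_left (hB : Integrable B) {f f' g : ℝ → ℝ} (hf : MemLp f 2)
    (hf' : MemLp f' 2) (hg : MemLp g 2) :
    kernelForm B (f + f') g = kernelForm B f g + kernelForm B f' g := by
  unfold kernelForm
  rw [← integral_add (kernelForm_integrable hB hf hg) (kernelForm_integrable hB hf' hg)]
  refine integral_congr_ae (Eventually.of_forall fun p => ?_)
  simp only [Pi.add_apply]
  ring

theorem kernelForm_smul_left (c : ℝ) (f g : ℝ → ℝ) :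
    kernelForm B (c • f) g = c * kernelForm B f g := by
  unfold kernelForm
  rw [← integral_const_mul]
  refine integral_congr_ae (Eventually.of_forall fun p => ?_)
  simp only [Pi.smul_apply, smul_eq_mul]
  ring

theorem kernelForm_shift (f g : ℝ → ℝ) (c : ℝ) :
    kernelForm B (fun s => f (s - c)) (fun s => g (s - c)) = kernelForm B f g := by
  unfold kernelForm
  rw [← integral_sub_right_eq_self
    (fun p : ℝ × ℝ => f p.1 * g p.2 * B (p.1 - p.2)) ((c, c) : ℝ × ℝ)]
  refine integral_congr_ae (Eventually.of_forall fun p => ?_)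
  simp

end KernelForm

namespace TsirelsonKernel

variable {α : ℝ} (K : TsirelsonKernel α)

/-- The space `L²(ℝ)`, to be equipped with the scalar product
`⟨f, g⟩ = ∬ f(s) g(t) B(s - t) ds dt`. -/
def Pre (_K : TsirelsonKernel α) : Type := Lp ℝ 2 (volume : Measure ℝ)

instance : AddCommGroup K.Pre := inferInstanceAs (AddCommGroup (Lp ℝ 2 (volume : Measure ℝ)))

instance : Module ℝ K.Pre := inferInstanceAs (Module ℝ (Lp ℝ 2 (volume : Measure ℝ)))

/-- An element of `K.Pre`, seen as an element of `L²(ℝ)`. -/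
def toL2 : K.Pre ≃ₗ[ℝ] Lp ℝ 2 (volume : Measure ℝ) :=
  LinearEquiv.refl ℝ (Lp ℝ 2 (volume : Measure ℝ))

/-- The scalar product `⟨f, g⟩ = ∬ f(s) g(t) B(s - t) ds dt` on `L²(ℝ)`. -/
@[reducible] def core : PreInnerProductSpace.Core ℝ K.Pre where
  inner f g := kernelForm K.B (K.toL2 f) (K.toL2 g)
  conj_inner_symm f g := by
    simpa using kernelForm_symm K.even (K.toL2 g) (K.toL2 f)
  re_inner_nonneg f := by
    simpa using K.posDef _ (Lp.memLp (K.toL2 f))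
  add_left f f' g := by
    rw [map_add, kernelForm_congr (Lp.coeFn_add _ _) (EventuallyEq.refl _ _)]
    exact kernelForm_add_left K.integrable (Lp.memLp _) (Lp.memLp _) (Lp.memLp _)
  smul_left f g c := by
    rw [map_smul, kernelForm_congr (Lp.coeFn_smul _ _) (EventuallyEq.refl _ _)]
    simpa using kernelForm_smul_left c (K.toL2 f) (K.toL2 g)

instance : SeminormedAddCommGroup K.Pre :=
  @InnerProductSpace.Core.toSeminormedAddCommGroup ℝ K.Pre _ _ _ K.core

instance : InnerProductSpace ℝ K.Pre := InnerProductSpace.ofCore K.core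

theorem inner_def (f g : K.Pre) : ⟪f, g⟫ = kernelForm K.B (K.toL2 f) (K.toL2 g) := rfl

/-- The Hilbert space completion of `L²(ℝ)` with respect to this scalar product. -/
abbrev Space : Type := UniformSpace.Completion K.Pre

/-- The subspace `L²(a, b)` of `L²(ℝ)`: the functions that vanish outside `(a, b)`. -/
def L2on (a b : ℝ) : Submodule ℝ K.Pre where
  carrier := {f | ∀ᵐ x : ℝ, x ∉ Ioo a b → (K.toL2 f : ℝ → ℝ) x = 0}
  zero_mem' := by
    have h := Lp.coeFn_zero ℝ 2 (volume : Measure ℝ)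
    change ∀ᵐ x : ℝ, x ∉ Ioo a b → (K.toL2 0 : ℝ → ℝ) x = 0
    rw [map_zero]
    filter_upwards [h] with x hx _
    rw [hx, Pi.zero_apply]
  add_mem' {f g} hf hg := by
    change ∀ᵐ x : ℝ, x ∉ Ioo a b → (K.toL2 (f + g) : ℝ → ℝ) x = 0
    rw [map_add]
    filter_upwards [hf, hg, Lp.coeFn_add (K.toL2 f) (K.toL2 g)] with x h1 h2 h3 hx
    rw [h3, Pi.add_apply, h1 hx, h2 hx, add_zero]
  smul_mem' c f hf := by
    change ∀ᵐ x : ℝ, x ∉ Ioo a b → (K.toL2 (c • f) : ℝ → ℝ) x = 0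
    rw [map_smul]
    filter_upwards [hf, Lp.coeFn_smul c (K.toL2 f)] with x h1 h3 hx
    rw [h3, Pi.smul_apply, h1 hx, smul_zero]

theorem mem_L2on {a b : ℝ} {f : K.Pre} :
    f ∈ K.L2on a b ↔ ∀ᵐ x : ℝ, x ∉ Ioo a b → (K.toL2 f : ℝ → ℝ) x = 0 := Iff.rfl

/-- `G_(a,b)`, the completion of `L²(a, b)` with respect to the scalar product, realized as the
closure of `L²(a, b)` in the completion of `L²(ℝ)`. -/
def G (a b : ℝ) : Submodule ℝ K.Space :=
  ((K.L2on a b).map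
    (UniformSpace.Completion.toComplL (𝕜 := ℝ) (E := K.Pre)).toLinearMap).topologicalClosure

/-- The shift `(S_t f)(s) = f(s - t)` as a linear map on `L²(ℝ)`. -/
def shiftLM (t : ℝ) : K.Pre →ₗ[ℝ] K.Pre :=
  K.toL2.symm.toLinearMap ∘ₗ
    Lp.compMeasurePreservingₗ ℝ (fun s => s - t) (measurePreserving_sub_right volume t) ∘ₗ
    K.toL2.toLinearMap

theorem shiftLM_coeFn (t : ℝ) (f : K.Pre) :
    (K.toL2 (K.shiftLM t f) : ℝ → ℝ) =ᵐ[volume] fun s => (K.toL2 f : ℝ → ℝ) (s - t) :=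
  Lp.coeFn_compMeasurePreserving (K.toL2 f) (measurePreserving_sub_right volume t)

/-- The shift is isometric for the scalar product. -/
def shiftIsom (t : ℝ) : K.Pre →ₗᵢ[ℝ] K.Pre :=
  (K.shiftLM t).isometryOfInner fun f g => by
    rw [inner_def, inner_def, kernelForm_congr (K.shiftLM_coeFn t f) (K.shiftLM_coeFn t g)]
    exact kernelForm_shift _ _ t

/-- The shift `S_t`, extended by continuity to the completion. -/
def shift (t : ℝ) : K.Space →L[ℝ] K.Space :=
  (K.shiftIsom t).toContinuousLinearMap.completion

theorem shift_coe (t : ℝ) (f : K.Pre) :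
    K.shift t (f : K.Space) = ((K.shiftLM t f : K.Pre) : K.Space) :=
  UniformSpace.Completion.map_coe (K.shiftIsom t).toContinuousLinearMap.uniformContinuous f

theorem G_mono {a b a' b' : ℝ} (h : a' ≤ a) (h' : b ≤ b') : K.G a b ≤ K.G a' b' := by
  refine Submodule.topologicalClosure_mono (Submodule.map_mono fun f hf => ?_)
  rw [mem_L2on] at *
  filter_upwards [hf] with x hx hx'
  exact hx fun hx2 => hx' (Ioo_subset_Ioo h h' hx2)

theorem shift_mem {s a b : ℝ} {x : K.Space} (hx : x ∈ K.G a b) :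
    K.shift s x ∈ K.G (a + s) (b + s) := by
  have hmaps : MapsTo (K.shift s)
      ((K.L2on a b).map (UniformSpace.Completion.toComplL (𝕜 := ℝ) (E := K.Pre)).toLinearMap :
        Set K.Space)
      ((K.L2on (a + s) (b + s)).map
        (UniformSpace.Completion.toComplL (𝕜 := ℝ) (E := K.Pre)).toLinearMap : Set K.Space) := by
    rintro _ ⟨f, hf, rfl⟩
    refine ⟨K.shiftLM s f, ?_, (K.shift_coe s f).symm⟩
    have hf' : ∀ᵐ x : ℝ, x ∉ Ioo a b → (K.toL2 f : ℝ → ℝ) x = 0 := hf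
    change ∀ᵐ x : ℝ, x ∉ Ioo (a + s) (b + s) → (K.toL2 (K.shiftLM s f) : ℝ → ℝ) x = 0
    have h := (measurePreserving_sub_right volume s).quasiMeasurePreserving.ae hf'
    filter_upwards [h, K.shiftLM_coeFn s f] with x h1 h2 hx
    rw [h2]
    refine h1 fun hx' => hx ⟨?_, ?_⟩
    · linarith [hx'.1]
    · linarith [hx'.2]
  exact hmaps.closure (K.shift s).continuous hx

/-- The sum system `(G_(a,b), S_t)` of Tsirelson's example with kernel `B`. -/
def sumSystem : SumSystemData K.Space where
  G := K.G
  complete a b := (Submodule.isClosed_topologicalClosure _).completeSpace_coe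
  mono _ h _ h' := K.G_mono h h'
  S t := (K.shift t).toLinearMap
  S_mem {s t} _ _ x hx := by
    have h := K.shift_mem (s := s) hx
    rwa [zero_add, add_comm t s] at h

end TsirelsonKernel

end

/-! The kernel depends on `s - t` only, so the shifts are isometric. What needs an argument is the
quasi-orthogonality of `G_(0,s)` and `G_(s,u)` and the density of the vectors built from additive
units. Both rest on comparing the scalar product with Haar coefficients.

Lower bound. On `(0, l)` a convex nonincreasing nonnegative `B` is a positive mixture of a constant
and of triangles `(r - |t|)₊`, with density `B''(r)`; second differences of a smoothed `B` replace
`B''`. The quadratic form of a triangle at `f` is the mean square increment, with step `r`, of the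
primitive of `f`. Near `0`, `B''(r)` is at least a constant times `r⁻³ ln^{-α}(1/r)`. Mean square
increments at all scales control the increments over dyadic grids, hence the Haar coefficients `c_i`
of `f`: `∑ w_i c_i² ≤ ‖f‖²` with `w_i` of order `k^{1-α}` on level `k` (`exists_haarWeight`).

Upper bound. The scalar products of Haar functions of two adjacent intervals are double Haar
coefficients of the second primitive of `B` at `x + y`. The rows of level `k` have total square sum
`O(k^{-2α})`; division by `w_i²` leaves `k^{-2}`, which is summable (`tsum_haarMatrix_ne_top`).
Hence the projection from `G_(s,u)` to `G_(0,s)` is Hilbert-Schmidt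
(`IsWeightedExpansion.isHilbertSchmidt`). This makes the sum closed
(`IsHilbertSchmidt.isClosed_sup`) and produces the operator that makes the two spaces orthogonal
(`IsHilbertSchmidt.exists_inPosS`).

Units. The lower bound also makes `f ↦ ∫₀ᵇ f` bounded for the norm of `G_(0,l)`
(`exists_sq_integ_le`), so it has a representing vector `Y b`, and these vectors separate the points
of the completion (`eq_zero_of_represents`). This gives `G_(0,s) ∩ G_(s,u) = 0`. The indicators of
`(0,t)` form a real unit; their shifts are total already in `L²`. The vectors representing `f ↦ ∫₀ᵗ
f` form an imaginary unit, and the associated `y'` represent `f ↦ ∫ f` over `(s₁, s₂)`. If `r` is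
orthogonal to all of them, then `b ↦ ⟪Y b, r⟫` is constant, and it vanishes at `0`; so `r = 0`. -/

noncomputable section

/-! ### Hilbert-Schmidt operators -/

section HilbertSchmidt

variable {E F H : Type*} [NormedAddCommGroup E] [InnerProductSpace ℝ E]
  [NormedAddCommGroup F] [InnerProductSpace ℝ F] [NormedAddCommGroup H] [InnerProductSpace ℝ H]

theorem HilbertBasis.tsum_ofReal_inner_sq {ι : Type*} (b : HilbertBasis ι ℝ E) (x : E) :
    ∑' i, ENNReal.ofReal (⟪b i, x⟫ ^ 2) = ENNReal.ofReal (‖x‖ ^ 2) := by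
  have h := b.hasSum_inner_mul_inner x x
  have h2 : HasSum (fun i => ⟪b i, x⟫ ^ 2) (‖x‖ ^ 2) := by
    rw [← real_inner_self_eq_norm_sq]
    refine h.congr_fun fun i => ?_
    rw [real_inner_comm, sq]
  rw [← ENNReal.ofReal_tsum_of_nonneg (fun i => sq_nonneg _) h2.summable, h2.tsum_eq]

/-- By Parseval in `F` and in `E`, both sides are the double sum of `⟪c k, T (b i)⟫²`, and
nonnegative terms may be reordered. Going to the adjoint and back shows that the sum does not depend
on the basis of `E`. -/
theorem tsum_norm_sq_eq_adjoint [CompleteSpace E] [CompleteSpace F] {ι κ : Type*}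
    (b : HilbertBasis ι ℝ E) (c : HilbertBasis κ ℝ F) (T : E →L[ℝ] F) :
    ∑' i, ENNReal.ofReal (‖T (b i)‖ ^ 2)
      = ∑' k, ENNReal.ofReal (‖ContinuousLinearMap.adjoint T (c k)‖ ^ 2) := by
  simp_rw [← c.tsum_ofReal_inner_sq, ← b.tsum_ofReal_inner_sq]
  rw [ENNReal.tsum_comm]
  refine tsum_congr fun k => tsum_congr fun i => ?_
  rw [ContinuousLinearMap.adjoint_inner_right, real_inner_comm]

theorem summable_norm_sq_iff {ι F : Type*} [NormedAddCommGroup F] (g : ι → F) :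
    (Summable fun i => ‖g i‖ ^ 2) ↔ ∑' i, ENNReal.ofReal (‖g i‖ ^ 2) ≠ ⊤ :=
  ⟨fun h => h.tsum_ofReal_ne_top, fun h => by
    have h1 := ENNReal.summable_toReal h
    refine h1.congr fun i => ?_
    rw [ENNReal.toReal_ofReal (sq_nonneg _)]⟩

theorem isHilbertSchmidt_iff [CompleteSpace E] [CompleteSpace F] {ι : Type*}
    (b : HilbertBasis ι ℝ E) (T : E →L[ℝ] F) :
    IsHilbertSchmidt T ↔ ∑' i, ENNReal.ofReal (‖T (b i)‖ ^ 2) ≠ ⊤ := by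
  obtain ⟨w, c, -⟩ := exists_hilbertBasis ℝ F
  constructor
  · rintro ⟨w', b', h⟩
    rw [summable_norm_sq_iff] at h
    rwa [tsum_norm_sq_eq_adjoint b c, ← tsum_norm_sq_eq_adjoint b' c]
  · intro h
    obtain ⟨w', b', -⟩ := exists_hilbertBasis ℝ E
    refine ⟨w', b', ?_⟩
    rw [summable_norm_sq_iff]
    rwa [tsum_norm_sq_eq_adjoint b' c, ← tsum_norm_sq_eq_adjoint b c]

theorem IsHilbertSchmidt.adjoint [CompleteSpace E] [CompleteSpace F] {T : E →L[ℝ] F}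
    (h : IsHilbertSchmidt T) : IsHilbertSchmidt (ContinuousLinearMap.adjoint T) := by
  obtain ⟨w, c, -⟩ := exists_hilbertBasis ℝ F
  obtain ⟨w', b, -⟩ := exists_hilbertBasis ℝ E
  rw [isHilbertSchmidt_iff c, ← tsum_norm_sq_eq_adjoint b c]
  exact (isHilbertSchmidt_iff b T).1 h

theorem IsHilbertSchmidt.comp_left {T : E →L[ℝ] F} (h : IsHilbertSchmidt T) (A : F →L[ℝ] H) :
    IsHilbertSchmidt (A ∘L T) := by
  obtain ⟨w, b, hb⟩ := h
  refine ⟨w, b, (hb.mul_left (‖A‖ ^ 2)).of_nonneg_of_le (fun i => sq_nonneg _) fun i => ?_⟩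
  rw [← mul_pow]
  exact pow_le_pow_left₀ (norm_nonneg _) (A.le_opNorm _) 2

/-- `A` need not send an orthonormal basis to an orthogonal family, so the easy ideal property
`comp_left` is applied to the adjoints instead. -/
theorem IsHilbertSchmidt.comp_right [CompleteSpace E] [CompleteSpace F] [CompleteSpace H]
    {T : E →L[ℝ] F} (h : IsHilbertSchmidt T) (A : H →L[ℝ] E) : IsHilbertSchmidt (T ∘L A) := by
  have h1 := (h.adjoint.comp_left (ContinuousLinearMap.adjoint A)).adjoint
  rwa [← ContinuousLinearMap.adjoint_comp, ContinuousLinearMap.adjoint_adjoint] at h1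

theorem IsHilbertSchmidt.smul {T : E →L[ℝ] F} (h : IsHilbertSchmidt T) (c : ℝ) :
    IsHilbertSchmidt (c • T) := by
  obtain ⟨w, b, hb⟩ := h
  refine ⟨w, b, (hb.mul_left (‖c‖ ^ 2)).congr fun i => ?_⟩
  rw [smul_apply, norm_smul, mul_pow]

theorem IsHilbertSchmidt.add [CompleteSpace E] [CompleteSpace F] {S T : E →L[ℝ] F}
    (hS : IsHilbertSchmidt S) (hT : IsHilbertSchmidt T) : IsHilbertSchmidt (S + T) := by
  obtain ⟨w, b, hb⟩ := hS
  have hT' := (summable_norm_sq_iff _).2 ((isHilbertSchmidt_iff b T).1 hT)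
  refine ⟨w, b, ((hb.add hT').mul_left 2).of_nonneg_of_le (fun i => sq_nonneg _) fun i => ?_⟩
  rw [add_apply]
  have := norm_add_le (S (b i)) (T (b i))
  nlinarith [sq_nonneg (‖S (b i)‖ - ‖T (b i)‖), norm_nonneg (S (b i) + T (b i))]

theorem isHilbertSchmidt_zero [CompleteSpace E] : IsHilbertSchmidt (0 : E →L[ℝ] F) := by
  obtain ⟨w, b, -⟩ := exists_hilbertBasis ℝ E
  exact ⟨w, b, by simp⟩

/-- A Hilbert-Schmidt operator has small norm on the orthogonal complement of finitely many
vectors. -/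
theorem HilbertBasis.exists_finset_norm_le {ι : Type*} (b : HilbertBasis ι ℝ E) {T : E →L[ℝ] F}
    (h : Summable fun i => ‖T (b i)‖ ^ 2) {ε : ℝ} (hε : 0 < ε) :
    ∃ s : Finset ι, ∀ y : E, (∀ i ∈ s, ⟪b i, y⟫ = 0) → ‖T y‖ ≤ ε * ‖y‖ := by
  classical
  -- Outside `s` the squares `‖T (b i)‖²` sum to less than `ε²`; for `y` orthogonal to the vectors
  -- of `s`, Cauchy-Schwarz and Bessel bound the remaining expansion of `T y`.
  obtain ⟨s, hs⟩ := (summable_iff_vanishing_norm.1 h) (ε ^ 2) (by positivity)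
  refine ⟨s, fun y hy => ?_⟩
  have h1 : HasSum (fun i => ⟪b i, y⟫ • b i) y := by
    simpa [HilbertBasis.repr_apply_apply] using b.hasSum_repr y
  have h2 : HasSum (fun i => ⟪b i, y⟫ • T (b i)) (T y) := by
    simpa using T.hasSum h1
  refine le_of_tendsto h2.norm (Eventually.of_forall fun t => ?_)
  have h3 : ∑ i ∈ t, ⟪b i, y⟫ • T (b i) = ∑ i ∈ t \ s, ⟪b i, y⟫ • T (b i) := by
    refine (Finset.sum_subset Finset.sdiff_subset fun i hi hi' => ?_).symm
    have : i ∈ s := by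
      by_contra h
      exact hi' (Finset.mem_sdiff.2 ⟨hi, h⟩)
    rw [hy i this, zero_smul]
  rw [h3]
  refine abs_le_of_sq_le_sq' ?_ (by positivity) |>.2
  have h4 := b.orthonormal.sum_inner_products_le (s := t \ s) y
  have h5 := hs (t \ s) Finset.sdiff_disjoint
  rw [Real.norm_of_nonneg (Finset.sum_nonneg fun i _ => sq_nonneg _)] at h5
  calc ‖∑ i ∈ t \ s, ⟪b i, y⟫ • T (b i)‖ ^ 2
      ≤ (∑ i ∈ t \ s, ‖⟪b i, y⟫‖ * ‖T (b i)‖) ^ 2 := by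
        gcongr
        refine (norm_sum_le _ _).trans (Finset.sum_le_sum fun i _ => ?_)
        rw [norm_smul]
    _ ≤ (∑ i ∈ t \ s, ‖⟪b i, y⟫‖ ^ 2) * ∑ i ∈ t \ s, ‖T (b i)‖ ^ 2 :=
        Finset.sum_mul_sq_le_sq_mul_sq _ _ _
    _ ≤ ‖y‖ ^ 2 * ε ^ 2 := by
        gcongr
    _ = (ε * ‖y‖) ^ 2 := by ring

end HilbertSchmidt

/-! ### Closed sums and quasi-orthogonality from a Hilbert-Schmidt angle -/

section QuasiOrthogonal

variable {E : Type*} [NormedAddCommGroup E] [InnerProductSpace ℝ E] [CompleteSpace E]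

/-- Two closed subspaces at a positive angle have a closed sum. -/
theorem Submodule.isClosed_sup_of_inner_le {G₁ G₂ : Submodule ℝ E} (h₁ : IsClosed (G₁ : Set E))
    (h₂ : IsClosed (G₂ : Set E)) (h : ∀ x ∈ G₁, ∀ y ∈ G₂, |⟪x, y⟫| ≤ 1 / 2 * (‖x‖ * ‖y‖)) :
    IsClosed ((G₁ ⊔ G₂ : Submodule ℝ E) : Set E) := by
  have := h₁.completeSpace_coe
  have := h₂.completeSpace_coe
  let Φ : (G₁ × G₂) →L[ℝ] E := G₁.subtypeL.coprod G₂.subtypeL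
  have hr : ((G₁ ⊔ G₂ : Submodule ℝ E) : Set E) = Set.range Φ := by
    ext z
    simp only [SetLike.mem_coe, Submodule.mem_sup, Set.mem_range]
    constructor
    · rintro ⟨x, hx, y, hy, rfl⟩
      exact ⟨(⟨x, hx⟩, ⟨y, hy⟩), rfl⟩
    · rintro ⟨⟨x, y⟩, rfl⟩
      exact ⟨x, x.2, y, y.2, rfl⟩
  rw [hr]
  have hanti : AntilipschitzWith 2 Φ := by
    refine ContinuousLinearMap.antilipschitz_of_bound Φ fun p => ?_
    obtain ⟨x, y⟩ := p
    have h3 := neg_le_of_abs_le (h x x.2 y y.2)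
    have h4 : ‖(x : E) + y‖ ^ 2 = ‖x‖ ^ 2 + 2 * ⟪(x : E), y⟫ + ‖y‖ ^ 2 := by
      rw [norm_add_sq_real]; simp
    -- The hypothesis gives `2 |⟪x, y⟫| ≤ ‖x‖ ‖y‖ ≤ (‖x‖² + ‖y‖²) / 2`. So the sum map is bounded
    -- below, and a map bounded below on a complete space has closed range.
    have h5 : ‖x‖ ^ 2 + ‖y‖ ^ 2 ≤ 2 * ‖(x : E) + y‖ ^ 2 := by
      simp only [Submodule.coe_norm] at *
      nlinarith [sq_nonneg (‖(x : E)‖ - ‖(y : E)‖)]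
    have h6 : Φ (x, y) = (x : E) + y := rfl
    rw [h6, Prod.norm_def]
    refine max_le ?_ ?_ <;> refine abs_le_of_sq_le_sq' ?_ (by positivity) |>.2 <;>
      push_cast <;> nlinarith [sq_nonneg ‖x‖, sq_nonneg ‖y‖, sq_nonneg ‖(x : E) + y‖]
  exact hanti.isClosed_range Φ.uniformContinuous

/-- If the angle operator between two closed subspaces is Hilbert-Schmidt, then their sum is
closed. -/
theorem IsHilbertSchmidt.isClosed_sup {G₁ G₂ : Submodule ℝ E} [G₁.HasOrthogonalProjection]
    (h₁ : IsClosed (G₁ : Set E)) (h₂ : IsClosed (G₂ : Set E))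
    (h : IsHilbertSchmidt (G₁.starProjection ∘L G₂.subtypeL)) :
    IsClosed ((G₁ ⊔ G₂ : Submodule ℝ E) : Set E) := by
  classical
  obtain ⟨w, b, hb⟩ := h
  obtain ⟨s, hs⟩ := b.exists_finset_norm_le hb (ε := 1 / 2) (by norm_num)
  -- `T` is spanned by the finitely many basis vectors that carry most of the Hilbert-Schmidt norm.
  -- On `W`, the rest of `G₂`, the projection to `G₁` has norm at most `1/2`, so `G₁ ⊔ W` is closed;
  -- adding the finite-dimensional `T` keeps it closed.
  let T : Submodule ℝ E := Submodule.span ℝ (Set.range fun i : s => (b i : E))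
  let W : Submodule ℝ E := G₂ ⊓ Tᗮ
  have : FiniteDimensional ℝ T := FiniteDimensional.span_of_finite ℝ (Set.finite_range _)
  have hT : T ≤ G₂ := Submodule.span_le.2 (by rintro _ ⟨i, rfl⟩; exact (b i).2)
  have hW : IsClosed (W : Set E) := h₂.inter (Submodule.isClosed_orthogonal T)
  have hsup : T ⊔ W = G₂ := by
    simp only [W]
    rw [inf_comm]
    exact Submodule.sup_orthogonal_inf_of_hasOrthogonalProjection hT
  rw [← hsup, sup_comm T W, ← sup_assoc]
  refine Submodule.isClosed_sup_finiteDimensional _ _ ?_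
  refine Submodule.isClosed_sup_of_inner_le h₁ hW fun x hx y hy => ?_
  have h3 : ⟪x, y⟫ = ⟪x, G₁.starProjection y⟫ := by
    rw [← Submodule.inner_starProjection_left_eq_right,
      Submodule.starProjection_eq_self_iff.2 hx]
  have h4 := hs ⟨y, hy.1⟩ fun i hi => by
    have := (Submodule.mem_orthogonal T y).1 hy.2 (b i) (Submodule.subset_span ⟨⟨i, hi⟩, rfl⟩)
    simpa using this
  have h5 : ‖G₁.starProjection y‖ ≤ 1 / 2 * ‖y‖ := h4
  rw [h3]
  refine (abs_real_inner_le_norm _ _).trans ?_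
  nlinarith [norm_nonneg x]

/-- Complementary closed subspaces with Hilbert-Schmidt angle operator can be made orthogonal by
an operator of class `𝒮`. -/
theorem IsHilbertSchmidt.exists_inPosS {G₁ G₂ : Submodule ℝ E} [G₁.HasOrthogonalProjection]
    (h₁ : IsClosed (G₁ : Set E)) (h₂ : IsClosed (G₂ : Set E)) (hc : IsCompl G₁ G₂)
    (h : IsHilbertSchmidt (G₁.starProjection ∘L G₂.subtypeL)) :
    ∃ A : E →L[ℝ] E, InPosS A ∧ ∀ x ∈ G₁, ∀ y ∈ G₂, ⟪A x, A y⟫ = 0 := by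
  have := h₂.completeSpace_coe
  have ht := Submodule.IsCompl.isTopCompl_of_isClosed hc h₁ h₂
  let Q : E →L[ℝ] G₂ := G₂.projectionOntoL G₁ ht.symm
  let l : E →L[ℝ] E := (G₁.starProjection ∘L G₂.subtypeL) ∘L Q
  have hl : IsHilbertSchmidt l := h.comp_right Q
  have hQ₁ : ∀ x ∈ G₁, Q x = 0 := fun x hx => by
    simp only [Q]; rw [Submodule.coe_projectionOntoL]
    exact Submodule.projectionOnto_apply_of_mem_right _ hx
  have hQ₂ : ∀ y ∈ G₂, (Q y : E) = y := fun y hy => by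
    simp only [Q]; rw [Submodule.coe_projectionOntoL, Submodule.projectionOnto_apply_of_mem_left _ hy]
  have hl₁ : ∀ x ∈ G₁, l x = 0 := fun x hx => by
    simp only [l, ContinuousLinearMap.comp_apply, hQ₁ x hx, map_zero]
  have hlm : ∀ x, l x ∈ G₁ := fun x => Submodule.starProjection_apply_mem _ _
  have hl₂ : ∀ y ∈ G₂, l y = G₁.starProjection y := fun y hy => by
    change G₁.starProjection (Q y : E) = _
    rw [hQ₂ y hy]
  let m := ContinuousLinearMap.adjoint l
  -- `I - l` fixes `G₁` and sends `y ∈ G₂` to its component orthogonal to `G₁`. The operator chosen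
  -- here equals `½ (I + (I - l)* (I - l))`: it is symmetric and at least `½`, hence invertible, and
  -- `I - A` contains only terms with a factor `l` or `l*`.
  let A : E →L[ℝ] E := ContinuousLinearMap.id ℝ E - (1 / 2 : ℝ) • (l + m) + (1 / 2 : ℝ) • (m ∘L l)
  have hA : ∀ x, A x = x - (1 / 2 : ℝ) • (l x + m x) + (1 / 2 : ℝ) • m (l x) := fun x => rfl
  have hml : ∀ x y, ⟪m x, y⟫ = ⟪x, l y⟫ := fun x y => ContinuousLinearMap.adjoint_inner_left l y x
  have hlm' : ∀ x y, ⟪x, m y⟫ = ⟪l x, y⟫ := fun x y => ContinuousLinearMap.adjoint_inner_right l x y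
  have hsymm : ∀ x y, ⟪A x, y⟫ = ⟪x, A y⟫ := fun x y => by
    simp only [hA, inner_add_left, inner_sub_left, inner_smul_left, inner_add_right,
      inner_sub_right, inner_smul_right, hml, hlm', RCLike.conj_to_real]
    ring
  have hcoer : ∀ x, 1 / 2 * ‖x‖ ^ 2 ≤ ⟪A x, x⟫ := fun x => by
    have h1 : ⟪A x, x⟫ = ‖x‖ ^ 2 - ⟪x, l x⟫ + 1 / 2 * ‖l x‖ ^ 2 := by
      simp only [hA, inner_add_left, inner_sub_left, inner_smul_left, hml, RCLike.conj_to_real,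
        real_inner_self_eq_norm_sq]
      rw [real_inner_comm (l x) x]
      ring
    have h2 := abs_le.1 (abs_real_inner_le_norm x (l x))
    rw [h1]
    nlinarith [sq_nonneg (‖x‖ - ‖l x‖)]
  refine ⟨A, ⟨?_, ?_, ?_⟩, fun x hx y hy => ?_⟩
  · rw [ContinuousLinearMap.isPositive_iff]
    exact ⟨hsymm, fun x => le_trans (by positivity) (hcoer x)⟩
  · have hu : IsUnit A := by
      refine ContinuousLinearMap.isUnit_of_forall_le_norm_inner_map A (c := 1 / 2) (by norm_num)
        fun x => ?_
      have := (hcoer x).trans (le_abs_self _)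
      simp only [Real.norm_eq_abs]
      refine le_trans (le_of_eq ?_) this
      push_cast; ring
    obtain ⟨u, hu⟩ := hu
    refine ContinuousLinearMap.IsInvertible.of_inverse (g := (↑u⁻¹ : E →L[ℝ] E)) ?_ ?_
    · rw [← hu]; exact u.mul_inv
    · rw [← hu]; exact u.inv_mul
  · have h1 : ContinuousLinearMap.id ℝ E - A
        = (1 / 2 : ℝ) • (l + m) + (-(1 / 2) : ℝ) • (m ∘L l) := by
      simp only [A]; module
    rw [h1]
    exact ((hl.add hl.adjoint).smul _).add ((hl.comp_left m).smul _)
  · have h1 : A x = x - (1 / 2 : ℝ) • m x := by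
      rw [hA, hl₁ x hx, map_zero]; module
    -- Against vectors of `G₁`, `y` may be replaced by `l y`. With `l ∘ l = 0` and `l x = 0`, all
    -- terms of `⟪A x, A y⟫` then cancel in pairs.
    have h2 : ∀ z ∈ G₁, ⟪z, y⟫ = ⟪z, l y⟫ := fun z hz => by
      rw [hl₂ y hy, ← Submodule.inner_starProjection_left_eq_right,
        Submodule.starProjection_eq_self_iff.2 hz]
    have h3 : l (l y) = 0 := hl₁ _ (hlm y)
    rw [h1, hA]
    simp only [inner_sub_left, inner_smul_left, inner_add_right, inner_sub_right,
      inner_smul_right, hml, hlm', RCLike.conj_to_real, h3, hl₁ x hx, inner_zero_left,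
      inner_zero_right, map_sub, map_smul]
    have h4 := h2 (l (m x)) (hlm _)
    rw [h2 x hx]
    linarith

end QuasiOrthogonal

/-! ### Expansions with weighted coefficients -/

section WeightedExpansion

variable {V : Type*} [NormedAddCommGroup V] [InnerProductSpace ℝ V] {ι κ : Type*}

/-- Every vector `f ∈ D` has a finite expansion `f = ∑ ⟪yᵢ, f⟫ eᵢ`, the weighted square sum of whose
coefficients is controlled by `‖f‖²`. -/
structure IsWeightedExpansion (D : Set V) (e y : ι → V) (w : ι → ℝ) : Prop where
  pos : ∀ i, 0 < w i
  bound : ∀ f ∈ D, ∀ F : Finset ι, ∑ i ∈ F, w i * ⟪y i, f⟫ ^ 2 ≤ ‖f‖ ^ 2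
  expand : ∀ f ∈ D, ∃ F : Finset ι, f = ∑ i ∈ F, ⟪y i, f⟫ • e i

namespace IsWeightedExpansion

variable {D : Set V} {e y : ι → V} {w : ι → ℝ}

theorem map {V' : Type*} [NormedAddCommGroup V'] [InnerProductSpace ℝ V']
    (h : IsWeightedExpansion D e y w) (τ : V →ₗᵢ[ℝ] V') :
    IsWeightedExpansion (τ '' D) (τ ∘ e) (τ ∘ y) w where
  pos := h.pos
  bound := by
    rintro _ ⟨f, hf, rfl⟩ F
    simpa using h.bound f hf F
  expand := by
    rintro _ ⟨f, hf, rfl⟩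
    obtain ⟨F, hF⟩ := h.expand f hf
    refine ⟨F, ?_⟩
    conv_lhs => rw [hF]
    simp

theorem sq_sum_le (h : IsWeightedExpansion D e y w) {f : V} (hf : f ∈ D) (F : Finset ι)
    (c : ι → ℝ) :
    (∑ i ∈ F, ⟪y i, f⟫ * c i) ^ 2 ≤ ‖f‖ ^ 2 * ∑ i ∈ F, (w i)⁻¹ * c i ^ 2 := by
  have h1 := Finset.sum_mul_sq_le_sq_mul_sq F (fun i => √(w i) * ⟪y i, f⟫)
    (fun i => (√(w i))⁻¹ * c i)
  have h2 : ∀ i, √(w i) * ⟪y i, f⟫ * ((√(w i))⁻¹ * c i) = ⟪y i, f⟫ * c i := fun i => by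
    have := (Real.sqrt_pos.2 (h.pos i)).ne'
    field_simp
  have h3 : ∀ i, (√(w i) * ⟪y i, f⟫) ^ 2 = w i * ⟪y i, f⟫ ^ 2 := fun i => by
    rw [mul_pow, Real.sq_sqrt (h.pos i).le]
  have h4 : ∀ i, ((√(w i))⁻¹ * c i) ^ 2 = (w i)⁻¹ * c i ^ 2 := fun i => by
    rw [mul_pow, inv_pow, Real.sq_sqrt (h.pos i).le]
  simp only [h2, h3, h4] at h1
  refine h1.trans (mul_le_mul_of_nonneg_right (h.bound f hf F) ?_)
  exact Finset.sum_nonneg fun i _ => mul_nonneg (inv_nonneg.2 (h.pos i).le) (sq_nonneg _)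

/-- Weighted Cauchy-Schwarz on the finite expansion of an element of `D`. The inequality is closed
in `f`, so it survives on the closure, where no expansion need exist. -/
theorem inner_sq_le (h : IsWeightedExpansion D e y w) {g : V}
    (hg : Summable fun i => (w i)⁻¹ * ⟪e i, g⟫ ^ 2) {f : V} (hf : f ∈ closure D) :
    ⟪f, g⟫ ^ 2 ≤ ‖f‖ ^ 2 * ∑' i, (w i)⁻¹ * ⟪e i, g⟫ ^ 2 := by
  have hcl : IsClosed {f : V | ⟪f, g⟫ ^ 2 ≤ ‖f‖ ^ 2 * ∑' i, (w i)⁻¹ * ⟪e i, g⟫ ^ 2} :=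
    isClosed_le (by fun_prop) (by fun_prop)
  refine closure_minimal (fun f hf => ?_) hcl hf
  obtain ⟨F, hF⟩ := h.expand f hf
  have h1 : ⟪f, g⟫ = ∑ i ∈ F, ⟪y i, f⟫ * ⟪e i, g⟫ := by
    conv_lhs => rw [hF]
    simp [sum_inner, inner_smul_left]
  rw [mem_ofPred_eq, h1]
  refine (h.sq_sum_le hf F _).trans (mul_le_mul_of_nonneg_left ?_ (sq_nonneg _))
  exact hg.sum_le_tsum F fun i _ => mul_nonneg (inv_nonneg.2 (h.pos i).le) (sq_nonneg _)

/-- Take `f = P g` in `inner_sq_le`: then `⟪f, g⟫ = ‖P g‖²`, and one factor `‖P g‖²` cancels. The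
values lie in `[0, ∞]`, so summability is not needed. -/
theorem norm_starProjection_sq_le (h : IsWeightedExpansion D e y w) (U : Submodule ℝ V)
    [U.HasOrthogonalProjection] (hU : (U : Set V) ⊆ closure D) (g : V) :
    ENNReal.ofReal (‖U.starProjection g‖ ^ 2)
      ≤ ∑' i, ENNReal.ofReal ((w i)⁻¹ * ⟪e i, g⟫ ^ 2) := by
  have hnn : ∀ i, 0 ≤ (w i)⁻¹ * ⟪e i, g⟫ ^ 2 := fun i =>
    mul_nonneg (inv_nonneg.2 (h.pos i).le) (sq_nonneg _)
  by_cases htop : ∑' i, ENNReal.ofReal ((w i)⁻¹ * ⟪e i, g⟫ ^ 2) = ⊤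
  · rw [htop]; exact le_top
  have hs : Summable fun i => (w i)⁻¹ * ⟪e i, g⟫ ^ 2 :=
    (ENNReal.summable_toReal htop).congr fun i => ENNReal.toReal_ofReal (hnn i)
  rw [← ENNReal.ofReal_tsum_of_nonneg hnn hs]
  refine ENNReal.ofReal_le_ofReal ?_
  have h1 := h.inner_sq_le hs (hU (Submodule.starProjection_apply_mem U g))
  have h2 : ⟪U.starProjection g, g⟫ = ‖U.starProjection g‖ ^ 2 := by
    rw [← real_inner_self_eq_norm_sq, Submodule.inner_starProjection_left_eq_right,
      Submodule.inner_starProjection_left_eq_right,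
      Submodule.starProjection_eq_self_iff.2 (Submodule.starProjection_apply_mem U g)]
  rw [h2] at h1
  by_cases h0 : ‖U.starProjection g‖ ^ 2 = 0
  · rw [h0]; exact tsum_nonneg hnn
  · have : 0 < ‖U.starProjection g‖ ^ 2 := lt_of_le_of_ne (sq_nonneg _) (Ne.symm h0)
    nlinarith

/-- The vector `x` has no expansion of its own. For `f ∈ D` the head of `⟪f, g⟫` is a finite
combination of the `⟪y i, f⟫`, which vanishes in the limit `f → x`, while the tail is at most `ε
‖f‖` by Cauchy-Schwarz. -/
theorem inner_eq_zero (h : IsWeightedExpansion D e y w) {g : V}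
    (hg : Summable fun i => (w i)⁻¹ * ⟪e i, g⟫ ^ 2) {x : V} (hx : x ∈ closure D)
    (hy : ∀ i, ⟪y i, x⟫ = 0) : ⟪x, g⟫ = 0 := by
  classical
  have key : ∀ ε > 0, |⟪x, g⟫| ≤ ‖x‖ * ε := by
    intro ε hε
    obtain ⟨s, hs⟩ := (summable_iff_vanishing_norm.1 hg) (ε ^ 2) (by positivity)
    have hcl : IsClosed {f : V | |⟪f, g⟫| ≤ ∑ i ∈ s, |⟪y i, f⟫ * ⟪e i, g⟫| + ‖f‖ * ε} :=
      isClosed_le (by fun_prop) (by fun_prop)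
    have h1 := closure_minimal (fun f hf => ?_) hcl hx
    · simpa [hy] using h1
    obtain ⟨F, hF⟩ := h.expand f hf
    have h1 : ⟪f, g⟫ = ∑ i ∈ F, ⟪y i, f⟫ * ⟪e i, g⟫ := by
      conv_lhs => rw [hF]
      simp [sum_inner, inner_smul_left]
    rw [mem_ofPred_eq, h1, ← Finset.sum_sdiff (Finset.inter_subset_left (s₁ := F) (s₂ := s)),
      add_comm]
    refine (abs_add_le _ _).trans (add_le_add ?_ ?_)
    · refine (Finset.abs_sum_le_sum_abs _ _).trans ?_
      exact Finset.sum_le_sum_of_subset_of_nonneg Finset.inter_subset_right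
        fun _ _ _ => abs_nonneg _
    · refine abs_le_of_sq_le_sq ?_ (by positivity)
      refine (h.sq_sum_le hf _ _).trans ?_
      rw [mul_pow]
      refine mul_le_mul_of_nonneg_left ?_ (sq_nonneg _)
      refine (le_abs_self _).trans (hs _ ?_).le
      rw [Finset.disjoint_left]
      intro i hi hi'
      simp only [Finset.mem_sdiff, Finset.mem_inter, not_and] at hi
      exact hi.2 hi.1 hi'
  have h2 : |⟪x, g⟫| ≤ 0 := by
    have h3 : Tendsto (fun ε : ℝ => ‖x‖ * ε) (𝓝[>] 0) (𝓝 0) := by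
      have : Tendsto (fun ε : ℝ => ‖x‖ * ε) (𝓝 0) (𝓝 (‖x‖ * 0)) := by
        exact (continuous_const.mul continuous_id).tendsto 0
      rw [mul_zero] at this
      exact this.mono_left nhdsWithin_le_nhds
    exact ge_of_tendsto h3 (eventually_mem_nhdsWithin.mono fun ε hε => key ε hε)
  exact abs_eq_zero.1 (le_antisymm h2 (abs_nonneg _))

/-- The projection bound is used twice. First it estimates each `‖P_U b_k‖²` by the `⟪e i, b_k⟫²`;
summation over `k` turns these into `‖P_{U'} (e i)‖²`, and the expansion on the side of `U'` bounds
them by the `⟪e i, e' j⟫²`. -/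
theorem isHilbertSchmidt {D' : Set V} {e' y' : κ → V} {w' : κ → ℝ}
    (h : IsWeightedExpansion D e y w) (h' : IsWeightedExpansion D' e' y' w')
    (hs : ∑' i, ∑' j, ENNReal.ofReal ((w i)⁻¹ * (w' j)⁻¹ * ⟪e i, e' j⟫ ^ 2) ≠ ⊤)
    (U U' : Submodule ℝ V) [CompleteSpace V] [CompleteSpace U] [CompleteSpace U']
    (hU : (U : Set V) ⊆ closure D) (hU' : (U' : Set V) ⊆ closure D') :
    IsHilbertSchmidt (U.starProjection ∘L U'.subtypeL) := by
  obtain ⟨s, b, -⟩ := exists_hilbertBasis ℝ U'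
  rw [isHilbertSchmidt_iff b]
  refine ne_top_of_le_ne_top hs ?_
  have hw : ∀ i, 0 ≤ (w i)⁻¹ := fun i => inv_nonneg.2 (h.pos i).le
  calc ∑' k, ENNReal.ofReal (‖(U.starProjection ∘L U'.subtypeL) (b k)‖ ^ 2)
      ≤ ∑' k, ∑' i, ENNReal.ofReal ((w i)⁻¹ * ⟪e i, (b k : V)⟫ ^ 2) :=
        ENNReal.tsum_le_tsum fun k => h.norm_starProjection_sq_le U hU (b k : V)
    _ = ∑' i, ENNReal.ofReal ((w i)⁻¹) * ENNReal.ofReal (‖U'.starProjection (e i)‖ ^ 2) := by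
        rw [ENNReal.tsum_comm]
        refine tsum_congr fun i => ?_
        have h1 := b.tsum_ofReal_inner_sq (U'.orthogonalProjectionOnto (e i))
        rw [show ‖U'.starProjection (e i)‖ = ‖U'.orthogonalProjectionOnto (e i)‖ from rfl, ← h1,
          ← ENNReal.tsum_mul_left]
        refine tsum_congr fun k => ?_
        rw [ENNReal.ofReal_mul (hw i)]
        congr 3
        rw [real_inner_comm, Submodule.coe_inner]
        change _ = ⟪(b k : V), U'.starProjection (e i)⟫
        rw [← Submodule.inner_starProjection_left_eq_right,
          Submodule.starProjection_eq_self_iff.2 (b k).2]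
    _ ≤ ∑' i, ∑' j, ENNReal.ofReal ((w i)⁻¹ * (w' j)⁻¹ * ⟪e i, e' j⟫ ^ 2) := by
        refine ENNReal.tsum_le_tsum fun i => ?_
        refine (mul_le_mul_right (h'.norm_starProjection_sq_le U' hU' (e i)) _).trans ?_
        rw [← ENNReal.tsum_mul_left]
        refine ENNReal.tsum_le_tsum fun j => ?_
        rw [← ENNReal.ofReal_mul (hw i), real_inner_comm, mul_assoc]

end IsWeightedExpansion
end WeightedExpansion

/-! ### The Haar system of an interval -/

section HaarCoefficients

/-- The indices of the Haar system of an interval: `none` for the constant function,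
`some ⟨k, m⟩` for the Haar function of the `m`-th dyadic interval of level `k`. -/
abbrev HaarIndex : Type := Option (Σ k : ℕ, Fin (2 ^ k))

/-- The indices of level less than `n`. -/
def haarLevels (n : ℕ) : Finset HaarIndex :=
  Finset.insertNone ((Finset.range n).sigma fun _ => Finset.univ)

theorem exists_subset_haarLevels (F : Finset HaarIndex) : ∃ n, F ⊆ haarLevels n := by
  classical
  induction F using Finset.induction_on with
  | empty => exact ⟨0, Finset.empty_subset _⟩
  | insert i F _ ih =>
    obtain ⟨n, hn⟩ := ih
    have hmono : ∀ {a b : ℕ}, a ≤ b → haarLevels a ⊆ haarLevels b := fun {a b} hab => by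
      refine Finset.insertNone.monotone (Finset.sigma_mono (Finset.range_mono hab) fun _ => ?_)
      exact le_rfl
    cases i with
    | none =>
      refine ⟨n, Finset.insert_subset ?_ hn⟩
      simp [haarLevels]
    | some i =>
      refine ⟨max n (i.1 + 1), Finset.insert_subset ?_ (hn.trans (hmono (le_max_left _ _)))⟩
      simp [haarLevels]

variable {W : Type*} [AddCommGroup W] [Module ℝ W]

/-- The increment of `Φ` over the `m`-th dyadic subinterval of level `k` of `(0, l)`. -/
def dyadicInc {W : Type*} [AddCommGroup W] (l : ℝ) (Φ : ℝ → W) (k m : ℕ) : W :=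
  Φ ((m + 1 : ℕ) * (l / 2 ^ k)) - Φ (m * (l / 2 ^ k))

/-- The Haar coefficients on `(0, l)` of the derivative of `Φ`. -/
def haar (l : ℝ) (Φ : ℝ → W) : HaarIndex → W
  | none => (√l)⁻¹ • (Φ l - Φ 0)
  | some ⟨k, m⟩ => (√(l / 2 ^ k))⁻¹ •
      (dyadicInc l Φ (k + 1) (2 * m) - dyadicInc l Φ (k + 1) (2 * m + 1))

theorem dyadicInc_split {W : Type*} [AddCommGroup W] (l : ℝ) (Φ : ℝ → W) (k m : ℕ) :
    dyadicInc l Φ k m = dyadicInc l Φ (k + 1) (2 * m) + dyadicInc l Φ (k + 1) (2 * m + 1) := by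
  have h1 : ((2 * m + 1 + 1 : ℕ) : ℝ) * (l / 2 ^ (k + 1)) = (m + 1 : ℕ) * (l / 2 ^ k) := by
    push_cast; rw [pow_succ]; field_simp; ring
  have h2 : ((2 * m : ℕ) : ℝ) * (l / 2 ^ (k + 1)) = m * (l / 2 ^ k) := by
    push_cast; rw [pow_succ]; field_simp
  simp only [dyadicInc, h1, h2]
  abel

theorem sum_range_two_mul {M : Type*} [AddCommMonoid M] (g : ℕ → M) (n : ℕ) :
    ∑ m ∈ Finset.range (2 * n), g m = ∑ m ∈ Finset.range n, (g (2 * m) + g (2 * m + 1)) := by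
  induction n with
  | zero => simp
  | succ n ih =>
    rw [show 2 * (n + 1) = 2 * n + 1 + 1 by ring, Finset.sum_range_succ, Finset.sum_range_succ, ih,
      Finset.sum_range_succ, add_assoc]

theorem sum_haarLevels {M : Type*} [AddCommMonoid M] (g : HaarIndex → M) (n : ℕ) :
    ∑ i ∈ haarLevels n, g i
      = g none + ∑ k ∈ Finset.range n, ∑ m : Fin (2 ^ k), g (some ⟨k, m⟩) := by
  rw [haarLevels, Finset.sum_insertNone, Finset.sum_sigma]

/-- Parseval up to level `n`: passing to the next level splits every cell in two, and `(a + b)(c +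
d) + (a - b)(c - d) = 2 (ac + bd)`. With `Ξ` vector valued it also serves as the Haar expansion of a
step function. -/
theorem haar_expansion {l : ℝ} (hl : 0 < l) (Φ : ℝ → ℝ) (Ξ : ℝ → W) (n : ℕ) :
    ∑ i ∈ haarLevels n, haar l Φ i • haar l Ξ i
      = (l / 2 ^ n)⁻¹ • ∑ m ∈ Finset.range (2 ^ n), dyadicInc l Φ n m • dyadicInc l Ξ n m := by
  rw [sum_haarLevels]
  have hsq : ∀ x : ℝ, 0 < x → (√x)⁻¹ * (√x)⁻¹ = x⁻¹ := fun x hx => by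
    rw [← mul_inv, Real.mul_self_sqrt hx.le]
  induction n with
  | zero =>
    simp only [haar, Finset.range_zero, Finset.sum_empty, add_zero, pow_zero, div_one,
      Finset.range_one, Finset.sum_singleton, dyadicInc]
    simp only [smul_eq_mul, ← hsq l hl, zero_add, Nat.cast_one, one_mul, Nat.cast_zero, zero_mul]
    module
  | succ n ih =>
    have hpos : 0 < l / 2 ^ n := by positivity
    rw [Finset.sum_range_succ, ← add_assoc, ih,
      show Finset.range (2 ^ (n + 1)) = Finset.range (2 * 2 ^ n) by rw [pow_succ'],
      sum_range_two_mul]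
    have h1 : ∑ m : Fin (2 ^ n), haar l Φ (some ⟨n, m⟩) • haar l Ξ (some ⟨n, m⟩)
        = (l / 2 ^ n)⁻¹ • ∑ m ∈ Finset.range (2 ^ n),
          ((dyadicInc l Φ (n + 1) (2 * m) - dyadicInc l Φ (n + 1) (2 * m + 1)) •
            (dyadicInc l Ξ (n + 1) (2 * m) - dyadicInc l Ξ (n + 1) (2 * m + 1))) := by
      rw [← Fin.sum_univ_eq_sum_range (fun m => (dyadicInc l Φ (n + 1) (2 * m) -
        dyadicInc l Φ (n + 1) (2 * m + 1)) • (dyadicInc l Ξ (n + 1) (2 * m) -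
        dyadicInc l Ξ (n + 1) (2 * m + 1))), Finset.smul_sum]
      refine Finset.sum_congr rfl fun m _ => ?_
      simp only [haar, smul_eq_mul]
      rw [← hsq _ hpos]
      module
    rw [h1, ← smul_add, ← Finset.sum_add_distrib, show (l / 2 ^ (n + 1))⁻¹ = (l / 2 ^ n)⁻¹ * 2 by
      rw [pow_succ]; field_simp, mul_smul, Finset.smul_sum (r := (2 : ℝ))]
    congr 1
    refine Finset.sum_congr rfl fun m _ => ?_
    rw [dyadicInc_split l Φ n m, dyadicInc_split l Ξ n m]
    module

theorem haar_sq_expansion {l : ℝ} (hl : 0 < l) (Φ : ℝ → ℝ) (n : ℕ) :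
    ∑ i ∈ haarLevels n, haar l Φ i ^ 2
      = (l / 2 ^ n)⁻¹ * ∑ m ∈ Finset.range (2 ^ n), dyadicInc l Φ n m ^ 2 := by
  simpa only [smul_eq_mul, ← sq] using haar_expansion hl Φ Φ n

theorem haar_map {W' : Type*} [AddCommGroup W'] [Module ℝ W'] (l : ℝ) (L : W →ₗ[ℝ] W')
    (Φ : ℝ → W) (i : HaarIndex) : haar l (fun x => L (Φ x)) i = L (haar l Φ i) := by
  rcases i with _ | ⟨k, m⟩ <;> simp [haar, dyadicInc]

theorem haar_congr {l : ℝ} (hl : 0 < l) {Φ Ψ : ℝ → W} (h : ∀ x ∈ Icc 0 l, Φ x = Ψ x)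
    (i : HaarIndex) : haar l Φ i = haar l Ψ i := by
  rcases i with _ | ⟨k, m⟩
  · simp only [haar]
    rw [h l ⟨hl.le, le_rfl⟩, h 0 ⟨le_rfl, hl.le⟩]
  · have hm : ∀ j : ℕ, j ≤ 2 * m.1 + 2 → Φ (j * (l / 2 ^ (k + 1))) = Ψ (j * (l / 2 ^ (k + 1))) := by
      intro j hj
      refine h _ ⟨by positivity, ?_⟩
      have h1 : ((j : ℕ) : ℝ) ≤ 2 ^ (k + 1) := by
        have := m.2
        have : j ≤ 2 ^ (k + 1) := by rw [pow_succ]; omega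
        exact_mod_cast this
      calc (j : ℝ) * (l / 2 ^ (k + 1)) ≤ 2 ^ (k + 1) * (l / 2 ^ (k + 1)) := by gcongr
        _ = l := by field_simp
    simp only [haar, dyadicInc]
    rw [hm _ (by omega), hm _ (by omega), hm _ (by omega)]

theorem sq_integral_le {f : ℝ → ℝ} {p q : ℝ} (hpq : p ≤ q)
    (hf : IntervalIntegrable f volume p q)
    (hf2 : IntervalIntegrable (fun x => f x ^ 2) volume p q) :
    (∫ x in p..q, f x) ^ 2 ≤ (q - p) * ∫ x in p..q, f x ^ 2 := by
  rcases hpq.eq_or_lt with rfl | hlt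
  · simp
  set I := ∫ x in p..q, f x
  have hpos : 0 < q - p := sub_pos.2 hlt
  have h0 : 0 ≤ ∫ x in p..q, (f x - I / (q - p)) ^ 2 :=
    intervalIntegral.integral_nonneg hpq fun x _ => sq_nonneg _
  have h1 : ∫ x in p..q, (f x - I / (q - p)) ^ 2
      = (∫ x in p..q, f x ^ 2) - 2 * (I / (q - p)) * I + (I / (q - p)) ^ 2 * (q - p) := by
    have : ∀ x, (f x - I / (q - p)) ^ 2
        = f x ^ 2 - (2 * (I / (q - p))) * f x + (I / (q - p)) ^ 2 := fun x => by ring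
    simp only [this]
    rw [intervalIntegral.integral_add (hf2.sub (hf.const_mul _)) (by simp),
      intervalIntegral.integral_sub hf2 (hf.const_mul _), intervalIntegral.integral_const_mul,
      intervalIntegral.integral_const, smul_eq_mul]
    ring
  rw [h1] at h0
  have h2 : (q - p) * ((∫ x in p..q, f x ^ 2) - 2 * (I / (q - p)) * I
      + (I / (q - p)) ^ 2 * (q - p)) = (q - p) * (∫ x in p..q, f x ^ 2) - I ^ 2 := by
    field_simp; ring
  nlinarith [mul_nonneg hpos.le h0]

theorem dyadic_endpoints {l : ℝ} (hl : 0 < l) {k m : ℕ} (hm : m < 2 ^ k) :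
    (0 : ℝ) ≤ m * (l / 2 ^ k) ∧ (m : ℝ) * (l / 2 ^ k) ≤ (m + 1 : ℕ) * (l / 2 ^ k) ∧
      ((m + 1 : ℕ) : ℝ) * (l / 2 ^ k) ≤ l := by
  refine ⟨by positivity, ?_, ?_⟩
  · gcongr; omega
  · have h1 : ((m + 1 : ℕ) : ℝ) ≤ 2 ^ k := by exact_mod_cast hm
    calc ((m + 1 : ℕ) : ℝ) * (l / 2 ^ k) ≤ 2 ^ k * (l / 2 ^ k) := by gcongr
      _ = l := by field_simp

/-- Bessel's inequality for the Haar system. -/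
theorem haar_bessel {l : ℝ} (hl : 0 < l) {φ : ℝ → ℝ} (hφ : IntervalIntegrable φ volume 0 l)
    (hφ2 : IntervalIntegrable (fun x => φ x ^ 2) volume 0 l) (F : Finset HaarIndex) :
    ∑ i ∈ F, haar l (fun x => ∫ t in (0 : ℝ)..x, φ t) i ^ 2 ≤ ∫ t in (0 : ℝ)..l, φ t ^ 2 := by
  obtain ⟨n, hn⟩ := exists_subset_haarLevels F
  refine (Finset.sum_le_sum_of_subset_of_nonneg hn fun _ _ _ => sq_nonneg _).trans ?_
  rw [haar_sq_expansion hl]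
  have hh : 0 < l / 2 ^ n := by positivity
  have hsub : ∀ m : ℕ, m < 2 ^ n → ∀ a b : ℝ, a = m * (l / 2 ^ n) → b = (m + 1 : ℕ) * (l / 2 ^ n) →
      uIcc a b ⊆ uIcc 0 l := by
    rintro m hm a b rfl rfl
    obtain ⟨h1, h2, h3⟩ := dyadic_endpoints hl hm
    rw [uIcc_of_le h2, uIcc_of_le hl.le]
    exact Icc_subset_Icc h1 h3
  have h1 : ∀ m ∈ Finset.range (2 ^ n), dyadicInc l (fun x => ∫ t in (0 : ℝ)..x, φ t) n m ^ 2
      ≤ (l / 2 ^ n) * ∫ t in (m * (l / 2 ^ n))..((m + 1 : ℕ) * (l / 2 ^ n)), φ t ^ 2 := by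
    intro m hm
    have hm' := Finset.mem_range.1 hm
    obtain ⟨e1, e2, e3⟩ := dyadic_endpoints hl hm'
    have hsub0 : ∀ x, 0 ≤ x → x ≤ l → IntervalIntegrable φ volume 0 x := fun x hx hxl =>
      hφ.mono_set (by rw [uIcc_of_le hx, uIcc_of_le hl.le]; exact Icc_subset_Icc_right hxl)
    have h2 : dyadicInc l (fun x => ∫ t in (0 : ℝ)..x, φ t) n m
        = ∫ t in (m * (l / 2 ^ n))..((m + 1 : ℕ) * (l / 2 ^ n)), φ t :=
      intervalIntegral.integral_interval_sub_left (hsub0 _ (e1.trans e2) e3)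
        (hsub0 _ e1 (e2.trans e3))
    rw [h2]
    refine (sq_integral_le e2 (hφ.mono_set (hsub m hm' _ _ rfl rfl))
      (hφ2.mono_set (hsub m hm' _ _ rfl rfl))).trans (le_of_eq ?_)
    congr 1
    push_cast; ring
  have h3 := intervalIntegral.sum_integral_adjacent_intervals (μ := volume)
    (f := fun t => φ t ^ 2) (a := fun m : ℕ => (m : ℝ) * (l / 2 ^ n)) (n := 2 ^ n)
    fun m hm => hφ2.mono_set (hsub m hm _ _ rfl rfl)
  have h4 : ((2 ^ n : ℕ) : ℝ) * (l / 2 ^ n) = l := by push_cast; field_simp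
  rw [h4, Nat.cast_zero, zero_mul] at h3
  calc (l / 2 ^ n)⁻¹ * ∑ m ∈ Finset.range (2 ^ n),
        dyadicInc l (fun x => ∫ t in (0 : ℝ)..x, φ t) n m ^ 2
      ≤ (l / 2 ^ n)⁻¹ * ∑ m ∈ Finset.range (2 ^ n), (l / 2 ^ n) *
          ∫ t in (m * (l / 2 ^ n))..((m + 1 : ℕ) * (l / 2 ^ n)), φ t ^ 2 := by
        gcongr with m hm
        exact h1 m hm
    _ = ∫ t in (0 : ℝ)..l, φ t ^ 2 := by
        rw [← Finset.mul_sum, h3]; field_simp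

/-- The middle value `φ c` is a lower bound of `φ` on the left half and an upper bound on the right
half, so the difference is nonnegative and at most the half length times the total drop. -/
theorem AntitoneOn.abs_integral_sub_le {φ : ℝ → ℝ} {p c q : ℝ} (hpc : p ≤ c) (hcq : q - c = c - p)
    (hφ : AntitoneOn φ (Icc p q)) :
    |(∫ t in p..c, φ t) - ∫ t in c..q, φ t| ≤ (c - p) * (φ p - φ q) := by
  have hcq' : c ≤ q := by linarith
  have hi1 : IntervalIntegrable φ volume p c := AntitoneOn.intervalIntegrable
    (hφ.mono (by rw [uIcc_of_le hpc]; exact Icc_subset_Icc_right hcq'))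
  have hi2 : IntervalIntegrable φ volume c q := AntitoneOn.intervalIntegrable
    (hφ.mono (by rw [uIcc_of_le hcq']; exact Icc_subset_Icc_left hpc))
  have hp : p ∈ Icc p q := ⟨le_rfl, hpc.trans hcq'⟩
  have hc : c ∈ Icc p q := ⟨hpc, hcq'⟩
  have hq : q ∈ Icc p q := ⟨hpc.trans hcq', le_rfl⟩
  have h1 : (∫ t in p..c, φ t) ≤ ∫ t in p..c, φ p :=
    intervalIntegral.integral_mono_on hpc hi1 (by simp) fun t ht =>
      hφ hp ⟨ht.1, ht.2.trans hcq'⟩ ht.1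
  have h2 : (∫ t in p..c, φ c) ≤ ∫ t in p..c, φ t :=
    intervalIntegral.integral_mono_on hpc (by simp) hi1 fun t ht =>
      hφ ⟨ht.1, ht.2.trans hcq'⟩ hc ht.2
  have h3 : (∫ t in c..q, φ t) ≤ ∫ t in c..q, φ c :=
    intervalIntegral.integral_mono_on hcq' hi2 (by simp) fun t ht =>
      hφ hc ⟨hpc.trans ht.1, ht.2⟩ ht.1
  have h4 : (∫ t in c..q, φ q) ≤ ∫ t in c..q, φ t :=
    intervalIntegral.integral_mono_on hcq' (by simp) hi2 fun t ht =>
      hφ ⟨hpc.trans ht.1, ht.2⟩ hq ht.2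
  simp only [intervalIntegral.integral_const, smul_eq_mul] at h1 h2 h3 h4
  rw [abs_of_nonneg] <;> rw [hcq] at * <;> linarith

/-- The Haar coefficients of level `k` of a monotone function, away from the first `a` dyadic
intervals. -/
theorem haar_sq_sum_le {l : ℝ} (hl : 0 < l) {φ Φ : ℝ → ℝ} {k a : ℕ}
    (ha : a ≤ 2 ^ k) (hφ : AntitoneOn φ (Icc (a * (l / 2 ^ k)) l))
    (hΦ : ∀ x y, a * (l / 2 ^ k) ≤ x → x ≤ y → y ≤ l → Φ y - Φ x = ∫ t in x..y, φ t) :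
    ∑ m : Fin (2 ^ k), (if a ≤ m.1 then haar l Φ (some ⟨k, m⟩) ^ 2 else 0)
      ≤ (l / 2 ^ k) / 4 * (φ (a * (l / 2 ^ k)) - φ l) ^ 2 := by
  set h := l / 2 ^ k with hh
  have hpos : 0 < h := by positivity
  have hl' : l = (2 ^ k : ℕ) * h := by rw [hh]; push_cast; field_simp
  have hcell : ∀ m : ℕ, a ≤ m → m < 2 ^ k →
      ((√h)⁻¹ * (dyadicInc l Φ (k + 1) (2 * m) - dyadicInc l Φ (k + 1) (2 * m + 1))) ^ 2
        ≤ h / 4 * (φ (m * h) - φ ((m + 1 : ℕ) * h)) ^ 2 := by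
    intro m hm hm2
    obtain ⟨e1, e2, e3⟩ := dyadic_endpoints hl hm2
    rw [← hh] at e1 e2 e3
    have e0 : (a : ℝ) * h ≤ m * h := by gcongr
    have g1 : ((2 * m : ℕ) : ℝ) * (l / 2 ^ (k + 1)) = m * h := by
      rw [hh, pow_succ]; push_cast; field_simp
    have g2 : ((2 * m + 1 : ℕ) : ℝ) * (l / 2 ^ (k + 1)) = m * h + h / 2 := by
      rw [hh, pow_succ]; push_cast; field_simp
    have g3 : ((2 * m + 1 + 1 : ℕ) : ℝ) * (l / 2 ^ (k + 1)) = (m + 1 : ℕ) * h := by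
      rw [hh, pow_succ]; push_cast; field_simp; ring
    have g4 : ((m + 1 : ℕ) : ℝ) * h = m * h + h := by push_cast; ring
    simp only [dyadicInc, g1, g2, g3]
    rw [hΦ _ _ e0 (by linarith) (by linarith), hΦ _ _ (by linarith) (by linarith) e3]
    have h1 := AntitoneOn.abs_integral_sub_le (φ := φ) (p := m * h) (c := m * h + h / 2)
      (q := (m + 1 : ℕ) * h) (by linarith) (by linarith) (hφ.mono (Icc_subset_Icc e0 e3))
    rw [mul_pow, inv_pow, Real.sq_sqrt hpos.le, ← sq_abs]
    calc h⁻¹ * |_| ^ 2 ≤ h⁻¹ * ((m * h + h / 2 - m * h) * (φ (m * h) - φ ((m + 1 : ℕ) * h))) ^ 2 := by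
          gcongr
      _ = h / 4 * (φ (m * h) - φ ((m + 1 : ℕ) * h)) ^ 2 := by field_simp; ring
  have hstep : ∀ m : ℕ, a ≤ m → m < 2 ^ k → 0 ≤ φ (m * h) - φ ((m + 1 : ℕ) * h) := by
    intro m hm hm2
    obtain ⟨e1, e2, e3⟩ := dyadic_endpoints hl hm2
    rw [← hh] at e1 e2 e3
    have e0 : (a : ℝ) * h ≤ m * h := by gcongr
    exact sub_nonneg.2 (hφ ⟨e0, e2.trans e3⟩ ⟨e0.trans e2, e3⟩ e2)
  have hsum : ∑ m ∈ Finset.Ico a (2 ^ k), (φ (m * h) - φ ((m + 1 : ℕ) * h)) = φ (a * h) - φ l := by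
    have := Finset.sum_Ico_sub (fun m : ℕ => φ (m * h)) ha
    rw [hl']
    rw [← neg_sub, ← this, ← Finset.sum_neg_distrib]
    exact Finset.sum_congr rfl fun m _ => by ring
  change ∑ m : Fin (2 ^ k), (if a ≤ m.1 then ((√(l / 2 ^ k))⁻¹ •
      (dyadicInc l Φ (k + 1) (2 * m) - dyadicInc l Φ (k + 1) (2 * m + 1))) ^ 2 else 0) ≤ _
  rw [Fin.sum_univ_eq_sum_range (fun m => if a ≤ m then ((√(l / 2 ^ k))⁻¹ •
      (dyadicInc l Φ (k + 1) (2 * m) - dyadicInc l Φ (k + 1) (2 * m + 1))) ^ 2 else 0) (2 ^ k),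
    ← Finset.sum_filter, ← hsum]
  have hfil : (Finset.range (2 ^ k)).filter (fun m => a ≤ m) = Finset.Ico a (2 ^ k) := by
    ext m; simp [and_comm]
  rw [hfil]
  -- The drops over the cells are nonnegative, so their squares sum to at most the square of the
  -- total drop, however many cells there are. The level sum thus keeps the factor `h`.
  calc ∑ m ∈ Finset.Ico a (2 ^ k), ((√(l / 2 ^ k))⁻¹ •
        (dyadicInc l Φ (k + 1) (2 * m) - dyadicInc l Φ (k + 1) (2 * m + 1))) ^ 2
      ≤ ∑ m ∈ Finset.Ico a (2 ^ k), h / 4 * (φ (m * h) - φ ((m + 1 : ℕ) * h)) ^ 2 :=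
        Finset.sum_le_sum fun m hm => hcell m (Finset.mem_Ico.1 hm).1 (Finset.mem_Ico.1 hm).2
    _ ≤ h / 4 * (∑ m ∈ Finset.Ico a (2 ^ k), (φ (m * h) - φ ((m + 1 : ℕ) * h))) ^ 2 := by
        rw [← Finset.mul_sum]
        refine mul_le_mul_of_nonneg_left ?_ (by positivity)
        exact Finset.sum_sq_le_sq_sum_of_nonneg fun m hm =>
          hstep m (Finset.mem_Ico.1 hm).1 (Finset.mem_Ico.1 hm).2

end HaarCoefficients

/-! ### Mean square differences control dyadic increments -/

section DyadicDifferences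

variable {F : ℝ → ℝ}

/-- The integral `∫ (F (x + r) - F x)² dx`. -/
def diffEnergy (F : ℝ → ℝ) (r : ℝ) : ℝ := ∫ x, (F (x + r) - F x) ^ 2

theorem diffEnergy_nonneg (F : ℝ → ℝ) (r : ℝ) : 0 ≤ diffEnergy F r :=
  integral_nonneg fun _ => sq_nonneg _

theorem measurable_diffEnergy (hF : Continuous F) : Measurable (diffEnergy F) := by
  have h : StronglyMeasurable fun p : ℝ × ℝ => (F (p.2 + p.1) - F p.2) ^ 2 :=
    Continuous.stronglyMeasurable (by fun_prop)
  exact h.integral_prod_right.measurable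

theorem sum_integral_cells_le {g : ℝ → ℝ} (hg : Integrable g) (h0 : ∀ x, 0 ≤ g x) {h : ℝ}
    (hh : 0 ≤ h) (c : ℝ) (M : ℕ) :
    ∑ m ∈ Finset.range M, ∫ x in (c + m * h)..(c + (m + 1 : ℕ) * h), g x ≤ ∫ x, g x := by
  have h3 := intervalIntegral.sum_integral_adjacent_intervals (μ := volume)
    (f := g) (a := fun m : ℕ => c + (m : ℝ) * h) (n := M)
    fun m hm => hg.intervalIntegrable
  rw [h3, intervalIntegral.integral_of_le (by gcongr; simp)]
  exact setIntegral_le_integral hg (Eventually.of_forall h0)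

/-- Cauchy-Schwarz on windows of length `r`, one in each cell and hence disjoint. The gain is the
factor `r` in place of `h`. -/
theorem sum_sq_integral_le {g : ℝ → ℝ} (hc : Continuous g) (hg : Integrable fun x => g x ^ 2)
    {h r : ℝ} (hr : 0 ≤ r) (hrh : r ≤ h) (c : ℝ) (M : ℕ) :
    ∑ m ∈ Finset.range M, (∫ x in (c + m * h)..(c + m * h + r), g x) ^ 2
      ≤ r * ∫ x, g x ^ 2 := by
  refine le_trans ?_ (mul_le_mul_of_nonneg_left (sum_integral_cells_le hg
    (fun x => sq_nonneg _) (hr.trans hrh) c M) hr)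
  rw [Finset.mul_sum]
  refine Finset.sum_le_sum fun m _ => ?_
  refine (sq_integral_le (by linarith) (hc.intervalIntegrable _ _)
    ((hc.pow 2).intervalIntegrable _ _)).trans ?_
  rw [add_sub_cancel_left]
  refine mul_le_mul_of_nonneg_left ?_ hr
  refine intervalIntegral.integral_mono_interval le_rfl (by linarith) ?_
    (Eventually.of_forall fun x => sq_nonneg _) ((hc.pow 2).intervalIntegrable _ _)
  push_cast; linarith

/-- Cauchy-Schwarz with `∑ (2/3)ⁱ ≤ 3`. The ratio `3/2` lies strictly between `1` and `2`, so the
weights on the right are still beaten by terms of size `2⁻ⁱ`. -/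
theorem sq_sum_le_geometric (z : ℕ → ℝ) (n : ℕ) :
    (∑ i ∈ Finset.range n, z i) ^ 2 ≤ 3 * ∑ i ∈ Finset.range n, (3 / 2 : ℝ) ^ i * z i ^ 2 := by
  refine (Finset.sum_sq_le_sum_mul_sum_of_sq_le_mul (Finset.range n) (f := fun i => (2 / 3 : ℝ) ^ i)
    (g := fun i => (3 / 2 : ℝ) ^ i * z i ^ 2) (fun i _ => by positivity) (fun i _ => by positivity)
    fun i _ => ?_).trans ?_
  · refine le_of_eq ?_
    rw [← mul_assoc, ← mul_pow]; norm_num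
  · refine mul_le_mul_of_nonneg_right ?_ (Finset.sum_nonneg fun i _ => by positivity)
    rw [geom_sum_eq (by norm_num), div_le_iff_of_neg (by norm_num)]
    have : (0 : ℝ) ≤ (2 / 3) ^ n := by positivity
    linarith

/-- The increments of `F` over the cells of a grid are controlled by its mean square differences at
the scales `ρ h / 2ⁱ`. -/
theorem sum_sq_inc_le (hF : Continuous F)
    (hint : ∀ r, 0 < r → Integrable fun x => (F (x + r) - F x) ^ 2) {h ρ : ℝ} (hh : 0 < h)
    (hρ : 0 < ρ) (hρ1 : ρ ≤ 1) (M : ℕ) :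
    ENNReal.ofReal (h⁻¹ * ∑ m ∈ Finset.range M, (F ((m + 1 : ℕ) * h) - F (m * h)) ^ 2)
      ≤ ∑' i : ℕ, ENNReal.ofReal (3 * (3 / 4) ^ i *
          ((ρ * (h / 2 ^ i)) ^ 2)⁻¹ * diffEnergy F (ρ * (h / 2 ^ i))) := by
  set r : ℕ → ℝ := fun i => ρ * (h / 2 ^ i) with hr
  have hrpos : ∀ i, 0 < r i := fun i => by positivity
  have hrle : ∀ i, r i ≤ h / 2 ^ i := fun i => by
    have : 0 < h / 2 ^ i := by positivity
    simp only [hr]; nlinarith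
  have hrle' : ∀ i, r i ≤ h := fun i =>
    (hrle i).trans (div_le_self hh.le (one_le_pow₀ (by norm_num)))
  have hr2 : ∀ i, r i = 2 * r (i + 1) := fun i => by simp only [hr, pow_succ]; field_simp
  let g : ℕ → ℝ → ℝ := fun i x => (F (x + r i) - F x) / r i
  have hgc : ∀ i, Continuous (g i) := fun i => by fun_prop
  have hg2 : ∀ i x, g i x ^ 2 = ((r i) ^ 2)⁻¹ * (F (x + r i) - F x) ^ 2 := fun i x => by
    simp only [g, div_pow]; rw [div_eq_inv_mul]
  have hgi : ∀ i, Integrable fun x => g i x ^ 2 := fun i => by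
    simp only [hg2]
    exact (hint _ (hrpos i)).const_mul _
  let Q : ℕ → ℝ := fun i => ((r i) ^ 2)⁻¹ * diffEnergy F (r i)
  have hQ : ∀ i, ∫ x, g i x ^ 2 = Q i := fun i => by
    simp only [hg2, integral_const_mul, Q, diffEnergy]
  have hQ0 : ∀ i, 0 ≤ Q i := fun i =>
    mul_nonneg (inv_nonneg.2 (sq_nonneg _)) (diffEnergy_nonneg _ _)
  -- The integral over cell `m` of the difference quotient at scale `r i` tends to the increment of
  -- `F` over that cell. The increment is recovered by telescoping over `i`.
  let b : ℕ → ℕ → ℝ := fun i m => ∫ x in (m * h)..(m * h + h), g i x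
  have hb0 : ∑ m ∈ Finset.range M, b 0 m ^ 2 ≤ h * Q 0 := by
    have := sum_sq_integral_le (hgc 0) (hgi 0) hh.le le_rfl 0 M
    simpa only [zero_add, hQ] using this
  have hshift : ∀ (u : ℝ → ℝ), Continuous u → ∀ p q s : ℝ,
      (∫ x in p..q, u (x + s)) - ∫ x in p..q, u x = (∫ x in q..q + s, u x) - ∫ x in p..p + s, u x := by
    intro u hu p q s
    rw [intervalIntegral.integral_comp_add_right]
    have i := fun a b => hu.intervalIntegrable (μ := volume) a b
    have e1 := intervalIntegral.integral_add_adjacent_intervals (i p q) (i q (q + s))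
    have e2 := intervalIntegral.integral_add_adjacent_intervals (i p (p + s)) (i (p + s) (q + s))
    linarith
  have hbd : ∀ i, ∑ m ∈ Finset.range M, (b (i + 1) m - b i m) ^ 2 ≤ h / 2 ^ (i + 1) * Q (i + 1) := by
    intro i
    have e1 : ∀ m : ℕ, (b (i + 1) m - b i m) ^ 2
        ≤ 1 / 2 * ((∫ x in (h + m * h)..(h + m * h + r (i + 1)), g (i + 1) x) ^ 2 +
          (∫ x in (0 + m * h)..(0 + m * h + r (i + 1)), g (i + 1) x) ^ 2) := by
      intro m
      -- As `r i = 2 r (i + 1)`, a difference quotient is the mean of two finer ones, one of them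
      -- translated by `r (i + 1)`. After integration over a cell the translation leaves only two
      -- boundary windows of length `r (i + 1)`, whence the gain `2^{-(i + 1)}`.
      have e2 : ∀ x, g i x = (g (i + 1) x + g (i + 1) (x + r (i + 1))) / 2 := fun x => by
        have := (hrpos (i + 1)).ne'
        simp only [g, hr2 i, add_assoc, ← two_mul]
        field_simp; ring
      have e3 : b i m = b (i + 1) m + 1 / 2 *
          ((∫ x in (m * h + h)..(m * h + h + r (i + 1)), g (i + 1) x) -
            ∫ x in (m * h)..(m * h + r (i + 1)), g (i + 1) x) := by
        rw [← hshift _ (hgc _)]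
        simp only [b, e2]
        have hgs : Continuous fun x => g (i + 1) (x + r (i + 1)) :=
          (hgc (i + 1)).comp (continuous_id.add continuous_const)
        rw [intervalIntegral.integral_div, intervalIntegral.integral_add
          ((hgc _).intervalIntegrable _ _) (hgs.intervalIntegrable _ _)]
        ring
      rw [e3, zero_add, add_comm h]
      set A := ∫ x in (m * h + h)..(m * h + h + r (i + 1)), g (i + 1) x
      set B := ∫ x in (m * h)..(m * h + r (i + 1)), g (i + 1) x
      nlinarith [sq_nonneg (A + B)]
    calc ∑ m ∈ Finset.range M, (b (i + 1) m - b i m) ^ 2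
        ≤ ∑ m ∈ Finset.range M, 1 / 2 *
          ((∫ x in (h + m * h)..(h + m * h + r (i + 1)), g (i + 1) x) ^ 2 +
          (∫ x in (0 + m * h)..(0 + m * h + r (i + 1)), g (i + 1) x) ^ 2) :=
          Finset.sum_le_sum fun m _ => e1 m
      _ ≤ 1 / 2 * (r (i + 1) * Q (i + 1) + r (i + 1) * Q (i + 1)) := by
          rw [← Finset.mul_sum, Finset.sum_add_distrib, ← hQ]
          exact mul_le_mul_of_nonneg_left (add_le_add
            (sum_sq_integral_le (hgc _) (hgi _) (hrpos _).le (hrle' _) h M)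
            (sum_sq_integral_le (hgc _) (hgi _) (hrpos _).le (hrle' _) 0 M)) (by norm_num)
      _ ≤ h / 2 ^ (i + 1) * Q (i + 1) := by
          have := mul_le_mul_of_nonneg_right (hrle (i + 1)) (hQ0 (i + 1))
          linarith
  have hbn : ∀ n, ∑ m ∈ Finset.range M, b n m ^ 2
      ≤ h * ∑ i ∈ Finset.range (n + 1), 3 * (3 / 4) ^ i * Q i := by
    intro n
    let z : ℕ → ℕ → ℝ := fun m i => if i = 0 then b 0 m else b i m - b (i - 1) m
    have hz : ∀ m, b n m = ∑ i ∈ Finset.range (n + 1), z m i := by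
      intro m
      rw [Finset.sum_range_succ']
      have := Finset.sum_range_sub (fun i => b i m) n
      simp only [z, Nat.add_eq_zero_iff, one_ne_zero, and_false, if_false, if_true,
        Nat.add_sub_cancel]
      linarith
    have hzq : ∀ i, ∑ m ∈ Finset.range M, z m i ^ 2 ≤ h / 2 ^ i * Q i := by
      intro i
      rcases i with _ | i
      · simpa [z] using hb0
      · simpa [z] using hbd i
    calc ∑ m ∈ Finset.range M, b n m ^ 2
        ≤ ∑ m ∈ Finset.range M, 3 * ∑ i ∈ Finset.range (n + 1), (3 / 2 : ℝ) ^ i * z m i ^ 2 := by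
          refine Finset.sum_le_sum fun m _ => ?_
          rw [hz m]
          exact sq_sum_le_geometric _ _
      _ = 3 * ∑ i ∈ Finset.range (n + 1), (3 / 2 : ℝ) ^ i * ∑ m ∈ Finset.range M, z m i ^ 2 := by
          rw [← Finset.mul_sum, Finset.sum_comm]
          simp only [Finset.mul_sum]
      _ ≤ 3 * ∑ i ∈ Finset.range (n + 1), (3 / 2 : ℝ) ^ i * (h / 2 ^ i * Q i) := by
          gcongr with i _
          exact hzq i
      _ = h * ∑ i ∈ Finset.range (n + 1), 3 * (3 / 4) ^ i * Q i := by
          rw [Finset.mul_sum, Finset.mul_sum]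
          refine Finset.sum_congr rfl fun i _ => ?_
          rw [show (3 / 4 : ℝ) = 3 / 2 / 2 by norm_num, div_pow (3 / 2 : ℝ)]
          field_simp
  have hlim : ∀ m : ℕ, Tendsto (fun i => b i m) atTop (𝓝 (F ((m + 1 : ℕ) * h) - F (m * h))) := by
    intro m
    have hr0 : Tendsto r atTop (𝓝[≠] 0) := by
      refine tendsto_nhdsWithin_iff.2 ⟨?_, Eventually.of_forall fun i => (hrpos i).ne'⟩
      have h1 : Tendsto (fun i : ℕ => ρ * h * (1 / 2 : ℝ) ^ i) atTop (𝓝 (ρ * h * 0)) :=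
        (tendsto_pow_atTop_nhds_zero_of_lt_one (by norm_num) (by norm_num)).const_mul _
      rw [mul_zero] at h1
      refine h1.congr fun i => ?_
      simp only [hr]; rw [one_div, inv_pow]; ring
    have hder : ∀ x : ℝ, Tendsto (fun i => (r i)⁻¹ * ∫ t in x..x + r i, F t) atTop (𝓝 (F x)) := by
      intro x
      have h1 := (hF.integral_hasStrictDerivAt x x).hasDerivAt
      rw [hasDerivAt_iff_tendsto_slope_zero] at h1
      simpa [Function.comp_def] using h1.comp hr0
    have h2 := (hder (m * h + h)).sub (hder (m * h))
    have h3 : ((m + 1 : ℕ) : ℝ) * h = m * h + h := by push_cast; ring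
    rw [h3]
    refine h2.congr fun i => ?_
    simp only [b, g]
    rw [← mul_sub, ← hshift F hF, intervalIntegral.integral_div, intervalIntegral.integral_sub
      (Continuous.intervalIntegrable (by fun_prop) _ _) (hF.intervalIntegrable _ _)]
    ring
  have hlim2 : Tendsto (fun n => ENNReal.ofReal (h⁻¹ * ∑ m ∈ Finset.range M, b n m ^ 2)) atTop
      (𝓝 (ENNReal.ofReal (h⁻¹ * ∑ m ∈ Finset.range M, (F ((m + 1 : ℕ) * h) - F (m * h)) ^ 2))) :=
    ENNReal.tendsto_ofReal ((tendsto_finsetSum _ fun m _ => (hlim m).pow 2).const_mul _)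
  refine le_of_tendsto hlim2 (Eventually.of_forall fun n => ?_)
  calc ENNReal.ofReal (h⁻¹ * ∑ m ∈ Finset.range M, b n m ^ 2)
      ≤ ENNReal.ofReal (∑ i ∈ Finset.range (n + 1), 3 * (3 / 4) ^ i * Q i) := by
        refine ENNReal.ofReal_le_ofReal ?_
        rw [inv_mul_le_iff₀ hh]
        exact hbn n
    _ = ∑ i ∈ Finset.range (n + 1), ENNReal.ofReal (3 * (3 / 4) ^ i * Q i) :=
        ENNReal.ofReal_sum_of_nonneg fun i _ => by have := hQ0 i; positivity
    _ ≤ ∑' i : ℕ, ENNReal.ofReal (3 * (3 / 4) ^ i * Q i) := ENNReal.sum_le_tsum _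
    _ = _ := by
        refine tsum_congr fun i => ?_
        rw [mul_assoc _ _ (diffEnergy F _)]

/-- Scale `i` below grid `j` is scale `j + i` of the whole interval. Moving the weight from `j` to
`j + i` costs `(7/6)ⁱ`, and `7/6 · 3/4 = 7/8 < 1`; the resulting sum `3 ∑ (7/8)ⁱ` is `24`. -/
theorem tsum_weighted_sq_inc_le (hF : Continuous F)
    (hint : ∀ r, 0 < r → Integrable fun x => (F (x + r) - F x) ^ 2) {l ρ : ℝ} (hl : 0 < l)
    (hρ : 0 < ρ) (hρ1 : ρ ≤ 1) {lam : ℕ → ℝ} (h0 : ∀ j, 0 ≤ lam j)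
    (hlam : ∀ j, lam j ≤ 7 / 6 * lam (j + 1)) :
    ∑' j, ENNReal.ofReal (lam j *
        ((l / 2 ^ j)⁻¹ * ∑ m ∈ Finset.range (2 ^ j), dyadicInc l F j m ^ 2))
      ≤ 24 * ∑' n : ℕ, ENNReal.ofReal (lam n * (((ρ * (l / 2 ^ n)) ^ 2)⁻¹ *
          diffEnergy F (ρ * (l / 2 ^ n)))) := by
  let Q : ℕ → ℝ := fun n => ((ρ * (l / 2 ^ n)) ^ 2)⁻¹ * diffEnergy F (ρ * (l / 2 ^ n))
  have hQ0 : ∀ n, 0 ≤ Q n := fun n =>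
    mul_nonneg (inv_nonneg.2 (sq_nonneg _)) (diffEnergy_nonneg _ _)
  have hlam' : ∀ j i, lam j ≤ (7 / 6) ^ i * lam (j + i) := by
    intro j i
    induction i with
    | zero => simp
    | succ i ih =>
      refine ih.trans ?_
      rw [pow_succ, mul_assoc]
      exact mul_le_mul_of_nonneg_left (hlam (j + i)) (by positivity)
  calc ∑' j, ENNReal.ofReal (lam j *
        ((l / 2 ^ j)⁻¹ * ∑ m ∈ Finset.range (2 ^ j), dyadicInc l F j m ^ 2))
      ≤ ∑' j, ∑' i, ENNReal.ofReal (3 * (7 / 8) ^ i) * ENNReal.ofReal (lam (j + i) * Q (j + i)) := by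
        refine ENNReal.tsum_le_tsum fun j => ?_
        rw [ENNReal.ofReal_mul (h0 j)]
        refine (mul_le_mul_right (sum_sq_inc_le hF hint (by positivity) hρ hρ1 _) _).trans ?_
        rw [← ENNReal.tsum_mul_left]
        refine ENNReal.tsum_le_tsum fun i => ?_
        rw [← ENNReal.ofReal_mul (h0 j), ← ENNReal.ofReal_mul (by positivity)]
        refine ENNReal.ofReal_le_ofReal ?_
        have e : l / 2 ^ j / 2 ^ i = l / 2 ^ (j + i) := by rw [pow_add, div_div]
        rw [e, mul_assoc (3 * (3 / 4) ^ i : ℝ)]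
        change lam j * (3 * (3 / 4) ^ i * Q (j + i)) ≤ _
        calc lam j * (3 * (3 / 4) ^ i * Q (j + i))
            ≤ ((7 / 6) ^ i * lam (j + i)) * (3 * (3 / 4) ^ i * Q (j + i)) :=
              mul_le_mul_of_nonneg_right (hlam' j i) (by have := hQ0 (j + i); positivity)
          _ = 3 * (7 / 8) ^ i * (lam (j + i) * Q (j + i)) := by
              rw [show (7 / 8 : ℝ) = 7 / 6 * (3 / 4) by norm_num, mul_pow]; ring
    _ ≤ ∑' i, ENNReal.ofReal (3 * (7 / 8) ^ i) * ∑' n, ENNReal.ofReal (lam n * Q n) := by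
        rw [ENNReal.tsum_comm]
        refine ENNReal.tsum_le_tsum fun i => ?_
        rw [ENNReal.tsum_mul_left]
        refine mul_le_mul_right ?_ _
        exact ENNReal.tsum_comp_le_tsum_of_injective (add_left_injective i) _
    _ = 24 * ∑' n, ENNReal.ofReal (lam n * Q n) := by
        rw [ENNReal.tsum_mul_right, ← ENNReal.ofReal_tsum_of_nonneg (fun i => by positivity)
          ((summable_geometric_of_lt_one (by norm_num) (by norm_num)).mul_left _), tsum_mul_left,
          tsum_geometric_of_lt_one (by norm_num) (by norm_num)]
        norm_num

/-- The mean square differences of `F`, averaged over each dyadic range of scales, control the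
dyadic increments of `F`. -/
theorem sum_weighted_sq_inc_le (hF : Continuous F)
    (hint : ∀ r, 0 < r → Integrable fun x => (F (x + r) - F x) ^ 2)
    (hII : ∀ a b, 0 ≤ a → 0 ≤ b → IntervalIntegrable (diffEnergy F) volume a b) {l : ℝ} (hl : 0 < l)
    {lam : ℕ → ℝ} (h0 : ∀ j, 0 ≤ lam j) (hlam : ∀ j, lam j ≤ 7 / 6 * lam (j + 1)) {E : ℝ}
    (hE : ∀ N, ∑ n ∈ Finset.range N, lam n * ((l / 2 ^ n) ^ 3)⁻¹ *
      ∫ r in (l / 2 ^ n / 2)..(l / 2 ^ n), diffEnergy F r ≤ E) :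
    ∑' j, ENNReal.ofReal (lam j *
        ((l / 2 ^ j)⁻¹ * ∑ m ∈ Finset.range (2 ^ j), dyadicInc l F j m ^ 2))
      ≤ ENNReal.ofReal (192 * E) := by
  set L := ∑' j, ENNReal.ofReal (lam j *
        ((l / 2 ^ j)⁻¹ * ∑ m ∈ Finset.range (2 ^ j), dyadicInc l F j m ^ 2))
  have hm := measurable_diffEnergy hF
  -- Only integrals of `diffEnergy F` over ranges of scales are available, so the inequality for a
  -- single `ρ`, whose left side does not depend on `ρ`, is integrated over `(1/2, 1]`. The final
  -- `192` is `2 · 24 · 4`: the inverse length of the interval, the previous constant, and `ρ⁻² ≤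
  -- 4`.
  have h1 : ∫⁻ _ρ in Ioc (1 / 2 : ℝ) 1, L ≤ ∫⁻ ρ in Ioc (1 / 2 : ℝ) 1,
      24 * ∑' n : ℕ, ENNReal.ofReal (4 * lam n * ((l / 2 ^ n) ^ 2)⁻¹ *
        diffEnergy F (ρ * (l / 2 ^ n))) := by
    refine setLIntegral_mono' measurableSet_Ioc fun ρ hρ => ?_
    have hρ0 : 0 < ρ := by linarith [hρ.1]
    refine (tsum_weighted_sq_inc_le hF hint hl hρ0 hρ.2 h0 hlam).trans ?_
    refine mul_le_mul_right (ENNReal.tsum_le_tsum fun n => ENNReal.ofReal_le_ofReal ?_) _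
    have hn : 0 < l / 2 ^ n := by positivity
    have h2 : ((ρ * (l / 2 ^ n)) ^ 2)⁻¹ ≤ 4 * ((l / 2 ^ n) ^ 2)⁻¹ := by
      rw [mul_pow, mul_inv]
      refine mul_le_mul_of_nonneg_right ?_ (by positivity)
      rw [inv_le_comm₀ (by positivity) (by norm_num)]
      nlinarith [hρ.1]
    calc lam n * (((ρ * (l / 2 ^ n)) ^ 2)⁻¹ * diffEnergy F (ρ * (l / 2 ^ n)))
        ≤ lam n * (4 * ((l / 2 ^ n) ^ 2)⁻¹ * diffEnergy F (ρ * (l / 2 ^ n))) := by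
          have := diffEnergy_nonneg F (ρ * (l / 2 ^ n))
          have := h0 n
          gcongr
      _ = _ := by ring
  have hmeas : ∀ n : ℕ, Measurable fun ρ : ℝ => ENNReal.ofReal (4 * lam n * ((l / 2 ^ n) ^ 2)⁻¹ *
      diffEnergy F (ρ * (l / 2 ^ n))) := fun n =>
    ((hm.comp (measurable_id.mul_const (l / 2 ^ n))).const_mul _).ennreal_ofReal
  rw [lintegral_const, Measure.restrict_apply_univ, Real.volume_Ioc,
    lintegral_const_mul' _ _ (by norm_num), lintegral_tsum fun n => (hmeas n).aemeasurable] at h1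
  have h3 : ∀ n : ℕ, ∫⁻ ρ in Ioc (1 / 2 : ℝ) 1, ENNReal.ofReal (4 * lam n * ((l / 2 ^ n) ^ 2)⁻¹ *
        diffEnergy F (ρ * (l / 2 ^ n)))
      = ENNReal.ofReal (4 * (lam n * ((l / 2 ^ n) ^ 3)⁻¹ *
        ∫ r in (l / 2 ^ n / 2)..(l / 2 ^ n), diffEnergy F r)) := by
    intro n
    have hn : 0 < l / 2 ^ n := by positivity
    have hi : IntervalIntegrable (fun ρ => diffEnergy F (ρ * (l / 2 ^ n))) volume (1 / 2) 1 := by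
      have := (hII (1 / 2 * (l / 2 ^ n)) (1 * (l / 2 ^ n))
        (by positivity) (by positivity)).comp_mul_right (c := l / 2 ^ n)
      simpa [hn.ne'] using this
    rw [← ofReal_integral_eq_lintegral_ofReal]
    · rw [integral_const_mul, ← intervalIntegral.integral_of_le (by norm_num),
        intervalIntegral.integral_comp_mul_right _ hn.ne', smul_eq_mul]
      congr 1
      rw [one_mul, show 1 / 2 * (l / 2 ^ n) = l / 2 ^ n / 2 by ring]
      field_simp
    · have := (hi.const_mul (4 * lam n * ((l / 2 ^ n) ^ 2)⁻¹)).1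
      exact this
    · exact Eventually.of_forall fun ρ => by
        have := h0 n; have := diffEnergy_nonneg F (ρ * (l / 2 ^ n)); positivity
  simp_rw [h3] at h1
  have hnn : ∀ n, 0 ≤ lam n * ((l / 2 ^ n) ^ 3)⁻¹ *
        ∫ r in (l / 2 ^ n / 2)..(l / 2 ^ n), diffEnergy F r := fun n => by
    have hn : 0 < l / 2 ^ n := by positivity
    refine mul_nonneg (mul_nonneg (h0 n) (by positivity))
      (intervalIntegral.integral_nonneg (by linarith) fun r _ => diffEnergy_nonneg F r)
  have h4 : ∑' n : ℕ, ENNReal.ofReal (4 * (lam n * ((l / 2 ^ n) ^ 3)⁻¹ *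
        ∫ r in (l / 2 ^ n / 2)..(l / 2 ^ n), diffEnergy F r)) ≤ ENNReal.ofReal (4 * E) := by
    refine ENNReal.tsum_le_of_sum_range_le fun N => ?_
    rw [← ENNReal.ofReal_sum_of_nonneg fun n _ => mul_nonneg (by norm_num) (hnn n)]
    refine ENNReal.ofReal_le_ofReal ?_
    rw [← Finset.mul_sum]
    exact mul_le_mul_of_nonneg_left (hE N) (by norm_num)
  have h5 := h1.trans (mul_le_mul_right h4 24)
  have h6 : L = 2 * (L * ENNReal.ofReal (1 - 1 / 2)) := by
    rw [mul_comm L, ← mul_assoc, show (2 : ENNReal) = ENNReal.ofReal 2 by simp,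
      ← ENNReal.ofReal_mul (by norm_num)]
    norm_num
  rw [h6]
  refine (mul_le_mul_right h5 2).trans (le_of_eq ?_)
  rw [show (2 : ENNReal) = ENNReal.ofReal 2 by simp, show (24 : ENNReal) = ENNReal.ofReal 24 by simp,
    ← ENNReal.ofReal_mul (by norm_num), ← ENNReal.ofReal_mul (by norm_num)]
  congr 1; ring

end DyadicDifferences

/-! ### The quadratic form of a triangular kernel -/

section Triangle

variable {f : ℝ → ℝ} {l : ℝ}

/-- The triangular kernel `(r - |t|)₊`. -/
def triangle (r t : ℝ) : ℝ := max (r - |t|) 0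

theorem triangle_nonneg (r t : ℝ) : 0 ≤ triangle r t := le_max_right _ _

theorem integrable_of_memLp_two (hf : MemLp f 2) (h0 : ∀ x, x ∉ Ioo 0 l → f x = 0) :
    Integrable f := by
  have h1 : IntegrableOn f (Ioo 0 l) :=
    (hf.mono_measure Measure.restrict_le_self).integrable (by norm_num)
  rw [← integrable_indicator_iff measurableSet_Ioo] at h1
  refine h1.congr (Eventually.of_forall fun x => ?_)
  by_cases hx : x ∈ Ioo 0 l
  · rw [indicator_of_mem hx]
  · rw [indicator_of_notMem hx, h0 x hx]

theorem continuous_primitive' (hf : Integrable f) :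
    Continuous fun x => ∫ t in (0 : ℝ)..x, f t :=
  intervalIntegral.continuous_primitive (fun _ _ => hf.intervalIntegrable) 0

/-- For `f` supported in `(0, l)` only `x ∈ [-r, l]` contributes. Inserting that indicator makes the
integrand a restriction of an integrable product, as Fubini requires. -/
theorem integrable_triangle_integrand (hf : Integrable f) (r : ℝ) :
    Integrable (fun q : ℝ × ℝ × ℝ => {q : ℝ × ℝ × ℝ | (q.1 < q.2.1 ∧ q.2.1 ≤ q.1 + r) ∧
      (q.1 < q.2.2 ∧ q.2.2 ≤ q.1 + r)}.indicator
        (fun q => (Icc (-r) l).indicator (fun _ => (1 : ℝ)) q.1 * (f q.2.1 * f q.2.2)) q) := by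
  have h1 : Integrable ((Icc (-r) l).indicator (fun _ => (1 : ℝ))) := by
    rw [integrable_indicator_iff measurableSet_Icc]
    exact integrableOn_const (by simp)
  refine (h1.mul_prod (hf.mul_prod hf)).indicator ?_
  refine MeasurableSet.inter (MeasurableSet.inter ?_ ?_) (MeasurableSet.inter ?_ ?_)
  · exact measurableSet_lt measurable_fst (measurable_fst.comp measurable_snd)
  · exact measurableSet_le (measurable_fst.comp measurable_snd) (measurable_fst.add_const r)
  · exact measurableSet_lt measurable_fst (measurable_snd.comp measurable_snd)
  · exact measurableSet_le (measurable_snd.comp measurable_snd) (measurable_fst.add_const r)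

theorem sq_increment_eq (hf : Integrable f) (h0 : ∀ x, x ∉ Ioo 0 l → f x = 0) {r : ℝ}
    (hr : 0 ≤ r) (x : ℝ) :
    ((∫ t in (0 : ℝ)..(x + r), f t) - ∫ t in (0 : ℝ)..x, f t) ^ 2
      = ∫ p : ℝ × ℝ, {q : ℝ × ℝ × ℝ | (q.1 < q.2.1 ∧ q.2.1 ≤ q.1 + r) ∧
        (q.1 < q.2.2 ∧ q.2.2 ≤ q.1 + r)}.indicator
          (fun q => (Icc (-r) l).indicator (fun _ => (1 : ℝ)) q.1 * (f q.2.1 * f q.2.2)) (x, p) := by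
  rw [intervalIntegral.integral_interval_sub_left hf.intervalIntegrable hf.intervalIntegrable,
    intervalIntegral.integral_of_le (by linarith), ← integral_indicator measurableSet_Ioc, sq,
    ← integral_prod_mul]
  refine integral_congr_ae (Eventually.of_forall fun p => ?_)
  simp only [indicator, mem_Ioc, mem_Icc, mem_ofPred_eq]
  by_cases h1 : x < p.1 ∧ p.1 ≤ x + r <;> by_cases h2 : x < p.2 ∧ p.2 ≤ x + r
  · by_cases h3 : -r ≤ x ∧ x ≤ l
    · simp [h1, h2, h3]
    · have : f p.1 = 0 := h0 _ fun h => h3 ⟨by linarith [h.1, h1.2], by linarith [h.2, h1.1]⟩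
      simp [this]
  · simp [h1, h2]
  · simp [h1]
  · simp [h1]

theorem integrable_sq_increment (hf : Integrable f) (h0 : ∀ x, x ∉ Ioo 0 l → f x = 0) {r : ℝ}
    (hr : 0 ≤ r) :
    Integrable fun x => ((∫ t in (0 : ℝ)..(x + r), f t) - ∫ t in (0 : ℝ)..x, f t) ^ 2 := by
  simp_rw [sq_increment_eq hf h0 hr]
  exact (integrable_triangle_integrand hf r).integral_prod_left

/-- Fubini: the set of `x` with both `u` and `v` in `(x, x + r]` has measure `(r - |u - v|)₊`. In
particular the triangle is a positive definite kernel. -/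
theorem diffEnergy_primitive (hf : Integrable f) (h0 : ∀ x, x ∉ Ioo 0 l → f x = 0) {r : ℝ}
    (hr : 0 ≤ r) :
    diffEnergy (fun x => ∫ t in (0 : ℝ)..x, f t) r
      = ∫ p : ℝ × ℝ, f p.1 * f p.2 * triangle r (p.1 - p.2) := by
  rw [diffEnergy]
  simp_rw [sq_increment_eq hf h0 hr]
  rw [integral_integral_swap (integrable_triangle_integrand hf r)]
  refine integral_congr_ae (Eventually.of_forall fun p => ?_)
  obtain ⟨u, v⟩ := p
  by_cases hu : u ∈ Ioo 0 l
  swap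
  · simp [indicator, h0 u hu]
  by_cases hv : v ∈ Ioo 0 l
  swap
  · simp [indicator, h0 v hv]
  have h1 : ∀ x, {q : ℝ × ℝ × ℝ | (q.1 < q.2.1 ∧ q.2.1 ≤ q.1 + r) ∧
        (q.1 < q.2.2 ∧ q.2.2 ≤ q.1 + r)}.indicator
          (fun q => (Icc (-r) l).indicator (fun _ => (1 : ℝ)) q.1 * (f q.2.1 * f q.2.2)) (x, u, v)
      = (Ico (max u v - r) (min u v)).indicator (fun _ => f u * f v) x := by
    intro x
    have h2 : x ∈ Ico (max u v - r) (min u v) ↔ (x < u ∧ u ≤ x + r) ∧ (x < v ∧ v ≤ x + r) := by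
      rw [mem_Ico, sub_le_iff_le_add, max_le_iff, lt_min_iff]; tauto
    simp only [indicator, mem_ofPred_eq, h2, mem_Icc]
    by_cases h3 : (x < u ∧ u ≤ x + r) ∧ (x < v ∧ v ≤ x + r)
    · have h4 : -r ≤ x ∧ x ≤ l := ⟨by linarith [h3.1.2, hu.1], by linarith [h3.1.1, hu.2]⟩
      simp [h3, h4]
    · simp [h3]
  simp only [h1]
  rw [integral_indicator measurableSet_Ico, setIntegral_const, smul_eq_mul, mul_comm,
    measureReal_def, Real.volume_Ico, triangle]
  congr 1
  rw [ENNReal.toReal_ofReal', ← max_sub_min_eq_abs']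
  congr 1
  ring

theorem integrable_prod_weight (hf : Integrable f) {ν : ℝ → ℝ} {R : ℝ}
    (hν : IntegrableOn ν (Ioc 0 R)) :
    Integrable (fun q : (ℝ × ℝ) × ℝ => f q.1.1 * f q.1.2 * (ν q.2 * triangle q.2 (q.1.1 - q.1.2)))
      ((volume : Measure (ℝ × ℝ)).prod (volume.restrict (Ioc 0 R))) := by
  have h1 : Integrable (fun q : (ℝ × ℝ) × ℝ => (f q.1.1 * f q.1.2) * ν q.2)
      ((volume : Measure (ℝ × ℝ)).prod (volume.restrict (Ioc 0 R))) :=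
    (hf.mul_prod hf).mul_prod hν
  have hc : Continuous fun q : (ℝ × ℝ) × ℝ => triangle q.2 (q.1.1 - q.1.2) := by
    unfold triangle; fun_prop
  have h2 : ∀ᵐ q ∂((volume : Measure (ℝ × ℝ)).prod (volume.restrict (Ioc 0 R))),
      ‖triangle q.2 (q.1.1 - q.1.2)‖ ≤ |R| := by
    have h3 : ∀ᵐ r ∂(volume.restrict (Ioc 0 R)), r ≤ R :=
      (ae_restrict_mem measurableSet_Ioc).mono fun r hr => hr.2
    have h4 := (Measure.quasiMeasurePreserving_snd (μ := (volume : Measure (ℝ × ℝ)))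
      (ν := volume.restrict (Ioc 0 R))).ae h3
    filter_upwards [h4] with q hq
    rw [Real.norm_of_nonneg (triangle_nonneg _ _), triangle]
    refine max_le ?_ (abs_nonneg _)
    linarith [abs_nonneg (q.1.1 - q.1.2), le_abs_self R]
  refine (h1.bdd_mul hc.aestronglyMeasurable h2).congr (Eventually.of_forall fun q => ?_)
  ring

theorem intervalIntegrable_weight_diffEnergy (hf : Integrable f)
    (h0 : ∀ x, x ∉ Ioo 0 l → f x = 0) {ν : ℝ → ℝ} {R : ℝ} (hR : 0 ≤ R)
    (hν : IntegrableOn ν (Ioc 0 R)) :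
    IntervalIntegrable (fun r => ν r * diffEnergy (fun x => ∫ t in (0 : ℝ)..x, f t) r)
      volume 0 R := by
  rw [intervalIntegrable_iff_integrableOn_Ioc_of_le hR]
  refine (integrable_prod_weight hf hν).integral_prod_right.congr ?_
  filter_upwards [ae_restrict_mem measurableSet_Ioc] with r hr
  rw [diffEnergy_primitive hf h0 hr.1.le, ← integral_const_mul]
  exact integral_congr_ae (Eventually.of_forall fun p => by ring)

theorem integral_weight_diffEnergy (hf : Integrable f) (h0 : ∀ x, x ∉ Ioo 0 l → f x = 0)
    {ν : ℝ → ℝ} {R : ℝ} (hR : 0 ≤ R) (hν : IntegrableOn ν (Ioc 0 R)) :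
    ∫ r in (0 : ℝ)..R, ν r * diffEnergy (fun x => ∫ t in (0 : ℝ)..x, f t) r
      = ∫ p : ℝ × ℝ, f p.1 * f p.2 * ∫ r in (0 : ℝ)..R, ν r * triangle r (p.1 - p.2) := by
  have h1 : ∫ r in (0 : ℝ)..R, ν r * diffEnergy (fun x => ∫ t in (0 : ℝ)..x, f t) r
      = ∫ r in Ioc 0 R, ∫ p : ℝ × ℝ, f p.1 * f p.2 * (ν r * triangle r (p.1 - p.2)) := by
    rw [intervalIntegral.integral_of_le hR]
    refine setIntegral_congr_fun measurableSet_Ioc fun r hr => ?_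
    rw [diffEnergy_primitive hf h0 hr.1.le, ← integral_const_mul]
    exact integral_congr_ae (Eventually.of_forall fun p => by ring)
  rw [h1, ← integral_integral_swap (integrable_prod_weight hf hν)]
  refine integral_congr_ae (Eventually.of_forall fun p => ?_)
  beta_reduce
  rw [integral_const_mul, intervalIntegral.integral_of_le hR]

theorem intervalIntegrable_diffEnergy (hf : Integrable f) (h0 : ∀ x, x ∉ Ioo 0 l → f x = 0)
    {a b : ℝ} (ha : 0 ≤ a) (hb : 0 ≤ b) :
    IntervalIntegrable (diffEnergy (fun x => ∫ t in (0 : ℝ)..x, f t)) volume a b := by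
  have h1 : ∀ R, 0 ≤ R → IntervalIntegrable (diffEnergy (fun x => ∫ t in (0 : ℝ)..x, f t))
      volume 0 R := fun R hR => by
    simpa using intervalIntegrable_weight_diffEnergy hf h0 hR (ν := fun _ => 1)
      (integrableOn_const (by simp))
  exact (h1 a ha).symm.trans (h1 b hb)

end Triangle

/-! ### The kernel as a positive mixture of triangles -/

namespace TsirelsonKernel

variable {α : ℝ} (K : TsirelsonKernel α)

/-- `∫₀ˣ B`. -/
def prim (x : ℝ) : ℝ := ∫ t in (0 : ℝ)..x, K.B t

/-- The second primitive of `B`. -/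
def primTwo (x : ℝ) : ℝ := ∫ t in (0 : ℝ)..x, K.prim t

theorem continuous_prim : Continuous K.prim := continuous_primitive' K.integrable

theorem prim_sub (x y : ℝ) : K.prim y - K.prim x = ∫ t in x..y, K.B t :=
  intervalIntegral.integral_interval_sub_left K.integrable.intervalIntegrable
    K.integrable.intervalIntegrable

theorem continuousAt_B {x : ℝ} (hx : 0 < x) : ContinuousAt K.B x :=
  K.continuousOn.continuousAt (isOpen_compl_singleton.mem_nhds hx.ne')

theorem hasDerivAt_prim {x : ℝ} (hx : 0 < x) : HasDerivAt K.prim (K.B x) x := by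
  refine intervalIntegral.integral_hasDerivAt_right K.integrable.intervalIntegrable
    ?_ (K.continuousAt_B hx)
  exact ⟨univ, univ_mem, K.integrable.1.restrict⟩

theorem hasDerivAt_primTwo (x : ℝ) : HasDerivAt K.primTwo (K.prim x) x :=
  (K.continuous_prim.integral_hasStrictDerivAt 0 x).hasDerivAt

theorem continuous_primTwo : Continuous K.primTwo :=
  continuous_iff_continuousAt.2 fun x => (K.hasDerivAt_primTwo x).continuousAt

theorem B_abs (t : ℝ) : K.B |t| = K.B t := by
  rcases abs_cases t with ⟨h, _⟩ | ⟨h, _⟩ <;> rw [h]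
  exact K.even t

theorem prim_sub_le {x y : ℝ} (hx : 0 < x) (hxy : x ≤ y) :
    K.prim y - K.prim x ≤ (y - x) * K.B x := by
  rw [prim_sub, ← smul_eq_mul, ← intervalIntegral.integral_const]
  exact intervalIntegral.integral_mono_on hxy K.integrable.intervalIntegrable (by simp)
    fun t ht => K.antitone hx (hx.trans_le ht.1) ht.1

theorem le_prim_sub {x y : ℝ} (hx : 0 < x) (hxy : x ≤ y) :
    (y - x) * K.B y ≤ K.prim y - K.prim x := by
  rw [prim_sub, ← smul_eq_mul, ← intervalIntegral.integral_const]
  exact intervalIntegral.integral_mono_on hxy (by simp) K.integrable.intervalIntegrable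
    fun t ht => K.antitone (hx.trans_le ht.1) (hx.trans_le hxy) ht.2

/-- `B` averaged over `[t, t + 2δ]` with a triangular weight. -/
def smooth (δ t : ℝ) : ℝ :=
  (δ ^ 2)⁻¹ * (K.primTwo t - 2 * K.primTwo (t + δ) + K.primTwo (t + 2 * δ))

/-- The derivative of `K.smooth δ`. -/
def smoothDeriv (δ t : ℝ) : ℝ :=
  (δ ^ 2)⁻¹ * (K.prim t - 2 * K.prim (t + δ) + K.prim (t + 2 * δ))

/-- The second difference quotient of `B`. -/
def secondDiff (δ t : ℝ) : ℝ := (δ ^ 2)⁻¹ * (K.B t - 2 * K.B (t + δ) + K.B (t + 2 * δ))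

theorem continuous_smooth (δ : ℝ) : Continuous (K.smooth δ) := by
  have := K.continuous_primTwo
  unfold smooth; fun_prop

theorem hasDerivAt_smooth (δ t : ℝ) : HasDerivAt (K.smooth δ) (K.smoothDeriv δ t) t := by
  have h : ∀ c : ℝ, HasDerivAt (fun t => K.primTwo (t + c)) (K.prim (t + c)) t := fun c =>
    (K.hasDerivAt_primTwo (t + c)).comp_add_const t c
  exact (((K.hasDerivAt_primTwo t).sub ((h δ).const_mul 2)).add (h (2 * δ))).const_mul _

theorem hasDerivAt_smoothDeriv {δ t : ℝ} (hδ : 0 < δ) (ht : 0 < t) :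
    HasDerivAt (K.smoothDeriv δ) (K.secondDiff δ t) t := by
  have h : ∀ c : ℝ, 0 ≤ c → HasDerivAt (fun t => K.prim (t + c)) (K.B (t + c)) t := fun c hc =>
    (K.hasDerivAt_prim (by linarith : 0 < t + c)).comp_add_const t c
  exact (((K.hasDerivAt_prim ht).sub ((h δ hδ.le).const_mul 2)).add
    (h (2 * δ) (by linarith))).const_mul _

/-- The second difference of the second primitive is a double average of `B` over `[t, t + 2δ]`;
monotonicity of `B` then squeezes it between `B (t + 2δ)` and `B t`. -/
theorem smooth_eq {δ : ℝ} (t : ℝ) :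
    K.smooth δ t = (δ ^ 2)⁻¹ * ∫ x in t..(t + δ), (K.prim (x + δ) - K.prim x) := by
  have hc := K.continuous_prim
  have e : ∀ a b, ∫ x in a..b, K.prim x = K.primTwo b - K.primTwo a := fun a b =>
    intervalIntegral.integral_eq_sub_of_hasDerivAt (fun x _ => K.hasDerivAt_primTwo x)
      (hc.intervalIntegrable _ _)
  rw [intervalIntegral.integral_sub (Continuous.intervalIntegrable (by fun_prop) _ _)
    (hc.intervalIntegrable _ _), intervalIntegral.integral_comp_add_right, e, e, smooth]
  congr 1
  rw [show t + δ + δ = t + 2 * δ by ring]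
  ring

theorem smooth_le {δ t : ℝ} (hδ : 0 < δ) (ht : 0 < t) : K.smooth δ t ≤ K.B t := by
  have hc := K.continuous_prim
  rw [smooth_eq, inv_mul_le_iff₀ (by positivity)]
  have : ∫ x in t..(t + δ), (K.prim (x + δ) - K.prim x) ≤ ∫ x in t..(t + δ), δ * K.B t := by
    refine intervalIntegral.integral_mono_on (by linarith)
      (Continuous.intervalIntegrable (by fun_prop) _ _) (by simp) fun x hx => ?_
    refine (K.prim_sub_le (ht.trans_le hx.1) (by linarith)).trans ?_
    rw [add_sub_cancel_left]
    exact mul_le_mul_of_nonneg_left (K.antitone ht (ht.trans_le hx.1) hx.1) hδ.le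
  rw [intervalIntegral.integral_const, smul_eq_mul] at this
  linarith

theorem le_smooth {δ t : ℝ} (hδ : 0 < δ) (ht : 0 < t) : K.B (t + 2 * δ) ≤ K.smooth δ t := by
  have hc := K.continuous_prim
  rw [smooth_eq, le_inv_mul_iff₀ (by positivity)]
  have : ∫ x in t..(t + δ), δ * K.B (t + 2 * δ) ≤ ∫ x in t..(t + δ), (K.prim (x + δ) - K.prim x) := by
    refine intervalIntegral.integral_mono_on (by linarith) (by simp)
      (Continuous.intervalIntegrable (by fun_prop) _ _) fun x hx => ?_
    refine le_trans ?_ (K.le_prim_sub (ht.trans_le hx.1) (by linarith))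
    rw [add_sub_cancel_left]
    exact mul_le_mul_of_nonneg_left (K.antitone (by simp; linarith [hx.1]) (by simp; linarith)
      (by linarith [hx.2])) hδ.le
  rw [intervalIntegral.integral_const, smul_eq_mul] at this
  linarith

theorem smooth_nonneg {δ t : ℝ} (hδ : 0 < δ) (ht : 0 < t) : 0 ≤ K.smooth δ t :=
  (K.nonneg _ (by linarith)).trans (K.le_smooth hδ ht)

theorem smoothDeriv_nonpos {δ t : ℝ} (hδ : 0 < δ) (ht : 0 < t) : K.smoothDeriv δ t ≤ 0 := by
  have h1 := K.le_prim_sub ht (by linarith : t ≤ t + δ)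
  have h2 := K.prim_sub_le (by linarith : 0 < t + δ) (by linarith : t + δ ≤ t + 2 * δ)
  refine mul_nonpos_of_nonneg_of_nonpos (by positivity) ?_
  nlinarith

theorem secondDiff_nonneg {δ t : ℝ} (ht : 0 < t) (hδ : 0 < δ) : 0 ≤ K.secondDiff δ t := by
  refine mul_nonneg (by positivity) ?_
  have h := K.convex.2 (show t ∈ Ioi 0 from ht) (show t + 2 * δ ∈ Ioi 0 by simp; linarith)
    (show (0 : ℝ) ≤ 1 / 2 by norm_num) (show (0 : ℝ) ≤ 1 / 2 by norm_num) (by norm_num)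
  simp only [smul_eq_mul] at h
  rw [show 1 / 2 * t + 1 / 2 * (t + 2 * δ) = t + δ by ring] at h
  linarith

theorem integrable_secondDiff (δ : ℝ) : Integrable (K.secondDiff δ) := by
  exact ((K.integrable.sub ((K.integrable.comp_add_right δ).const_mul 2)).add
    (K.integrable.comp_add_right (2 * δ))).const_mul _

/-- Taylor's formula at `R` with integral remainder. The remainder may start at `0` because
`triangle r t` vanishes for `r ≤ t`; this makes the domain of integration independent of `t`. -/
theorem smooth_taylor {δ t R : ℝ} (hδ : 0 < δ) (ht : 0 < t) (htR : t ≤ R) :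
    K.smooth δ t = K.smooth δ R - K.smoothDeriv δ R * triangle R t
      + ∫ r in (0 : ℝ)..R, K.secondDiff δ r * triangle r t := by
  have hi : ∀ a b, IntervalIntegrable (K.secondDiff δ) volume a b := fun a b =>
    (K.integrable_secondDiff δ).intervalIntegrable
  have htri : Continuous fun r => triangle r t := by unfold triangle; fun_prop
  have hi2 : ∀ a b, IntervalIntegrable (fun r => K.secondDiff δ r * triangle r t) volume a b :=
    fun a b => (hi a b).mul_continuousOn htri.continuousOn
  have hsub : ∀ x ∈ uIcc t R, 0 < x := fun x hx => by
    rw [uIcc_of_le htR] at hx; exact ht.trans_le hx.1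
  have hcd : ContinuousOn (K.smoothDeriv δ) (uIcc t R) := fun x hx =>
    (K.hasDerivAt_smoothDeriv hδ (hsub x hx)).continuousAt.continuousWithinAt
  have h1 : ∫ r in (0 : ℝ)..t, K.secondDiff δ r * triangle r t = 0 := by
    rw [intervalIntegral.integral_congr (g := fun _ => (0 : ℝ)) fun r hr => ?_]
    · simp
    rw [uIcc_of_le ht.le] at hr
    have : triangle r t = 0 := by
      rw [triangle, abs_of_pos ht]; exact max_eq_right (by linarith [hr.2])
    simp [this]
  have h2 : ∫ r in t..R, K.secondDiff δ r * triangle r t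
      = ∫ r in t..R, (r - t) * K.secondDiff δ r := by
    refine intervalIntegral.integral_congr fun r hr => ?_
    rw [uIcc_of_le htR] at hr
    have : triangle r t = r - t := by
      rw [triangle, abs_of_pos ht]; exact max_eq_left (by linarith [hr.1])
    simp only [this]; ring
  have h3 := intervalIntegral.integral_mul_deriv_eq_deriv_mul
    (u := fun r => r - t) (u' := fun _ => 1) (v := K.smoothDeriv δ) (v' := K.secondDiff δ)
    (a := t) (b := R) (fun x _ => (hasDerivAt_id x).sub_const t)
    (fun x hx => K.hasDerivAt_smoothDeriv hδ (hsub x hx)) (by simp) (hi _ _)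
  have h4 : ∫ x in t..R, K.smoothDeriv δ x = K.smooth δ R - K.smooth δ t :=
    intervalIntegral.integral_eq_sub_of_hasDerivAt (fun x _ => K.hasDerivAt_smooth δ x)
      hcd.intervalIntegrable
  have h5 : triangle R t = R - t := by
    rw [triangle, abs_of_pos ht]; exact max_eq_left (by linarith)
  simp only [one_mul, h4] at h3
  rw [← intervalIntegral.integral_add_adjacent_intervals (hi2 0 t) (hi2 t R), h1, h2, h3, h5]
  ring

variable {f : ℝ → ℝ} {l : ℝ}

theorem ae_sub_ne_zero : ∀ᵐ p : ℝ × ℝ, p.1 - p.2 ≠ 0 := by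
  have h : ∀ᵐ t : ℝ, t ≠ 0 := by
    rw [ae_iff]; simp
  exact (quasiMeasurePreserving_sub volume volume).ae h

/-- By `smooth_taylor` the right side exceeds the left by `smooth(l) (∫ f)²` and by `-smooth'(l)`
times the energy at step `l`. Both are nonnegative because `B` is nonnegative and nonincreasing. -/
theorem integral_secondDiff_le (hf : MemLp f 2) (h0 : ∀ x, x ∉ Ioo 0 l → f x = 0) (hl : 0 < l)
    {δ : ℝ} (hδ : 0 < δ) :
    ∫ r in (0 : ℝ)..l, K.secondDiff δ r * diffEnergy (fun x => ∫ t in (0 : ℝ)..x, f t) r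
      ≤ ∫ p : ℝ × ℝ, f p.1 * f p.2 * K.smooth δ |p.1 - p.2| := by
  have hfi := integrable_of_memLp_two hf h0
  have hν : IntegrableOn (K.secondDiff δ) (Ioc 0 l) := (K.integrable_secondDiff δ).integrableOn
  rw [integral_weight_diffEnergy hfi h0 hl.le hν]
  have hff : Integrable fun p : ℝ × ℝ => f p.1 * f p.2 := hfi.mul_prod hfi
  have hI : Integrable fun p : ℝ × ℝ => f p.1 * f p.2 *
      ∫ r in (0 : ℝ)..l, K.secondDiff δ r * triangle r (p.1 - p.2) := by
    refine (integrable_prod_weight hfi hν).integral_prod_left.congr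
      (Eventually.of_forall fun p => ?_)
    simp only
    rw [integral_const_mul, intervalIntegral.integral_of_le hl.le]
  have hT : Integrable fun p : ℝ × ℝ => f p.1 * f p.2 * triangle l (p.1 - p.2) := by
    have hc : Continuous fun p : ℝ × ℝ => triangle l (p.1 - p.2) := by unfold triangle; fun_prop
    refine (hff.bdd_mul (c := l) hc.aestronglyMeasurable (Eventually.of_forall fun p => ?_)).congr
      (Eventually.of_forall fun p => mul_comm _ _)
    rw [Real.norm_of_nonneg (triangle_nonneg _ _), triangle]
    exact max_le (by linarith [abs_nonneg (p.1 - p.2)]) hl.le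
  have h1 : ∫ p : ℝ × ℝ, f p.1 * f p.2 * K.smooth δ |p.1 - p.2|
      = ∫ p : ℝ × ℝ, (K.smooth δ l * (f p.1 * f p.2)
        + (-K.smoothDeriv δ l) * (f p.1 * f p.2 * triangle l (p.1 - p.2))
        + f p.1 * f p.2 * ∫ r in (0 : ℝ)..l, K.secondDiff δ r * triangle r (p.1 - p.2)) := by
    refine integral_congr_ae ?_
    filter_upwards [ae_sub_ne_zero] with p hp
    by_cases h1 : p.1 ∈ Ioo 0 l
    swap
    · simp [h0 _ h1]
    by_cases h2 : p.2 ∈ Ioo 0 l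
    swap
    · simp [h0 _ h2]
    have h3 : |p.1 - p.2| ≤ l := by
      rw [abs_le]; constructor <;> linarith [h1.1, h1.2, h2.1, h2.2]
    rw [K.smooth_taylor hδ (abs_pos.2 hp) h3]
    simp only [triangle, abs_abs]
    ring
  have h4 : Integrable fun p : ℝ × ℝ => K.smooth δ l * (f p.1 * f p.2)
      + (-K.smoothDeriv δ l) * (f p.1 * f p.2 * triangle l (p.1 - p.2)) :=
    (hff.const_mul _).add (hT.const_mul _)
  rw [h1, integral_add h4 hI, integral_add (hff.const_mul _) (hT.const_mul _), integral_const_mul, integral_const_mul,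
    ← diffEnergy_primitive hfi h0 hl.le, Measure.volume_eq_prod, integral_prod_mul]
  have h2 := mul_nonneg (K.smooth_nonneg hδ hl) (mul_self_nonneg (∫ x, f x))
  have h3 := mul_nonneg (neg_nonneg.2 (K.smoothDeriv_nonpos hδ hl))
    (diffEnergy_nonneg (fun x => ∫ t in (0 : ℝ)..x, f t) l)
  linarith

theorem tendsto_smooth {t : ℝ} (ht : 0 < t) :
    Tendsto (fun δ => K.smooth δ t) (𝓝[>] 0) (𝓝 (K.B t)) := by
  have h1 : Tendsto (fun δ : ℝ => K.B (t + 2 * δ)) (𝓝[>] 0) (𝓝 (K.B t)) := by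
    have hc : ContinuousAt (fun δ : ℝ => K.B (t + 2 * δ)) 0 :=
      ContinuousAt.comp (g := K.B) (f := fun δ : ℝ => t + 2 * δ)
        (by simpa using K.continuousAt_B ht) (by fun_prop)
    have := hc.tendsto.mono_left (nhdsWithin_le_nhds (s := Ioi 0))
    simpa using this
  refine tendsto_of_tendsto_of_tendsto_of_le_of_le' h1 tendsto_const_nhds ?_ ?_
  · exact eventually_mem_nhdsWithin.mono fun δ hδ => K.le_smooth hδ ht
  · exact eventually_mem_nhdsWithin.mono fun δ hδ => K.smooth_le hδ ht

theorem tendsto_integral_smooth (hf : MemLp f 2) :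
    Tendsto (fun δ => ∫ p : ℝ × ℝ, f p.1 * f p.2 * K.smooth δ |p.1 - p.2|) (𝓝[>] 0)
      (𝓝 (kernelForm K.B f f)) := by
  refine tendsto_integral_filter_of_dominated_convergence
    (fun p => ‖f p.1 * f p.2 * K.B (p.1 - p.2)‖) ?_ ?_
    (kernelForm_integrable K.integrable hf hf).norm ?_
  · refine Eventually.of_forall fun δ => ?_
    refine (hf.1.comp_fst.mul hf.1.comp_snd).mul ?_
    have := K.continuous_smooth δ
    exact Continuous.aestronglyMeasurable (by fun_prop)
  · refine eventually_mem_nhdsWithin.mono fun δ hδ => ?_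
    filter_upwards [ae_sub_ne_zero] with p hp
    have hp' := abs_pos.2 hp
    rw [norm_mul, norm_mul (f p.1 * f p.2)]
    refine mul_le_mul_of_nonneg_left ?_ (norm_nonneg _)
    rw [Real.norm_of_nonneg (K.smooth_nonneg hδ hp')]
    refine (K.smooth_le hδ hp').trans ?_
    rw [K.B_abs]
    exact Real.le_norm_self _
  · filter_upwards [ae_sub_ne_zero] with p hp
    have := (K.tendsto_smooth (abs_pos.2 hp)).const_mul (f p.1 * f p.2)
    rwa [K.B_abs] at this

/-- A lower bound for the scalar product in terms of lower bounds for the second differences of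
the kernel at dyadic scales. -/
theorem sum_energy_le_kernelForm (hf : MemLp f 2) (h0 : ∀ x, x ∉ Ioo 0 l → f x = 0) (hl : 0 < l)
    {κ : ℕ → ℝ} (hκ : ∀ n, ∀ᶠ δ in 𝓝[>] (0 : ℝ), ∀ r ∈ Icc (l / 2 ^ n / 2) (l / 2 ^ n),
      κ n ≤ K.secondDiff δ r) (N : ℕ) :
    ∑ n ∈ Finset.range N, κ n * ∫ r in (l / 2 ^ n / 2)..(l / 2 ^ n),
      diffEnergy (fun x => ∫ t in (0 : ℝ)..x, f t) r ≤ kernelForm K.B f f := by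
  have hfi := integrable_of_memLp_two hf h0
  set E := diffEnergy (fun x => ∫ t in (0 : ℝ)..x, f t)
  have hev : ∀ᶠ δ in 𝓝[>] (0 : ℝ), ∀ n ∈ Finset.range N,
      ∀ r ∈ Icc (l / 2 ^ n / 2) (l / 2 ^ n), κ n ≤ K.secondDiff δ r :=
    (Filter.eventually_all_finset _).2 fun n _ => hκ n
  refine ge_of_tendsto (K.tendsto_integral_smooth hf) ?_
  filter_upwards [hev, eventually_mem_nhdsWithin] with δ hδ hδ0
  refine le_trans ?_ (K.integral_secondDiff_le hf h0 hl hδ0)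
  have hII : ∀ a b, 0 ≤ a → 0 ≤ b →
      IntervalIntegrable (fun r => K.secondDiff δ r * E r) volume a b := by
    have h1 : ∀ R, 0 ≤ R → IntervalIntegrable (fun r => K.secondDiff δ r * E r) volume 0 R :=
      fun R hR => intervalIntegrable_weight_diffEnergy hfi h0 hR
        (K.integrable_secondDiff δ).integrableOn
    exact fun a b ha hb => (h1 a ha).symm.trans (h1 b hb)
  have h1 : ∀ n ∈ Finset.range N, κ n * ∫ r in (l / 2 ^ n / 2)..(l / 2 ^ n), E r
      ≤ ∫ r in (l / 2 ^ (n + 1))..(l / 2 ^ n), K.secondDiff δ r * E r := by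
    intro n hn
    have hpos : 0 < l / 2 ^ n := by positivity
    rw [show l / 2 ^ (n + 1) = l / 2 ^ n / 2 by rw [pow_succ]; field_simp,
      ← intervalIntegral.integral_const_mul]
    refine intervalIntegral.integral_mono_on (by linarith)
      ((intervalIntegrable_diffEnergy hfi h0 (by linarith) hpos.le).const_mul _)
      (hII _ _ (by linarith) hpos.le) fun r hr => ?_
    exact mul_le_mul_of_nonneg_right (hδ n hn r hr) (diffEnergy_nonneg _ _)
  refine (Finset.sum_le_sum h1).trans ?_
  have h2 : ∀ M : ℕ, ∑ n ∈ Finset.range M,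
      ∫ r in (l / 2 ^ (n + 1))..(l / 2 ^ n), K.secondDiff δ r * E r
      = ∫ r in (l / 2 ^ M)..l, K.secondDiff δ r * E r := by
    intro M
    induction M with
    | zero => simp
    | succ M ih =>
      rw [Finset.sum_range_succ, ih, add_comm]
      exact intervalIntegral.integral_add_adjacent_intervals
        (hII _ _ (by positivity) (by positivity)) (hII _ _ (by positivity) hl.le)
  have hN : 0 < l / 2 ^ N := by positivity
  have hNl : l / 2 ^ N ≤ l := div_le_self hl.le (one_le_pow₀ (by norm_num))
  rw [h2, ← intervalIntegral.integral_add_adjacent_intervals (hII 0 (l / 2 ^ N) le_rfl hN.le)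
    (hII (l / 2 ^ N) l hN.le hl.le)]
  have h3 : 0 ≤ ∫ r in (0 : ℝ)..(l / 2 ^ N), K.secondDiff δ r * E r := by
    rw [intervalIntegral.integral_of_le hN.le]
    exact setIntegral_nonneg measurableSet_Ioc fun r hr =>
      mul_nonneg (K.secondDiff_nonneg hr.1 hδ0) (diffEnergy_nonneg _ _)
  linarith

end TsirelsonKernel

/-! ### Second differences of the logarithmic kernel -/

/-- A second difference is bounded below by a lower bound of the second derivative. -/
theorem le_second_difference {g g' g'' : ℝ → ℝ} {r δ κ : ℝ} (hδ : 0 < δ)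
    (hg : ∀ x ∈ Icc r (r + 2 * δ), HasDerivAt g (g' x) x)
    (hg' : ∀ x ∈ Icc r (r + 2 * δ), HasDerivAt g' (g'' x) x)
    (hκ : ∀ x ∈ Icc r (r + 2 * δ), κ ≤ g'' x) :
    κ ≤ (δ ^ 2)⁻¹ * (g r - 2 * g (r + δ) + g (r + 2 * δ)) := by
  have hconv : ConvexOn ℝ (Icc r (r + 2 * δ)) fun x => g x - κ / 2 * x ^ 2 := by
    refine convexOn_of_hasDerivWithinAt2_nonneg (convex_Icc _ _)
      (f' := fun x => g' x - κ * x) (f'' := fun x => g'' x - κ) ?_ ?_ ?_ ?_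
    · exact fun x hx => ((hg x hx).continuousAt.sub (by fun_prop)).continuousWithinAt
    · intro x hx
      have hx' := interior_subset hx
      have h2 := ((hasDerivAt_pow 2 x).const_mul (κ / 2))
      refine (((hg x hx').sub h2).congr_deriv ?_).hasDerivWithinAt
      norm_num; ring
    · intro x hx
      have hx' := interior_subset hx
      have h2 := (hasDerivAt_id x).const_mul κ
      refine (((hg' x hx').sub h2).congr_deriv ?_).hasDerivWithinAt
      ring
    · intro x hx
      exact sub_nonneg.2 (hκ x (interior_subset hx))
  have h := hconv.2 (show r ∈ Icc r (r + 2 * δ) from ⟨le_rfl, by linarith⟩)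
    (show r + 2 * δ ∈ Icc r (r + 2 * δ) from ⟨by linarith, le_rfl⟩)
    (show (0 : ℝ) ≤ 1 / 2 by norm_num) (show (0 : ℝ) ≤ 1 / 2 by norm_num) (by norm_num)
  simp only [smul_eq_mul] at h
  rw [show 1 / 2 * r + 1 / 2 * (r + 2 * δ) = r + δ by ring] at h
  rw [le_inv_mul_iff₀ (by positivity)]
  nlinarith

section LogKernel

variable {α : ℝ}

/-- The derivative of `tⁿ (-log t)^β` on `(0, 1)`. -/
theorem hasDerivAt_pow_mul_log_rpow (n : ℤ) (β : ℝ) {t : ℝ} (h0 : 0 < t) (h1 : t < 1) :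
    HasDerivAt (fun t => t ^ n * (-Real.log t) ^ β)
      (n * (t ^ (n - 1) * (-Real.log t) ^ β) - β * (t ^ (n - 1) * (-Real.log t) ^ (β - 1))) t := by
  have hL : 0 < -Real.log t := by linarith [Real.log_neg h0 h1]
  have h2 : HasDerivAt (fun t => -Real.log t) (-t⁻¹) t := (Real.hasDerivAt_log h0.ne').neg
  have h3 := h2.rpow_const (p := β) (Or.inl hL.ne')
  refine ((hasDerivAt_zpow n t (Or.inl h0.ne')).mul h3).congr_deriv ?_
  rw [zpow_sub_one₀ h0.ne']
  ring

/-- With `L = -log t`, the second derivative of `t⁻¹ L^{-α}` is `t⁻³ L^{-α} (2 - 3α/L + α(α+1)/L²)`,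
and the bracket is at least `1` once `L ≥ 3α`. The `8` comes from `t ≤ 2h`. -/
theorem le_second_difference_logKernel (hα : 0 < α) {r δ h c : ℝ} (hδ : 0 < δ) (hr : h / 2 ≤ r)
    (hrδ : r + 2 * δ ≤ 2 * h) (h0 : 0 < h) (h1 : 2 * h < 1) (hh : 3 * α ≤ -Real.log (2 * h))
    (hc : -Real.log (h / 2) ≤ c) :
    (h ^ 3)⁻¹ * (c ^ (-α) / 8) ≤ (δ ^ 2)⁻¹ * (1 / (r * Real.log (1 / r) ^ α)
      - 2 * (1 / ((r + δ) * Real.log (1 / (r + δ)) ^ α))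
      + 1 / ((r + 2 * δ) * Real.log (1 / (r + 2 * δ)) ^ α)) := by
  have hg : ∀ t, 0 < t → t < 1 → 1 / (t * Real.log (1 / t) ^ α)
      = t ^ (-1 : ℤ) * (-Real.log t) ^ (-α) := fun t ht ht1 => by
    have hL : 0 < -Real.log t := by linarith [Real.log_neg ht ht1]
    rw [one_div t, Real.log_inv, Real.rpow_neg hL.le, zpow_neg_one, one_div, mul_inv]
  rw [hg r (by linarith) (by linarith), hg (r + δ) (by linarith) (by linarith),
    hg (r + 2 * δ) (by linarith) (by linarith)]
  have hmem : ∀ x ∈ Icc r (r + 2 * δ), h / 2 ≤ x ∧ x ≤ 2 * h := fun x hx =>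
    ⟨hr.trans hx.1, hx.2.trans hrδ⟩
  refine le_second_difference (g := fun t => t ^ (-1 : ℤ) * (-Real.log t) ^ (-α))
    (g' := fun t => ((-1 : ℤ) : ℝ) * (t ^ (-1 - 1 : ℤ) * (-Real.log t) ^ (-α))
      - (-α) * (t ^ (-1 - 1 : ℤ) * (-Real.log t) ^ (-α - 1)))
    (g'' := fun t => ((-1 : ℤ) : ℝ) * (((-1 - 1 : ℤ) : ℝ) * (t ^ (-1 - 1 - 1 : ℤ) *
        (-Real.log t) ^ (-α)) - (-α) * (t ^ (-1 - 1 - 1 : ℤ) * (-Real.log t) ^ (-α - 1)))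
      - (-α) * (((-1 - 1 : ℤ) : ℝ) * (t ^ (-1 - 1 - 1 : ℤ) * (-Real.log t) ^ (-α - 1))
        - (-α - 1) * (t ^ (-1 - 1 - 1 : ℤ) * (-Real.log t) ^ (-α - 1 - 1)))) hδ ?_ ?_ ?_
  · intro x hx
    obtain ⟨h3, h4⟩ := hmem x hx
    exact hasDerivAt_pow_mul_log_rpow (-1) (-α) (by linarith) (by linarith)
  · intro x hx
    obtain ⟨h3, h4⟩ := hmem x hx
    exact ((hasDerivAt_pow_mul_log_rpow (-1 - 1) (-α) (by linarith) (by linarith)).const_mul _).sub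
      ((hasDerivAt_pow_mul_log_rpow (-1 - 1) (-α - 1) (by linarith) (by linarith)).const_mul _)
  · intro x hx
    obtain ⟨h3, h4⟩ := hmem x hx
    have hx0 : 0 < x := by linarith
    set L := -Real.log x with hL
    have hL3 : 3 * α ≤ L := hh.trans (by
      rw [hL]; exact neg_le_neg (Real.log_le_log hx0 h4))
    have hL0 : 0 < L := by linarith
    have hLc : L ≤ c := le_trans (by
      rw [hL]; exact neg_le_neg (Real.log_le_log (by linarith) h3)) hc
    have e1 : x ^ (-1 - 1 - 1 : ℤ) = (x ^ 3)⁻¹ := by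
      rw [show (-1 - 1 - 1 : ℤ) = -(3 : ℕ) by norm_num, zpow_neg, zpow_natCast]
    have e2 : L ^ (-α - 1) = L ^ (-α) / L := Real.rpow_sub_one hL0.ne' _
    have e3 : L ^ (-α - 1 - 1) = L ^ (-α) / L / L := by
      rw [Real.rpow_sub_one hL0.ne', e2]
    rw [e1, e2, e3]
    have hp : 0 < L ^ (-α) := Real.rpow_pos_of_pos hL0 _
    have hx3 : (h ^ 3)⁻¹ / 8 ≤ (x ^ 3)⁻¹ := by
      rw [show (h ^ 3)⁻¹ / 8 = ((2 * h) ^ 3)⁻¹ by rw [mul_pow]; field_simp; norm_num]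
      gcongr
    have hcl : c ^ (-α) ≤ L ^ (-α) := Real.rpow_le_rpow_of_nonpos hL0 hLc (by linarith)
    have h5 : 3 * α / L ≤ 1 := by rw [div_le_one hL0]; exact hL3
    have h6 : 0 ≤ α * (α + 1) / L / L := by positivity
    have hc0 : 0 ≤ c ^ (-α) := Real.rpow_nonneg (hL0.le.trans hLc) _
    calc (h ^ 3)⁻¹ * (c ^ (-α) / 8) = ((h ^ 3)⁻¹ / 8) * c ^ (-α) := by ring
      _ ≤ (x ^ 3)⁻¹ * L ^ (-α) := by gcongr
      _ ≤ (x ^ 3)⁻¹ * L ^ (-α) * (2 - 3 * α / L + α * (α + 1) / L / L) := by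
          refine le_mul_of_one_le_right (by positivity) ?_
          linarith
      _ = _ := by push_cast; ring

end LogKernel

/-! ### Weights, and the lower bound of the scalar product by Haar coefficients -/

/-- The weights of the Haar coefficients. -/
def haarWeight (α C : ℝ) (q : ℕ) : HaarIndex → ℝ
  | none => C
  | some ⟨k, _⟩ => C * (k + q + 1 : ℝ) ^ (1 - α)

theorem haarWeight_pos (α : ℝ) {C : ℝ} (hC : 0 < C) (q : ℕ) (i : HaarIndex) :
    0 < haarWeight α C q i := by
  rcases i with _ | ⟨k, m⟩
  · exact hC
  · exact mul_pos hC (Real.rpow_pos_of_pos (by positivity) _)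

/-- Summation over the levels: weights `(j + 1)^{-α}` on the level sums give weights
`(k + 1)^{1 - α}` on the coefficients of level `k`. -/
theorem sum_haarWeight_le {α c : ℝ} (hα : 0 < α) (hc : 0 < c) (q : ℕ) :
    ∃ C > 0, ∀ (x : HaarIndex → ℝ) (A : ℝ), (∀ i, 0 ≤ x i) →
      (∀ N, ∑ j ∈ Finset.range N, (if q ≤ j then (j + 1 : ℝ) ^ (-α) else 0) *
        ∑ i ∈ haarLevels j, x i ≤ c * A) →
      ∀ F : Finset HaarIndex, ∑ i ∈ F, haarWeight α C q i * x i ≤ A := by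
  classical
  set lam : ℕ → ℝ := fun j => if q ≤ j then (j + 1 : ℝ) ^ (-α) else 0 with hlam
  have hlam0 : ∀ j, 0 ≤ lam j := fun j => by
    simp only [hlam]; split_ifs <;> positivity
  have hmpos : 0 < min (2 ^ (-α) : ℝ) (lam q) := by
    refine lt_min (by positivity) ?_
    simp only [hlam, le_refl, if_true]; positivity
  refine ⟨c⁻¹ * min (2 ^ (-α) : ℝ) (lam q), by positivity, fun x A hx hA F => ?_⟩
  obtain ⟨n, hn⟩ := exists_subset_haarLevels F
  have hw0 : ∀ i, 0 ≤ haarWeight α (c⁻¹ * min (2 ^ (-α) : ℝ) (lam q)) q i * x i := fun i =>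
    mul_nonneg (haarWeight_pos α (by positivity) q i).le (hx i)
  refine (Finset.sum_le_sum_of_subset_of_nonneg hn fun i _ _ => hw0 i).trans ?_
  set N := 2 * (n + q + 1)
  have key : ∀ i ∈ haarLevels n, c * haarWeight α (c⁻¹ * min (2 ^ (-α) : ℝ) (lam q)) q i
      ≤ ∑ j ∈ Finset.range N, if i ∈ haarLevels j then lam j else 0 := by
    intro i hi
    have hnn : ∀ j, 0 ≤ if i ∈ haarLevels j then lam j else 0 := fun j => by
      split_ifs
      exacts [hlam0 j, le_rfl]
    rcases i with _ | ⟨k, m⟩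
    · have h1 := Finset.single_le_sum (f := fun j => if (none : HaarIndex) ∈ haarLevels j
        then lam j else 0) (s := Finset.range N) (fun j _ => hnn j) (a := q)
        (Finset.mem_range.2 (by omega))
      refine le_trans ?_ h1
      simp only [haarWeight, haarLevels, Finset.none_mem_insertNone, if_true]
      rw [mul_inv_cancel_left₀ hc.ne']
      exact min_le_right _ _
    · have hkn : k < n := by simpa [haarLevels] using hi
      -- A coefficient of level `k` occurs in every partial sum with `j > k`. The `k + q + 1` values
      -- of `j` in this block each contribute at least `(2 (k + q + 1))^{-α}`, which together give
      -- the exponent `1 - α`.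
      have hsub : Finset.Ico (k + q + 1) (2 * (k + q + 1)) ⊆ Finset.range N := by
        intro j hj
        have := (Finset.mem_Ico.1 hj).2
        exact Finset.mem_range.2 (by omega)
      refine le_trans ?_ (Finset.sum_le_sum_of_subset_of_nonneg hsub fun j _ _ => hnn j)
      have h2 : ∀ j ∈ Finset.Ico (k + q + 1) (2 * (k + q + 1)),
          (2 * (k + q + 1) : ℝ) ^ (-α)
            ≤ if (some ⟨k, m⟩ : HaarIndex) ∈ haarLevels j then lam j else 0 := by
        intro j hj
        obtain ⟨h3, h4⟩ := Finset.mem_Ico.1 hj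
        have h5 : (some ⟨k, m⟩ : HaarIndex) ∈ haarLevels j := by
          simp [haarLevels]; omega
        rw [if_pos h5]
        simp only [hlam]
        rw [if_pos (by omega : q ≤ j)]
        refine Real.rpow_le_rpow_of_nonpos (by positivity) ?_ (by linarith)
        have : ((j + 1 : ℕ) : ℝ) ≤ ((2 * (k + q + 1) : ℕ) : ℝ) := by exact_mod_cast h4
        push_cast at this; linarith
      refine le_trans ?_ (Finset.sum_le_sum h2)
      rw [Finset.sum_const, Nat.card_Ico, nsmul_eq_mul, show 2 * (k + q + 1) - (k + q + 1)
        = k + q + 1 by omega, haarWeight, mul_assoc, mul_inv_cancel_left₀ hc.ne',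
        Real.mul_rpow (by norm_num) (by positivity), sub_eq_add_neg,
        Real.rpow_add (by positivity), Real.rpow_one]
      push_cast
      calc min (2 ^ (-α) : ℝ) (lam q) * ((k + q + 1) * (k + q + 1 : ℝ) ^ (-α))
          ≤ 2 ^ (-α) * ((k + q + 1) * (k + q + 1 : ℝ) ^ (-α)) := by
            gcongr
            exact min_le_left _ _
        _ = _ := by ring
  have h1 : c * ∑ i ∈ haarLevels n, haarWeight α (c⁻¹ * min (2 ^ (-α) : ℝ) (lam q)) q i * x i
      ≤ c * A := by
    refine le_trans ?_ (hA N)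
    calc c * ∑ i ∈ haarLevels n, haarWeight α (c⁻¹ * min (2 ^ (-α) : ℝ) (lam q)) q i * x i
        = ∑ i ∈ haarLevels n, (c * haarWeight α (c⁻¹ * min (2 ^ (-α) : ℝ) (lam q)) q i) * x i := by
          rw [Finset.mul_sum]
          exact Finset.sum_congr rfl fun i _ => by ring
      _ ≤ ∑ i ∈ haarLevels n, (∑ j ∈ Finset.range N, if i ∈ haarLevels j then lam j else 0) * x i :=
          Finset.sum_le_sum fun i hi => mul_le_mul_of_nonneg_right (key i hi) (hx i)
      _ = ∑ j ∈ Finset.range N, lam j * ∑ i ∈ haarLevels n, if i ∈ haarLevels j then x i else 0 := by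
          simp only [Finset.sum_mul, Finset.mul_sum]
          rw [Finset.sum_comm]
          refine Finset.sum_congr rfl fun j _ => Finset.sum_congr rfl fun i _ => ?_
          split_ifs <;> simp
      _ ≤ ∑ j ∈ Finset.range N, lam j * ∑ i ∈ haarLevels j, x i := by
          refine Finset.sum_le_sum fun j _ => mul_le_mul_of_nonneg_left ?_ (hlam0 j)
          rw [← Finset.sum_filter]
          refine Finset.sum_le_sum_of_subset_of_nonneg (fun i hi => ?_) fun i _ _ => hx i
          exact (Finset.mem_filter.1 hi).2
  exact le_of_mul_le_mul_left h1 hc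

namespace TsirelsonKernel

variable {α : ℝ}

/-- For `α ≤ 0` one would have `B t ≥ 1/t` near `0`, which is not integrable. Positivity of `α` is
all that the estimates use. -/
theorem alpha_pos (K : TsirelsonKernel α) : 0 < α := by
  by_contra hα
  push Not at hα
  obtain ⟨ε, hε, h⟩ := K.near_zero
  set c := min (ε / 2) (Real.exp (-1)) with hc
  have hc0 : 0 < c := lt_min (by linarith) (Real.exp_pos _)
  have h1 : IntervalIntegrable (fun x : ℝ => x⁻¹) volume 0 c := by
    refine (K.integrable.intervalIntegrable (a := 0) (b := c)).mono_fun
      (by fun_prop) ?_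
    rw [uIoc_of_le hc0.le]
    filter_upwards [ae_restrict_mem measurableSet_Ioc] with t ht
    have ht1 : t < ε := ht.2.trans_lt ((min_le_left _ _).trans_lt (by linarith))
    have hL : 1 ≤ Real.log (1 / t) := by
      rw [one_div, Real.log_inv]
      have := Real.log_le_log ht.1 (ht.2.trans (min_le_right _ _))
      rw [Real.log_exp] at this
      linarith
    have hpos : 0 < Real.log (1 / t) ^ α := Real.rpow_pos_of_pos (by linarith) _
    have hle : Real.log (1 / t) ^ α ≤ 1 := Real.rpow_le_one_of_one_le_of_nonpos hL hα
    rw [h t ⟨ht.1, ht1⟩, norm_inv, Real.norm_of_nonneg ht.1.le, Real.norm_of_nonneg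
      (by have := ht.1; positivity), one_div]
    have := ht.1
    gcongr
    nlinarith
  rw [intervalIntegrable_inv_iff] at h1
  rcases h1 with h1 | h1
  · exact hc0.ne h1
  · exact h1 left_mem_uIcc

/-- The weighted square sum of the Haar coefficients of `f` is dominated by the scalar product of
Tsirelson's example. -/
theorem exists_haarWeight (K : TsirelsonKernel α) {l : ℝ} (hl : 0 < l) : ∃ C > 0, ∃ q : ℕ, ∀ f : ℝ → ℝ, MemLp f 2 →
    (∀ x, x ∉ Ioo 0 l → f x = 0) → ∀ F : Finset HaarIndex,
      ∑ i ∈ F, haarWeight α C q i * haar l (fun x => ∫ t in (0 : ℝ)..x, f t) i ^ 2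
        ≤ kernelForm K.B f f := by
  have hα := K.alpha_pos
  obtain ⟨ε, hε, hB⟩ := K.near_zero
  have hlim : Tendsto (fun n : ℕ => 2 * (l / 2 ^ n)) atTop (𝓝 0) := by
    have h1 : Tendsto (fun n : ℕ => 2 * l * (1 / 2 : ℝ) ^ n) atTop (𝓝 (2 * l * 0)) :=
      (tendsto_pow_atTop_nhds_zero_of_lt_one (by norm_num) (by norm_num)).const_mul _
    rw [mul_zero] at h1
    exact h1.congr fun n => by rw [one_div, inv_pow]; ring
  have hratio : ∀ᶠ n : ℕ in atTop, (n + 1 : ℝ) ^ (-α) ≤ 7 / 6 * (n + 2 : ℝ) ^ (-α) := by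
    have h1 : Tendsto (fun n : ℕ => (1 + 1 / ((n : ℝ) + 1)) ^ α) atTop (𝓝 ((1 + 0) ^ α)) :=
      ((tendsto_const_nhds.add tendsto_one_div_add_atTop_nhds_zero_nat)).rpow_const (Or.inr hα.le)
    rw [add_zero, Real.one_rpow] at h1
    filter_upwards [h1.eventually_le_const (by norm_num : (1 : ℝ) < 7 / 6)] with n hn
    have e : (n + 2 : ℝ) = (1 + 1 / ((n : ℝ) + 1)) * (n + 1) := by field_simp; ring
    have hp : 0 < (1 + 1 / ((n : ℝ) + 1)) := by positivity
    rw [e, Real.mul_rpow hp.le (by positivity), Real.rpow_neg hp.le, ← mul_assoc]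
    refine le_mul_of_one_le_left (by positivity) ?_
    rw [← div_eq_mul_inv, le_div_iff₀ (Real.rpow_pos_of_pos hp _)]
    linarith
  have hsmall : ∀ᶠ n : ℕ in atTop, 2 * (l / 2 ^ n) < min (min ε 1) (Real.exp (-(3 * α))) :=
    hlim.eventually_lt_const (lt_min (lt_min hε one_pos) (Real.exp_pos _))
  -- From level `q` on, the weights `(j + 1)^{-α}` vary slowly enough, and `(0, 2l/2ⁿ)` lies where
  -- `B` is explicit and `-log ≥ 3α`. Below `q` the weight is set to `0`, and there convexity of `B`
  -- alone suffices.
  obtain ⟨q, hq⟩ := eventually_atTop.1 (hratio.and hsmall)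
  -- Chosen so that `-log (l / 2^{n+1}) ≤ C₀ (n + 1)` for all `n`, which turns the logarithmic
  -- factor into `(n + 1)^{-α}`.
  set C₀ := 1 + |Real.log l| with hC₀
  have hC₀pos : 0 < C₀ := by positivity
  set c := C₀ ^ (-α) / 8 with hc
  have hcpos : 0 < c := by positivity
  set lam : ℕ → ℝ := fun j => if q ≤ j then (j + 1 : ℝ) ^ (-α) else 0 with hlam
  have hlam0 : ∀ j, 0 ≤ lam j := fun j => by
    simp only [hlam]; split_ifs <;> positivity
  have hlam1 : ∀ j, lam j ≤ 7 / 6 * lam (j + 1) := fun j => by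
    by_cases hj : q ≤ j
    · simp only [hlam]
      rw [if_pos hj, if_pos (by omega)]
      have := (hq j hj).1
      push_cast
      rwa [add_assoc, one_add_one_eq_two]
    · have h1 : lam j = 0 := if_neg hj
      rw [h1]
      have := hlam0 (j + 1)
      positivity
  obtain ⟨C, hC, hsum⟩ := sum_haarWeight_le hα (show 0 < 192 / c by positivity) q
  refine ⟨C, hC, q, fun f hf h0 => ?_⟩
  have hfi := integrable_of_memLp_two hf h0
  have hform : 0 ≤ kernelForm K.B f f := K.posDef f hf
  set Φ : ℝ → ℝ := fun x => ∫ t in (0 : ℝ)..x, f t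
  refine hsum (fun i => haar l Φ i ^ 2) _ (fun i => sq_nonneg _) fun N => ?_
  have hE : ∀ N, ∑ n ∈ Finset.range N, lam n * ((l / 2 ^ n) ^ 3)⁻¹ *
      ∫ r in (l / 2 ^ n / 2)..(l / 2 ^ n), diffEnergy Φ r ≤ kernelForm K.B f f / c := by
    intro N
    rw [le_div_iff₀ hcpos, Finset.sum_mul]
    refine le_trans (le_of_eq ?_) (K.sum_energy_le_kernelForm hf h0 hl
      (κ := fun n => ((l / 2 ^ n) ^ 3)⁻¹ * (c * lam n)) (fun n => ?_) N)
    · exact Finset.sum_congr rfl fun n _ => by ring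
    have hpos : 0 < l / 2 ^ n := by positivity
    by_cases hn : q ≤ n
    · obtain ⟨-, h2⟩ := hq n hn
      have h3 : 2 * (l / 2 ^ n) < ε := h2.trans_le ((min_le_left _ _).trans (min_le_left _ _))
      have h4 : 2 * (l / 2 ^ n) < 1 := h2.trans_le ((min_le_left _ _).trans (min_le_right _ _))
      have h5 : 3 * α ≤ -Real.log (2 * (l / 2 ^ n)) := by
        have := Real.log_le_log (by positivity) (h2.le.trans (min_le_right _ _))
        rw [Real.log_exp] at this
        linarith
      have h6 : -Real.log (l / 2 ^ n / 2) ≤ C₀ * (n + 1) := by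
        rw [div_div, ← pow_succ, Real.log_div hl.ne' (by positivity), Real.log_pow]
        have := neg_abs_le (Real.log l)
        have h7 : Real.log 2 ≤ 1 := by linarith [Real.log_two_lt_d9]
        push_cast
        have hn0 : (0 : ℝ) ≤ n := by positivity
        nlinarith [abs_nonneg (Real.log l), mul_nonneg hn0 (abs_nonneg (Real.log l))]
      have h7 : ∀ᶠ δ in 𝓝[>] (0 : ℝ), δ < l / 2 ^ n / 2 :=
        (eventually_lt_nhds (by positivity)).filter_mono nhdsWithin_le_nhds
      filter_upwards [h7, eventually_mem_nhdsWithin] with δ hδ hδ0 r hr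
      have hδ0' : 0 < δ := hδ0
      have h8 := le_second_difference_logKernel hα hδ0' hr.1 (by linarith [hr.2]) hpos h4 h5 h6
      have hBr : ∀ t, 0 < t → t ≤ 2 * (l / 2 ^ n) → K.B t = 1 / (t * Real.log (1 / t) ^ α) :=
        fun t ht ht2 => hB t ⟨ht, ht2.trans_lt h3⟩
      have hr0 : 0 < r := by linarith [hr.1]
      rw [secondDiff, hBr r hr0 (by linarith [hr.2]), hBr (r + δ) (by linarith) (by linarith [hr.2]),
        hBr (r + 2 * δ) (by linarith) (by linarith [hr.2])]
      refine le_trans (le_of_eq ?_) h8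
      simp only [hlam, if_pos hn, hc]
      rw [Real.mul_rpow hC₀pos.le (by positivity)]
      ring
    · filter_upwards [eventually_mem_nhdsWithin] with δ hδ0 r hr
      have hr0 : 0 < r := by linarith [hr.1]
      simp only [hlam, if_neg hn, mul_zero]
      exact K.secondDiff_nonneg hr0 hδ0
  have h1 := sum_weighted_sq_inc_le (continuous_primitive' hfi)
    (fun r hr => integrable_sq_increment hfi h0 hr.le)
    (fun a b ha hb => intervalIntegrable_diffEnergy hfi h0 ha hb) hl hlam0 hlam1 hE
  have h2 := (ENNReal.sum_le_tsum (Finset.range N)).trans h1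
  rw [← ENNReal.ofReal_sum_of_nonneg, ENNReal.ofReal_le_ofReal_iff (by positivity)] at h2
  · simp only [haar_sq_expansion hl]
    refine h2.trans (le_of_eq ?_)
    ring
  · intro j _
    have := hlam0 j
    have : 0 ≤ ∑ m ∈ Finset.range (2 ^ j), dyadicInc l Φ j m ^ 2 :=
      Finset.sum_nonneg fun m _ => sq_nonneg _
    positivity

end TsirelsonKernel

/-! ### Upper bound: the Hilbert-Schmidt sum for adjacent intervals -/

theorem ENNReal.tsum_option {ι : Type*} (f : Option ι → ENNReal) :
    ∑' i, f i = f none + ∑' i, f (some i) := by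
  rw [← (Equiv.optionEquivSumPUnit.{0} ι).symm.tsum_eq, ENNReal.summable.tsum_sum ENNReal.summable,
    add_comm]
  simp

/-- For the fourth root `r` of `p`, `-log r ≤ (1 - r) / r ≤ (1 - p) / r`, and `r² = √p`. The right
side is chosen so that, at `p = v / (v + h)`, it is a multiple of an explicit derivative in `v`. -/
theorem sq_log_le {p : ℝ} (hp : 0 < p) (hp1 : p ≤ 1) :
    Real.log p ^ 2 ≤ 16 * (1 - p) ^ 2 * (√p)⁻¹ := by
  set r := √(√p) with hr
  have hr0 : 0 < r := Real.sqrt_pos.2 (Real.sqrt_pos.2 hp)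
  have hr2 : r ^ 2 = √p := Real.sq_sqrt (Real.sqrt_nonneg _)
  have hr4 : r ^ 4 = p := by rw [show r ^ 4 = (r ^ 2) ^ 2 by ring, hr2, Real.sq_sqrt hp.le]
  have hr1 : r ≤ 1 := by
    by_contra h
    have : 1 < r ^ 4 := one_lt_pow₀ (not_le.1 h) (by norm_num)
    linarith
  have hlog : Real.log p = 4 * Real.log r := by rw [← hr4, Real.log_pow]; norm_num
  have h1 : -Real.log r ≤ (1 - r ^ 4) * r⁻¹ := by
    have h2 := Real.one_sub_inv_le_log_of_pos hr0
    have h3 : r ^ 4 ≤ r := by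
      calc r ^ 4 ≤ r ^ 1 := pow_le_pow_of_le_one hr0.le hr1 (by norm_num)
        _ = r := pow_one r
    have h4 : r⁻¹ * r = 1 := inv_mul_cancel₀ hr0.ne'
    have h5 : 0 < r⁻¹ := inv_pos.2 hr0
    nlinarith [mul_le_mul_of_nonneg_left h3 h5.le]
  have h0 : 0 ≤ -Real.log r := by linarith [Real.log_nonpos hr0.le hr1]
  calc Real.log p ^ 2 = 16 * (-Real.log r) ^ 2 := by rw [hlog]; ring
    _ ≤ 16 * ((1 - r ^ 4) * r⁻¹) ^ 2 := by gcongr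
    _ = 16 * (1 - p) ^ 2 * (√p)⁻¹ := by rw [hr4, ← hr2, mul_pow, inv_pow]; ring

/-- The derivative of `√(v / (v + h))`. -/
def sqrtRatioDeriv (h v : ℝ) : ℝ := h / (v + h) ^ 2 / (2 * √(v / (v + h)))

theorem hasDerivAt_sqrt_ratio {h v : ℝ} (hh : 0 < h) (hv : 0 < v) :
    HasDerivAt (fun v => √(v / (v + h))) (sqrtRatioDeriv h v) v := by
  have h1 : HasDerivAt (fun v => v / (v + h)) (h / (v + h) ^ 2) v := by
    refine ((hasDerivAt_id v).div ((hasDerivAt_id v).add_const h) (by simp; positivity)).congr_deriv ?_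
    simp
  exact h1.sqrt (by positivity)

theorem continuousOn_sqrt_ratio {h l : ℝ} (hh : 0 < h) :
    ContinuousOn (fun v => √(v / (v + h))) (Icc 0 l) :=
  (continuousOn_id.div (by fun_prop) fun v hv => by
    have := hv.1; positivity).sqrt

theorem sqrtRatioDeriv_nonneg {h v : ℝ} (hh : 0 < h) : 0 ≤ sqrtRatioDeriv h v := by
  unfold sqrtRatioDeriv; positivity

theorem intervalIntegrable_sqrtRatioDeriv {h l : ℝ} (hh : 0 < h) (hl : 0 < l) :
    IntervalIntegrable (sqrtRatioDeriv h) volume 0 l := by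
  refine intervalIntegral.intervalIntegrable_deriv_of_nonneg (g := fun v => √(v / (v + h)))
    (by rw [uIcc_of_le hl.le]; exact continuousOn_sqrt_ratio hh) (fun x hx => ?_)
    fun x _ => sqrtRatioDeriv_nonneg hh
  rw [min_eq_left hl.le] at hx
  exact hasDerivAt_sqrt_ratio hh hx.1

/-- The bound does not depend on `h`. Dominating both `log² ((v + h) / v) / h` and `h / (v + h)²` by
this derivative is what makes the estimates uniform in the level. -/
theorem integral_sqrtRatioDeriv_le {h l : ℝ} (hh : 0 < h) (hl : 0 < l) :
    ∫ v in (0 : ℝ)..l, sqrtRatioDeriv h v ≤ 1 := by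
  rw [intervalIntegral.integral_eq_sub_of_hasDerivAt_of_le hl.le (continuousOn_sqrt_ratio hh)
    (fun x hx => hasDerivAt_sqrt_ratio hh hx.1) (intervalIntegrable_sqrtRatioDeriv hh hl)]
  simp only [zero_div, Real.sqrt_zero, sub_zero]
  rw [Real.sqrt_le_one]
  rw [div_le_one (by positivity)]
  linarith

theorem sq_log_ratio_le {h v : ℝ} (hh : 0 < h) (hv : 0 < v) :
    Real.log ((v + h) / v) ^ 2 ≤ 32 * h * sqrtRatioDeriv h v := by
  have h1 := sq_log_le (p := v / (v + h)) (by positivity)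
    (by rw [div_le_one (by positivity)]; linarith)
  rw [← inv_div, Real.log_inv, neg_sq]
  refine h1.trans (le_of_eq ?_)
  have : 1 - v / (v + h) = h / (v + h) := by field_simp; ring
  rw [this, sqrtRatioDeriv]
  have : 0 < √(v / (v + h)) := Real.sqrt_pos.2 (by positivity)
  field_simp
  ring

theorem le_sqrtRatioDeriv {h v : ℝ} (hh : 0 < h) (hv : 0 < v) :
    h / 2 * ((h + v)⁻¹) ^ 2 ≤ sqrtRatioDeriv h v := by
  have h1 : √(v / (v + h)) ≤ 1 := by
    rw [Real.sqrt_le_one, div_le_one (by positivity)]; linarith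
  have h2 : 0 < √(v / (v + h)) := Real.sqrt_pos.2 (by positivity)
  rw [sqrtRatioDeriv, le_div_iff₀ (by positivity), add_comm h v]
  have : 0 ≤ h / (v + h) ^ 2 := by positivity
  calc h / 2 * ((v + h)⁻¹) ^ 2 * (2 * √(v / (v + h))) = h / (v + h) ^ 2 * √(v / (v + h)) := by
        field_simp
    _ ≤ _ := mul_le_of_le_one_right this h1

namespace TsirelsonKernel

variable {α : ℝ} (K : TsirelsonKernel α)

theorem B_nonneg {t : ℝ} (ht : t ≠ 0) : 0 ≤ K.B t := by
  rw [← K.B_abs]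
  exact K.nonneg _ (abs_pos.2 ht)

theorem prim_monotone : Monotone K.prim := fun x y hxy => by
  have h : 0 ≤ K.prim y - K.prim x := by
    rw [prim_sub]
    refine intervalIntegral.integral_nonneg_of_ae_restrict hxy ?_
    have h0 : ∀ᵐ t : ℝ, t ≠ 0 := by simp [ae_iff]
    filter_upwards [ae_restrict_of_ae h0] with t ht
    exact K.B_nonneg ht
  linarith

theorem mul_B_le {r : ℝ} (hr : 0 < r) : r * K.B r ≤ K.prim r := by
  have h1 : ∀ᶠ δ in 𝓝[>] (0 : ℝ), (r - δ) * K.B r ≤ K.prim r - K.prim δ := by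
    filter_upwards [Ioo_mem_nhdsGT hr] with δ hδ
    exact K.le_prim_sub hδ.1 hδ.2.le
  have h2 : Tendsto (fun δ => (r - δ) * K.B r) (𝓝[>] 0) (𝓝 ((r - 0) * K.B r)) :=
    (Continuous.tendsto (by fun_prop) _).mono_left nhdsWithin_le_nhds
  have h3 : Tendsto (fun δ => K.prim r - K.prim δ) (𝓝[>] 0) (𝓝 (K.prim r - K.prim 0)) :=
    (Continuous.tendsto (by have := K.continuous_prim; fun_prop) _).mono_left nhdsWithin_le_nhds
  have := le_of_tendsto_of_tendsto h2 h3 h1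
  have h0 : K.prim 0 = 0 := intervalIntegral.integral_same
  rwa [sub_zero, h0, sub_zero] at this

theorem exists_prim_le : ∃ M > 0, ∀ r, 0 ≤ r → K.prim r ≤ M := by
  refine ⟨(∫ t, ‖K.B t‖) + 1, by positivity, fun r hr => ?_⟩
  have h1 : K.prim r ≤ ‖K.prim r‖ := Real.le_norm_self _
  have h2 : ‖K.prim r‖ ≤ ∫ t in Set.Ioc 0 r, ‖K.B t‖ := by
    rw [prim, intervalIntegral.integral_of_le hr]
    exact norm_integral_le_integral_norm _
  have h3 : ∫ t in Set.Ioc 0 r, ‖K.B t‖ ≤ ∫ t, ‖K.B t‖ :=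
    setIntegral_le_integral K.integrable.norm (Eventually.of_forall fun t => norm_nonneg _)
  linarith

/-- The kernel `B` is dominated, on the scale `l / 2 ^ k`, by `(k + 1)^{-α}` times a function
with an explicit primitive. -/
theorem exists_B_le {l : ℝ} (hl : 0 < l) (q : ℕ) : ∃ C > 0, ∀ (k : ℕ) (r : ℝ), 0 < r →
    K.B r ≤ C * (k + q + 1 : ℝ) ^ (-α) * (r⁻¹ + (√(l / 2 ^ k))⁻¹) := by
  have hα := K.alpha_pos
  obtain ⟨ε, hε, hB⟩ := K.near_zero
  obtain ⟨M, hM, hMle⟩ := K.exists_prim_le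
  have hlim : Tendsto (fun n : ℕ => l / 2 ^ n) atTop (𝓝 0) := by
    have h1 : Tendsto (fun n : ℕ => l * (1 / 2 : ℝ) ^ n) atTop (𝓝 (l * 0)) :=
      (tendsto_pow_atTop_nhds_zero_of_lt_one (by norm_num) (by norm_num)).const_mul _
    rw [mul_zero] at h1
    exact h1.congr fun n => by rw [one_div, inv_pow]; ring
  have hsmall : ∀ᶠ n : ℕ in atTop, l / 2 ^ n < min ε 1 ^ 2 :=
    hlim.eventually_lt_const (by have := lt_min hε one_pos; positivity)
  have hlarge : ∀ᶠ n : ℕ in atTop, (n + q + 1 : ℝ) / 2 ≤ -Real.log (l / 2 ^ n) := by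
    obtain ⟨N, hN⟩ := exists_nat_ge (6 * (Real.log l + (q + 1) / 2))
    filter_upwards [eventually_ge_atTop N] with n hn
    have h1 : (N : ℝ) ≤ n := by exact_mod_cast hn
    rw [Real.log_div hl.ne' (by positivity), Real.log_pow]
    have := Real.log_two_gt_d9
    have hn0 : (0 : ℝ) ≤ n := by positivity
    nlinarith
  obtain ⟨n₀, hn₀⟩ := eventually_atTop.1 (hsmall.and hlarge)
  set C₁ := M * (n₀ + q + 1 : ℝ) ^ α with hC₁
  have hC₁0 : 0 < C₁ := by positivity
  refine ⟨max C₁ (4 ^ α), lt_max_of_lt_left hC₁0, fun k r hr => ?_⟩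
  have hsq : 0 ≤ (√(l / 2 ^ k))⁻¹ := by positivity
  have hri : 0 < r⁻¹ := inv_pos.2 hr
  have hkp : 0 < (k + q + 1 : ℝ) ^ (-α) := by positivity
  -- For the finitely many small `k`, monotonicity gives `r B(r) ≤ ∫₀ʳ B ≤ M`, and the constant
  -- absorbs the power of `k`.
  by_cases hk : k < n₀
  · have h1 : K.B r ≤ M * r⁻¹ := by
      rw [← div_eq_mul_inv, le_div_iff₀ hr, mul_comm]
      exact (K.mul_B_le hr).trans (hMle r hr.le)
    have h2 : (1 : ℝ) ≤ (n₀ + q + 1 : ℝ) ^ α * (k + q + 1 : ℝ) ^ (-α) := by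
      rw [Real.rpow_neg (by positivity), ← div_eq_mul_inv, one_le_div (by positivity)]
      have : (k : ℝ) ≤ n₀ := by exact_mod_cast hk.le
      gcongr
    calc K.B r ≤ M * 1 * r⁻¹ := by rwa [mul_one]
      _ ≤ M * ((n₀ + q + 1 : ℝ) ^ α * (k + q + 1 : ℝ) ^ (-α)) * (r⁻¹ + (√(l / 2 ^ k))⁻¹) := by
          gcongr
          linarith
      _ = C₁ * (k + q + 1 : ℝ) ^ (-α) * (r⁻¹ + (√(l / 2 ^ k))⁻¹) := by rw [hC₁]; ring
      _ ≤ _ := by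
          gcongr
          exact le_max_left _ _
  push Not at hk
  obtain ⟨hs1, hs2⟩ := hn₀ k hk
  set h := l / 2 ^ k with hh
  have hpos : 0 < h := by positivity
  have hm1 : min ε 1 ≤ 1 := min_le_right _ _
  have hm0 : 0 < min ε 1 := lt_min hε one_pos
  have hsε : √h < min ε 1 := by
    rw [Real.sqrt_lt' hm0]; exact hs1
  have hs0 : 0 < √h := Real.sqrt_pos.2 hpos
  -- Up to `√h` one has `log (1/r) ≥ ½ log (1/h)`, which is still of order `k`. Beyond `√h`, `B` is
  -- at most `B (√h)`, whence the term `1/√h`.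
  have key : ∀ r, 0 < r → r ≤ √h → K.B r ≤ 4 ^ α * (k + q + 1 : ℝ) ^ (-α) * r⁻¹ := by
    intro r hr hrh
    have hrε : r < ε := (hrh.trans_lt hsε).trans_le (min_le_left _ _)
    have hL : (k + q + 1 : ℝ) / 4 ≤ Real.log (1 / r) := by
      rw [one_div, Real.log_inv]
      have h1 := Real.log_le_log hr hrh
      rw [Real.log_sqrt hpos.le] at h1
      linarith
    rw [hB r ⟨hr, hrε⟩, one_div, mul_inv, mul_comm]
    have hx : (0 : ℝ) < k + q + 1 := by positivity
    have hL0 : 0 ≤ Real.log (1 / r) := le_trans (by positivity) hL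
    have e : (4 : ℝ) ^ α * (k + q + 1 : ℝ) ^ (-α) = ((k + q + 1 : ℝ) / 4) ^ (-α) := by
      rw [Real.div_rpow hx.le (by norm_num), Real.rpow_neg (by norm_num : (0 : ℝ) ≤ 4)]
      field_simp
    rw [e, ← Real.rpow_neg hL0]
    exact mul_le_mul_of_nonneg_right
      (Real.rpow_le_rpow_of_nonpos (by positivity) hL (by linarith)) (inv_pos.2 hr).le
  have hle : 4 ^ α * (k + q + 1 : ℝ) ^ (-α) ≤ max C₁ (4 ^ α) * (k + q + 1 : ℝ) ^ (-α) := by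
    gcongr
    exact le_max_right _ _
  rcases le_total r (√h) with hrh | hrh
  · refine (key r hr hrh).trans (mul_le_mul hle ?_ hri.le (by positivity))
    linarith
  · refine ((K.antitone hs0 hr hrh).trans (key _ hs0 le_rfl)).trans
      (mul_le_mul hle ?_ (by positivity) (by positivity))
    linarith

/-- The Haar coefficients of `x ↦ ∫₀ˣ B(u + v) du`. -/
def haarPrim (l : ℝ) (i : HaarIndex) (v : ℝ) : ℝ := haar l (fun x => K.prim (x + v)) i

theorem continuous_haarPrim (l : ℝ) (i : HaarIndex) : Continuous (K.haarPrim l i) := by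
  have := K.continuous_prim
  unfold haarPrim
  rcases i with _ | ⟨k, m⟩ <;> simp only [haar, dyadicInc] <;> fun_prop

/-- As a function of `y`, the first Haar transform is, up to a constant, a primitive of `haarPrim l
i`. Bessel's inequality in `y` therefore bounds the `i`-th row of `haarMatrix` by `∫ haarPrim²`. -/
theorem haar_primTwo_sub (l : ℝ) (i : HaarIndex) (y : ℝ) :
    haar l (fun x => K.primTwo (x + y)) i - haar l (fun x => K.primTwo (x + 0)) i
      = ∫ v in (0 : ℝ)..y, K.haarPrim l i v := by
  rw [intervalIntegral.integral_eq_sub_of_hasDerivAt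
    (f := fun y => haar l (fun x => K.primTwo (x + y)) i)
    (fun v _ => ?_) ((K.continuous_haarPrim l i).intervalIntegrable _ _)]
  have h : ∀ c : ℝ, HasDerivAt (fun y => K.primTwo (c + y)) (K.prim (c + v)) v := fun c =>
    (K.hasDerivAt_primTwo (c + v)).comp_const_add c v
  unfold haarPrim
  rcases i with _ | ⟨k, m⟩
  · simp only [haar]
    exact ((h _).fun_sub (h _)).fun_const_smul (√l)⁻¹
  · simp only [haar, dyadicInc]
    exact (((h _).fun_sub (h _)).fun_sub ((h _).fun_sub (h _))).fun_const_smul _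

/-- The scalar products of the Haar functions of two adjacent intervals. -/
def haarMatrix (l : ℝ) (i j : HaarIndex) : ℝ :=
  haar l (fun y => haar l (fun x => K.primTwo (x + y)) i) j

/-- A Haar coefficient is a finite combination of point values, so the transforms in the two
variables commute. As the kernel depends on `x + y`, the matrix is symmetric. -/
theorem haar_comm (l : ℝ) (M : ℝ → ℝ → ℝ) (i j : HaarIndex) :
    haar l (fun y => haar l (fun x => M x y) i) j = haar l (fun x => haar l (fun y => M x y) j) i := by
  let L : (ℝ → ℝ) →ₗ[ℝ] ℝ :=
    { toFun := fun Φ => haar l Φ j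
      map_add' := fun Φ Ψ => by
        rcases j with _ | ⟨k, m⟩ <;> simp only [haar, dyadicInc, Pi.add_apply, smul_eq_mul] <;> ring
      map_smul' := fun c Φ => by
        rcases j with _ | ⟨k, m⟩ <;>
          simp only [haar, dyadicInc, Pi.smul_apply, smul_eq_mul, RingHom.id_apply] <;> ring }
  have h1 := haar_map l L M i
  rw [show (fun x => haar l (fun y => M x y) j) = fun x => L (M x) from rfl]
  have h2 : (fun y => haar l (fun x => M x y) i) = haar l M i := by
    funext y
    exact haar_map l (LinearMap.proj (R := ℝ) (φ := fun _ : ℝ => ℝ) y) M i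
  rw [h2]
  exact h1.symm

theorem haarMatrix_symm (l : ℝ) (i j : HaarIndex) : K.haarMatrix l i j = K.haarMatrix l j i := by
  rw [haarMatrix, haar_comm, haarMatrix]
  simp only [add_comm]

theorem haar_sub_const (l : ℝ) (Φ : ℝ → ℝ) (c : ℝ) (i : HaarIndex) :
    haar l (fun x => Φ x - c) i = haar l Φ i := by
  rcases i with _ | ⟨k, m⟩ <;> simp [haar, dyadicInc]

theorem sum_haarMatrix_sq_le {l : ℝ} (hl : 0 < l) (i : HaarIndex) (F : Finset HaarIndex) :
    ∑ j ∈ F, K.haarMatrix l i j ^ 2 ≤ ∫ v in (0 : ℝ)..l, K.haarPrim l i v ^ 2 := by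
  have hc := K.continuous_haarPrim l i
  refine le_trans (le_of_eq ?_) (haar_bessel hl (hc.intervalIntegrable _ _)
    ((hc.pow 2).intervalIntegrable _ _) F)
  refine Finset.sum_congr rfl fun j _ => ?_
  simp only [← haar_primTwo_sub, haar_sub_const, haarMatrix]

/-- On the cells with `m ≥ 1`, `x ↦ B (x + v)` is monotone and bounded by `B (h + v)`, so
`haar_sq_sum_le` applies with `a = 1`. On the first cell `B` may blow up as `v → 0`, and the total
increment of the primitive is used instead. -/
theorem sum_haarPrim_sq_le {l : ℝ} (hl : 0 < l) {k : ℕ} {v : ℝ} (hv : 0 < v) :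
    ∑ m : Fin (2 ^ k), K.haarPrim l (some ⟨k, m⟩) v ^ 2
      ≤ (l / 2 ^ k) / 4 * K.B (l / 2 ^ k + v) ^ 2
        + (l / 2 ^ k)⁻¹ * (K.prim (v + l / 2 ^ k) - K.prim v) ^ 2 := by
  set h := l / 2 ^ k with hh
  have hpos : 0 < h := by positivity
  have h1 := haar_sq_sum_le hl (k := k) (a := 1) (φ := fun x => K.B (x + v))
    (Φ := fun x => K.prim (x + v)) Nat.one_le_two_pow ?_ ?_
  · simp only [Nat.cast_one, one_mul, ← hh] at h1
    have h2 : (K.B (h + v) - K.B (l + v)) ^ 2 ≤ K.B (h + v) ^ 2 := by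
      have hhl : h ≤ l := by
        rw [hh]; exact div_le_self hl.le (one_le_pow₀ (by norm_num))
      have h3 := K.antitone (show 0 < h + v by positivity)
        (show 0 < l + v by positivity) (by linarith)
      have h4 := K.nonneg (l + v) (by positivity)
      exact pow_le_pow_left₀ (by linarith) (by linarith) 2
    have h0 : K.haarPrim l (some ⟨k, ⟨0, by positivity⟩⟩) v ^ 2
        ≤ h⁻¹ * (K.prim (v + h) - K.prim v) ^ 2 := by
      simp only [haarPrim, haar, dyadicInc, ← hh, smul_eq_mul]
      rw [mul_pow, inv_pow, Real.sq_sqrt hpos.le]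
      have e1 : ((2 * 0 + 1 : ℕ) : ℝ) * (l / 2 ^ (k + 1)) = h / 2 := by
        rw [hh, pow_succ]; push_cast; field_simp
      have e2 : ((2 * 0 + 1 + 1 : ℕ) : ℝ) * (l / 2 ^ (k + 1)) = h := by
        rw [hh, pow_succ]; push_cast; field_simp
      have e3 : ((2 * 0 : ℕ) : ℝ) * (l / 2 ^ (k + 1)) = 0 := by simp
      rw [e1, e2, e3, zero_add]
      have m1 := K.prim_monotone (by linarith : v ≤ h / 2 + v)
      have m2 := K.prim_monotone (by linarith : h / 2 + v ≤ h + v)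
      rw [add_comm v h]
      refine mul_le_mul_of_nonneg_left (sq_le_sq' ?_ ?_) (by positivity) <;> linarith
    have h5 : ∑ m : Fin (2 ^ k), K.haarPrim l (some ⟨k, m⟩) v ^ 2
        = (∑ m : Fin (2 ^ k), if 1 ≤ m.1 then K.haarPrim l (some ⟨k, m⟩) v ^ 2 else 0)
          + K.haarPrim l (some ⟨k, ⟨0, by positivity⟩⟩) v ^ 2 := by
      rw [← Finset.sum_add_sum_compl (Finset.univ.filter fun m : Fin (2 ^ k) => 1 ≤ m.1)
        (fun m => K.haarPrim l (some ⟨k, m⟩) v ^ 2), Finset.sum_filter]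
      congr 1
      rw [Finset.sum_eq_single_of_mem ⟨0, by positivity⟩ (by simp)]
      intro m hm hm0
      simp at hm
      exact absurd (Fin.ext (by simpa using hm)) hm0
    rw [h5]
    refine add_le_add (le_trans h1 ?_) h0
    gcongr
  · intro x hx y hy hxy
    have hx1 := hx.1
    rw [← hh] at hx1
    push_cast at hx1
    exact K.antitone (show x + v ∈ Ioi 0 by simp; linarith) (show y + v ∈ Ioi 0 by simp; linarith)
      (by linarith)
  · intro x y _ _ _
    rw [intervalIntegral.integral_comp_add_right, prim_sub]

/-- Both terms of the pointwise bound are dominated by `A²` times `sqrtRatioDeriv` plus a constant,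
with `65 = 64 + 1` and `5/2 = 1/2 + 2`. Integration in `v` then removes the dependence on `h`. -/
theorem sum_integral_haarPrim_sq_le {l A : ℝ} (hl : 0 < l) {k : ℕ} (hA : 0 ≤ A)
    (hB : ∀ r, 0 < r → K.B r ≤ A * (r⁻¹ + (√(l / 2 ^ k))⁻¹)) :
    ∑ m : Fin (2 ^ k), ∫ v in (0 : ℝ)..l, K.haarPrim l (some ⟨k, m⟩) v ^ 2
      ≤ A ^ 2 * (65 + 5 / 2 * l) := by
  set h := l / 2 ^ k with hh
  have hpos : 0 < h := by positivity
  have hsh : 0 < √h := Real.sqrt_pos.2 hpos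
  have hsq : (√h)⁻¹ ^ 2 = h⁻¹ := by rw [inv_pow, Real.sq_sqrt hpos.le]
  rw [← intervalIntegral.integral_finsetSum
    (f := fun (m : Fin (2 ^ k)) v => K.haarPrim l (some ⟨k, m⟩) v ^ 2) fun m _ =>
    ((K.continuous_haarPrim l _).pow 2).intervalIntegrable _ _]
  have hpt : ∀ v ∈ Ioo 0 l, ∑ m : Fin (2 ^ k), K.haarPrim l (some ⟨k, m⟩) v ^ 2
      ≤ A ^ 2 * (65 * sqrtRatioDeriv h v + 5 / 2) := by
    intro v hv
    have hv0 := hv.1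
    refine (K.sum_haarPrim_sq_le hl hv.1).trans ?_
    rw [← hh]
    have b1 : K.B (h + v) ^ 2 ≤ 2 * A ^ 2 * ((h + v)⁻¹ ^ 2 + h⁻¹) := by
      have h1 := pow_le_pow_left₀ (K.nonneg (h + v) (by positivity)) (hB (h + v) (by positivity)) 2
      rw [← hsq]
      nlinarith [mul_nonneg (sq_nonneg A) (sq_nonneg ((h + v)⁻¹ - (√h)⁻¹))]
    have b2 : K.prim (v + h) - K.prim v ≤ A * (Real.log ((v + h) / v) + √h) := by
      rw [prim_sub]
      have i1 : IntervalIntegrable (fun r : ℝ => r⁻¹) volume v (v + h) := by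
        rw [intervalIntegrable_inv_iff]
        right
        rw [uIcc_of_le (by linarith)]
        exact fun h => absurd h.1 (not_le.2 hv0)
      have h2 : ∫ r in v..(v + h), K.B r ≤ ∫ r in v..(v + h), A * (r⁻¹ + (√h)⁻¹) :=
        intervalIntegral.integral_mono_on (by linarith) K.integrable.intervalIntegrable
          ((i1.add (by simp)).const_mul A) fun r hr => hB r (hv0.trans_le hr.1)
      rw [intervalIntegral.integral_const_mul, intervalIntegral.integral_add i1 (by simp),
        integral_inv_of_pos hv0 (by positivity), intervalIntegral.integral_const, smul_eq_mul,
        add_sub_cancel_left] at h2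
      refine h2.trans (le_of_eq ?_)
      congr 2
      rw [mul_inv_eq_iff_eq_mul₀ hsh.ne', Real.mul_self_sqrt hpos.le]
    have b3 : (K.prim (v + h) - K.prim v) ^ 2 ≤ 2 * A ^ 2 * (32 * h * sqrtRatioDeriv h v + h) := by
      have h1 := pow_le_pow_left₀ (sub_nonneg.2 (K.prim_monotone (by linarith : v ≤ v + h))) b2 2
      have h3 := sq_log_ratio_le hpos hv0
      have h4 := Real.sq_sqrt hpos.le
      have h5 : (A * (Real.log ((v + h) / v) + √h)) ^ 2
          ≤ 2 * A ^ 2 * (Real.log ((v + h) / v) ^ 2 + √h ^ 2) := by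
        nlinarith [mul_nonneg (sq_nonneg A) (sq_nonneg (Real.log ((v + h) / v) - √h))]
      refine h1.trans (h5.trans ?_)
      rw [h4]
      gcongr
    have b4 := le_sqrtRatioDeriv hpos hv0
    calc h / 4 * K.B (h + v) ^ 2 + h⁻¹ * (K.prim (v + h) - K.prim v) ^ 2
        ≤ h / 4 * (2 * A ^ 2 * ((h + v)⁻¹ ^ 2 + h⁻¹))
          + h⁻¹ * (2 * A ^ 2 * (32 * h * sqrtRatioDeriv h v + h)) := by gcongr
      _ = A ^ 2 * (h / 2 * (h + v)⁻¹ ^ 2 + 64 * sqrtRatioDeriv h v + 5 / 2) := by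
          field_simp; ring
      _ ≤ A ^ 2 * (65 * sqrtRatioDeriv h v + 5 / 2) := by
          gcongr
          linarith
  have i1 := (intervalIntegrable_sqrtRatioDeriv hpos hl)
  have h1 := intervalIntegral.integral_mono_on_of_le_Ioo hl.le
    (Continuous.intervalIntegrable (continuous_finsetSum _ fun m _ =>
      ((K.continuous_haarPrim l (some ⟨k, m⟩)).pow 2)) _ _)
    (((i1.const_mul 65).add (by simp : IntervalIntegrable (fun _ => (5 / 2 : ℝ)) volume 0 l)).const_mul
      (A ^ 2)) hpt
  refine h1.trans ?_
  rw [intervalIntegral.integral_const_mul, intervalIntegral.integral_add (i1.const_mul 65) (by simp),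
    intervalIntegral.integral_const_mul, intervalIntegral.integral_const, smul_eq_mul]
  have := integral_sqrtRatioDeriv_le hpos hl
  rw [sub_zero, mul_comm l]
  gcongr
  linarith

/-- The Hilbert-Schmidt estimate. -/
theorem tsum_haarMatrix_ne_top {l C : ℝ} (hl : 0 < l) (hC : 0 < C) (q : ℕ) :
    ∑' i, ∑' j, ENNReal.ofReal ((haarWeight α C q i)⁻¹ * (haarWeight α C q j)⁻¹ *
      K.haarMatrix l i j ^ 2) ≠ ⊤ := by
  set w := haarWeight α C q with hw
  have hwpos : ∀ i, 0 < w i := haarWeight_pos α hC q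
  obtain ⟨C₁, hC₁, hB⟩ := K.exists_B_le hl q
  have hrow : ∀ i, ∑' j, ENNReal.ofReal (K.haarMatrix l i j ^ 2)
      ≤ ENNReal.ofReal (∫ v in (0 : ℝ)..l, K.haarPrim l i v ^ 2) := fun i => by
    rw [ENNReal.tsum_eq_iSup_sum]
    refine iSup_le fun F => ?_
    rw [← ENNReal.ofReal_sum_of_nonneg fun _ _ => sq_nonneg _]
    exact ENNReal.ofReal_le_ofReal (K.sum_haarMatrix_sq_le hl i F)
  set a : HaarIndex → HaarIndex → ENNReal := fun i j =>
    ENNReal.ofReal ((w i)⁻¹ ^ 2) * ENNReal.ofReal (K.haarMatrix l i j ^ 2) with ha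
  -- From `w_i⁻¹ w_j⁻¹ ≤ w_i⁻² + w_j⁻²` and the symmetry of the matrix, it is enough to sum whole
  -- rows with weight `w_i⁻²`.
  have hle : ∑' i, ∑' j, ENNReal.ofReal ((w i)⁻¹ * (w j)⁻¹ * K.haarMatrix l i j ^ 2)
      ≤ (∑' i, ∑' j, a i j) + ∑' i, ∑' j, a j i := by
    rw [← ENNReal.tsum_add]
    refine ENNReal.tsum_le_tsum fun i => ?_
    rw [← ENNReal.tsum_add]
    refine ENNReal.tsum_le_tsum fun j => ?_
    simp only [ha]
    rw [← ENNReal.ofReal_mul (by positivity), ← ENNReal.ofReal_mul (by positivity),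
      ← ENNReal.ofReal_add (by positivity) (by positivity), K.haarMatrix_symm l j i, ← add_mul]
    refine ENNReal.ofReal_le_ofReal (mul_le_mul_of_nonneg_right ?_ (sq_nonneg _))
    nlinarith [sq_nonneg ((w i)⁻¹ - (w j)⁻¹), sq_nonneg (w i)⁻¹, sq_nonneg (w j)⁻¹]
  have hfin : ∑' i, ∑' j, a i j ≠ ⊤ := by
    have h1 : ∑' i, ∑' j, a i j ≤ ∑' i, ENNReal.ofReal ((w i)⁻¹ ^ 2) *
        ENNReal.ofReal (∫ v in (0 : ℝ)..l, K.haarPrim l i v ^ 2) := by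
      refine ENNReal.tsum_le_tsum fun i => ?_
      simp only [ha]
      rw [ENNReal.tsum_mul_left]
      gcongr
      exact hrow i
    refine ne_top_of_le_ne_top ?_ h1
    rw [ENNReal.tsum_option, ENNReal.tsum_sigma']
    refine ENNReal.add_ne_top.2 ⟨ENNReal.mul_ne_top ENNReal.ofReal_ne_top ENNReal.ofReal_ne_top, ?_⟩
    set M := (C⁻¹ * C₁) ^ 2 * (65 + 5 / 2 * l) with hM
    have hM0 : 0 ≤ M := by positivity
    -- The squared inverse weight has order `k^{2α - 2}` and the rows of level `k` have total order
    -- `k^{-2α}`; the product is of order `k^{-2}` whatever `α` is.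
    have h2 : ∀ k : ℕ, ∑' m : Fin (2 ^ k), ENNReal.ofReal ((w (some ⟨k, m⟩))⁻¹ ^ 2) *
        ENNReal.ofReal (∫ v in (0 : ℝ)..l, K.haarPrim l (some ⟨k, m⟩) v ^ 2)
        ≤ ENNReal.ofReal (M * (1 / ((k : ℝ) + 1) ^ 2)) := by
      intro k
      have hx : 0 < (k + q + 1 : ℝ) := by positivity
      have h3 := K.sum_integral_haarPrim_sq_le hl (k := k)
        (A := C₁ * (k + q + 1 : ℝ) ^ (-α)) (by positivity) (hB k)
      have hnn : ∀ m : Fin (2 ^ k), 0 ≤ ∫ v in (0 : ℝ)..l, K.haarPrim l (some ⟨k, m⟩) v ^ 2 :=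
        fun m => intervalIntegral.integral_nonneg hl.le fun v _ => sq_nonneg _
      rw [tsum_fintype]
      simp only [hw, haarWeight]
      rw [← Finset.mul_sum, ← ENNReal.ofReal_sum_of_nonneg fun m _ => hnn m,
        ← ENNReal.ofReal_mul (by positivity)]
      refine ENNReal.ofReal_le_ofReal ?_
      calc _ ≤ (C * (k + q + 1 : ℝ) ^ (1 - α))⁻¹ ^ 2 *
            ((C₁ * (k + q + 1 : ℝ) ^ (-α)) ^ 2 * (65 + 5 / 2 * l)) := by gcongr
        _ = M * (1 / ((k + q + 1 : ℝ)) ^ 2) := by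
            rw [sub_eq_add_neg, Real.rpow_add hx, Real.rpow_one, hM]
            have : (k + q + 1 : ℝ) ^ (-α) ≠ 0 := (Real.rpow_pos_of_pos hx _).ne'
            field_simp
        _ ≤ _ := by
            gcongr
            have : (0 : ℝ) ≤ q := by positivity
            linarith
    refine ne_top_of_le_ne_top ?_ (ENNReal.tsum_le_tsum h2)
    have hs : Summable fun k : ℕ => M * (1 / ((k : ℝ) + 1) ^ 2) := by
      have h4 := (summable_nat_add_iff 1).2 (Real.summable_one_div_nat_pow.2 one_lt_two)
      refine Summable.mul_left M (h4.congr fun k => ?_)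
      push_cast; rfl
    rw [← ENNReal.ofReal_tsum_of_nonneg (fun k => by positivity) hs]
    exact ENNReal.ofReal_ne_top
  refine ne_top_of_le_ne_top (ENNReal.add_ne_top.2 ⟨hfin, ?_⟩) hle
  rw [ENNReal.tsum_comm]
  exact hfin

end TsirelsonKernel

/-! ### Indicator functions, integrals and total families -/

namespace TsirelsonKernel

variable {α : ℝ} (K : TsirelsonKernel α)

/-- The indicator function of `(a, b)`. -/
def ind (a b : ℝ) : K.Pre :=
  K.toL2.symm (indicatorConstLp 2 (measurableSet_Ioo (a := a) (b := b)) (by simp) (1 : ℝ))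

theorem ind_coeFn (a b : ℝ) :
    (K.toL2 (K.ind a b) : ℝ → ℝ) =ᵐ[volume] (Ioo a b).indicator fun _ => 1 := by
  rw [ind, LinearEquiv.apply_symm_apply]
  exact indicatorConstLp_coeFn

theorem pre_ext {f g : K.Pre} (h : (K.toL2 f : ℝ → ℝ) =ᵐ[volume] K.toL2 g) : f = g :=
  K.toL2.injective (Lp.ext h)

theorem ind_mem {a b a' b' : ℝ} (h : a' ≤ a) (h' : b ≤ b') : K.ind a b ∈ K.L2on a' b' := by
  rw [mem_L2on]
  filter_upwards [K.ind_coeFn a b] with x hx hx'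
  rw [hx, indicator_of_notMem]
  exact fun h2 => hx' (Ioo_subset_Ioo h h' h2)

theorem ind_add {a b c : ℝ} (hab : a ≤ b) (hbc : b ≤ c) :
    K.ind a b + K.ind b c = K.ind a c := by
  refine K.pre_ext ?_
  have hb : ∀ᵐ x : ℝ, x ≠ b := by simp [ae_iff]
  rw [map_add]
  filter_upwards [Lp.coeFn_add (K.toL2 (K.ind a b)) (K.toL2 (K.ind b c)), K.ind_coeFn a b,
    K.ind_coeFn b c, K.ind_coeFn a c, hb] with x h0 h1 h2 h3 hx
  rw [h0, Pi.add_apply, h1, h2, h3]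
  simp only [indicator, mem_Ioo]
  rcases lt_or_gt_of_ne hx with h | h
  · by_cases ha : a < x
    · simp [ha, h, h.trans_le hbc, h.not_gt]
    · simp [ha, h.not_gt]
  · by_cases hc : x < c
    · simp [hc, h, hab.trans_lt h, h.not_gt]
    · simp [hc, h.not_gt]

theorem locallyIntegrable_toL2 (f : K.Pre) : LocallyIntegrable (K.toL2 f : ℝ → ℝ) :=
  (Lp.memLp (K.toL2 f)).locallyIntegrable (by norm_num)

theorem intervalIntegrable_toL2 (f : K.Pre) (a b : ℝ) :
    IntervalIntegrable (K.toL2 f : ℝ → ℝ) volume a b :=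
  ((locallyIntegrable_toL2 K f).integrableOn_isCompact isCompact_uIcc).intervalIntegrable

/-- `∫ₐᵇ f` as a linear functional. -/
def integ (a b : ℝ) : K.Pre →ₗ[ℝ] ℝ where
  toFun f := ∫ x in a..b, (K.toL2 f : ℝ → ℝ) x
  map_add' f g := by
    rw [← intervalIntegral.integral_add (K.intervalIntegrable_toL2 f a b)
      (K.intervalIntegrable_toL2 g a b), map_add]
    refine intervalIntegral.integral_congr_ae ?_
    filter_upwards [Lp.coeFn_add (K.toL2 f) (K.toL2 g)] with x hx _
    rw [hx, Pi.add_apply]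
  map_smul' c f := by
    rw [RingHom.id_apply, smul_eq_mul, ← intervalIntegral.integral_const_mul, map_smul]
    refine intervalIntegral.integral_congr_ae ?_
    filter_upwards [Lp.coeFn_smul c (K.toL2 f)] with x hx _
    rw [hx, Pi.smul_apply, smul_eq_mul]

theorem integ_apply (a b : ℝ) (f : K.Pre) :
    K.integ a b f = ∫ x in a..b, (K.toL2 f : ℝ → ℝ) x := rfl

theorem integ_add (a b c : ℝ) (f : K.Pre) :
    K.integ a b f + K.integ b c f = K.integ a c f :=
  intervalIntegral.integral_add_adjacent_intervals (K.intervalIntegrable_toL2 f a b)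
    (K.intervalIntegrable_toL2 f b c)

theorem continuous_integ (a : ℝ) (f : K.Pre) : Continuous fun b => K.integ a b f :=
  intervalIntegral.continuous_primitive (fun _ _ => K.intervalIntegrable_toL2 f _ _) a

theorem inner_toL2_ind {a b : ℝ} (hab : a ≤ b) (f : K.Pre) :
    ⟪K.toL2 (K.ind a b), K.toL2 f⟫ = K.integ a b f := by
  rw [ind, LinearEquiv.apply_symm_apply, L2.inner_indicatorConstLp_one, integ_apply,
    intervalIntegral.integral_of_le hab, integral_Ioc_eq_integral_Ioo]

theorem integ_ind {x c : ℝ} (hx : 0 ≤ x) (hc : 0 ≤ c) :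
    K.integ 0 x (K.ind 0 c) = min x c := by
  rw [← inner_toL2_ind K hx, ind, ind, LinearEquiv.apply_symm_apply, LinearEquiv.apply_symm_apply,
    L2.real_inner_indicatorConstLp_one_indicatorConstLp_one _ _ (by simp) (by simp), Ioo_inter_Ioo]
  simp [hx, hc]

theorem norm_sq_eq (f : K.Pre) : ‖f‖ ^ 2 = kernelForm K.B (K.toL2 f) (K.toL2 f) := by
  rw [← real_inner_self_eq_norm_sq, inner_def]

/-- Schur's test: `|u(s) u(t)| ≤ ½ u(s)² + ½ u(t)²`, and `|B|` has the same integral along every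
row. So convergence in `L²` implies convergence in the completion, and totality passes from one to
the other. -/
theorem norm_sq_le (f : K.Pre) : ‖f‖ ^ 2 ≤ (∫ t, |K.B t|) * ‖K.toL2 f‖ ^ 2 := by
  rw [norm_sq_eq, ← real_inner_self_eq_norm_sq (K.toL2 f), L2.inner_def]
  have hf := Lp.memLp (K.toL2 f)
  set u : ℝ → ℝ := (K.toL2 f : ℝ → ℝ)
  have hB : Integrable fun t => |K.B t| := K.integrable.abs
  have hu2 : Integrable fun t => u t ^ 2 := hf.integrable_sq
  have key : Integrable (fun p : ℝ × ℝ => u p.2 ^ 2 * |K.B (p.1 - p.2)|) :=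
    Integrable.convolution_integrand (L := ContinuousLinearMap.mul ℝ ℝ) hu2 hB
  have e : ∫ p : ℝ × ℝ, u p.2 ^ 2 * |K.B (p.1 - p.2)| = (∫ t, |K.B t|) * ∫ t, u t ^ 2 := by
    rw [Measure.volume_eq_prod, integral_prod_symm _ key, ← integral_const_mul]
    refine integral_congr_ae (Eventually.of_forall fun y => ?_)
    simp only
    rw [integral_const_mul, integral_sub_right_eq_self (fun x => |K.B x|), mul_comm]
  have e' : ∫ p : ℝ × ℝ, u p.1 ^ 2 * |K.B (p.1 - p.2)| = (∫ t, |K.B t|) * ∫ t, u t ^ 2 := by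
    rw [← e, Measure.volume_eq_prod, ← integral_prod_swap]
    refine integral_congr_ae (Eventually.of_forall fun p => ?_)
    simp only [Prod.fst_swap, Prod.snd_swap]
    rw [← neg_sub, K.even]
  have key' : Integrable (fun p : ℝ × ℝ => u p.1 ^ 2 * |K.B (p.1 - p.2)|) := by
    refine key.swap.congr (Eventually.of_forall fun p => ?_)
    simp only [Function.comp, Prod.fst_swap, Prod.snd_swap]
    rw [← neg_sub, K.even]
  have h1 : kernelForm K.B u u ≤ ∫ p : ℝ × ℝ, (1 / 2 * (u p.1 ^ 2 * |K.B (p.1 - p.2)|)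
      + 1 / 2 * (u p.2 ^ 2 * |K.B (p.1 - p.2)|)) := by
    refine integral_mono (kernelForm_integrable K.integrable hf hf)
      ((key'.const_mul _).add (key.const_mul _)) fun p => ?_
    have h2 := le_abs_self (u p.1 * u p.2 * K.B (p.1 - p.2))
    rw [abs_mul, abs_mul] at h2
    refine h2.trans ?_
    have h3 : |u p.1| * |u p.2| ≤ 1 / 2 * u p.1 ^ 2 + 1 / 2 * u p.2 ^ 2 := by
      rw [← sq_abs (u p.1), ← sq_abs (u p.2)]
      nlinarith [sq_nonneg (|u p.1| - |u p.2|)]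
    nlinarith [mul_le_mul_of_nonneg_right h3 (abs_nonneg (K.B (p.1 - p.2)))]
  rw [integral_add (key'.const_mul _) (key.const_mul _), integral_const_mul, integral_const_mul,
    e, e'] at h1
  have h4 : ∫ t, ⟪u t, u t⟫ = ∫ t, u t ^ 2 := by
    refine integral_congr_ae (Eventually.of_forall fun t => ?_)
    simp [sq]
  rw [h4]
  linarith

/-- The map of `L²(ℝ)` into the completion is continuous for the norm of `L²(ℝ)`. -/
def toSpace : Lp ℝ 2 (volume : Measure ℝ) →L[ℝ] K.Space :=
  LinearMap.mkContinuous ((UniformSpace.Completion.toComplL (𝕜 := ℝ) (E := K.Pre)).toLinearMap ∘ₗ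
    K.toL2.symm.toLinearMap) (√(∫ t, |K.B t|)) fun f => by
    have h := Real.sqrt_le_sqrt (K.norm_sq_le (K.toL2.symm f))
    rw [Real.sqrt_sq (norm_nonneg _), Real.sqrt_mul' _ (sq_nonneg _), Real.sqrt_sq (norm_nonneg _),
      LinearEquiv.apply_symm_apply] at h
    exact (UniformSpace.Completion.norm_coe (K.toL2.symm f)).le.trans h

theorem toSpace_toL2 (f : K.Pre) : K.toSpace (K.toL2 f) = (f : K.Space) := rfl

theorem coe_mem_G {a b : ℝ} {f : K.Pre} (hf : f ∈ K.L2on a b) : (f : K.Space) ∈ K.G a b :=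
  subset_closure ⟨f, hf, rfl⟩

/-- A function in `L²(0, l)` whose primitive is constant vanishes. -/
theorem eq_zero_of_integ {l c : ℝ} {f : K.Pre} (hf : f ∈ K.L2on 0 l)
    (h : ∀ x ∈ Ioo 0 l, K.integ c x f = K.integ c (l / 2) f) : f = 0 := by
  refine K.pre_ext ?_
  rw [map_zero]
  have h1 := LocallyIntegrable.ae_hasDerivAt_integral (K.locallyIntegrable_toL2 f)
  filter_upwards [h1, hf, Lp.coeFn_zero ℝ 2 (volume : Measure ℝ)] with x hx hx' h0
  rw [h0, Pi.zero_apply]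
  by_cases hxl : x ∈ Ioo 0 l
  · have h2 : HasDerivAt (fun y => ∫ t in c..y, (K.toL2 f : ℝ → ℝ) t) 0 x := by
      refine (hasDerivAt_const x (K.integ c (l / 2) f)).congr_of_eventuallyEq ?_
      filter_upwards [isOpen_Ioo.mem_nhds hxl] with y hy
      exact h y hy
    exact (hx c).unique h2
  · exact hx' hxl

/-- A family of functions in `L²(0, l)` that is total in `L²(0, l)` is total in `G_(0,l)`. -/
theorem G_eq_closure_span {a b : ℝ} {A : Set K.Pre} (hA : A ⊆ K.L2on a b)
    (h : ∀ f ∈ K.L2on a b, (∀ g ∈ A, ⟪K.toL2 g, K.toL2 f⟫ = 0) → f = 0) :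
    K.G a b = (Submodule.span ℝ ((fun f : K.Pre => (f : K.Space)) '' A)).topologicalClosure := by
  apply le_antisymm
  · set M : Submodule ℝ (Lp ℝ 2 (volume : Measure ℝ)) :=
      (Submodule.span ℝ (K.toL2 '' A)).topologicalClosure with hM
    have hMc : IsClosed (M : Set (Lp ℝ 2 (volume : Measure ℝ))) :=
      Submodule.isClosed_topologicalClosure _
    have : CompleteSpace M := hMc.completeSpace_coe
    -- `L²(a, b)` is the kernel of the restriction to the complement of `(a, b)`, hence closed in
    -- `L²(ℝ)`. So the residual of the projection onto `M` stays in `L²(a, b)`, where the totality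
    -- hypothesis applies.
    have hMsub : ∀ u ∈ M, K.toL2.symm u ∈ K.L2on a b := by
      set R := LpToLpRestrictCLM ℝ ℝ ℝ volume 2 (Ioo a b)ᶜ
      have hR : ∀ g, K.toL2.symm g ∈ K.L2on a b ↔ g ∈ LinearMap.ker R.toLinearMap := fun g => by
        rw [mem_L2on, LinearEquiv.apply_symm_apply, LinearMap.mem_ker, ContinuousLinearMap.coe_coe,
          Lp.eq_zero_iff_ae_eq_zero,
          (LpToLpRestrictCLM_coeFn ℝ (Ioo a b)ᶜ g).congr_left, Filter.EventuallyEq,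
          ae_restrict_iff' measurableSet_Ioo.compl]
        rfl
      intro u hu
      rw [hR]
      refine Submodule.topologicalClosure_minimal _ (Submodule.span_le.2 ?_) R.isClosed_ker hu
      rintro _ ⟨g, hg, rfl⟩
      exact (hR _).1 (by rw [LinearEquiv.symm_apply_apply]; exact hA hg)
    have hsub : ∀ f ∈ K.L2on a b, K.toL2 f ∈ M := by
      intro f hf
      have h1 : K.toL2.symm (K.toL2 f - M.starProjection (K.toL2 f)) = 0 := by
        refine h _ ?_ fun g hg => ?_
        · rw [map_sub, LinearEquiv.symm_apply_apply]
          exact (K.L2on a b).sub_mem hf (hMsub _ (Submodule.starProjection_apply_mem _ _))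
        · rw [LinearEquiv.apply_symm_apply]
          exact Submodule.sub_starProjection_mem_orthogonal (K := M) _ _
            (subset_closure (Submodule.subset_span ⟨g, hg, rfl⟩))
      rw [map_eq_zero_iff _ K.toL2.symm.injective, sub_eq_zero] at h1
      rw [h1]
      exact Submodule.starProjection_apply_mem _ _
    refine Submodule.topologicalClosure_minimal _ ?_ (Submodule.isClosed_topologicalClosure _)
    rintro _ ⟨f, hf, rfl⟩
    have h2 := Submodule.topologicalClosure_map K.toSpace (Submodule.span ℝ (K.toL2 '' A))
      (Submodule.mem_map_of_mem (hsub f hf))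
    rw [Submodule.map_span, ← image_comp] at h2
    exact h2
  · refine Submodule.topologicalClosure_mono (Submodule.span_le.2 ?_)
    rintro _ ⟨f, hf, rfl⟩
    exact ⟨f, hA hf, rfl⟩

end TsirelsonKernel

/-! ### Boundedness of the functionals `f ↦ ∫₀ᵇ f` -/

theorem exists_sum_haarWeight_inv_le (α : ℝ) {l C : ℝ} (hl : 0 < l) (hC : 0 < C) (q : ℕ) :
    ∃ M ≥ 0, ∀ φ Φ : ℝ → ℝ, AntitoneOn φ (Icc 0 l) →
      (∀ x y, 0 ≤ x → x ≤ y → y ≤ l → Φ y - Φ x = ∫ t in x..y, φ t) →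
      ∀ F : Finset HaarIndex, ∑ i ∈ F, (haarWeight α C q i)⁻¹ * haar l Φ i ^ 2
        ≤ M * ((Φ l - Φ 0) ^ 2 + (φ 0 - φ l) ^ 2) := by
  set a : ℕ → ℝ := fun k => (C * (k + q + 1 : ℝ) ^ (1 - α))⁻¹ * ((l / 2 ^ k) / 4) with ha
  have ha0 : ∀ k, 0 ≤ a k := fun k => by simp only [ha]; positivity
  have hsum : Summable a := by
    have h1 := (summable_nat_add_iff (q + 1)).2
      (summable_pow_mul_geometric_of_norm_lt_one ⌈α⌉₊ (r := (1 / 2 : ℝ)) (by norm_num))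
    refine Summable.of_nonneg_of_le ha0 (fun k => ?_) (h1.mul_left (C⁻¹ * l / 4 * 2 ^ (q + 1)))
    have hx : (1 : ℝ) ≤ k + q + 1 := by
      have : (0 : ℝ) ≤ k := by positivity
      have : (0 : ℝ) ≤ q := by positivity
      linarith
    -- The inverse weights grow at most polynomially in `k`, while the squared coefficients of a
    -- monotone function on level `k` sum to `O(2⁻ᵏ)`.
    have h2 : ((k + q + 1 : ℝ) ^ (1 - α))⁻¹ ≤ (k + q + 1 : ℝ) ^ ⌈α⌉₊ := by
      rw [← Real.rpow_neg (by positivity), ← Real.rpow_natCast]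
      refine Real.rpow_le_rpow_of_exponent_le hx ?_
      linarith [Nat.le_ceil α]
    have e : ((k + (q + 1) : ℕ) : ℝ) = k + q + 1 := by push_cast; ring
    rw [e]
    calc a k = C⁻¹ * l / 4 * (1 / 2 ^ k) * ((k + q + 1 : ℝ) ^ (1 - α))⁻¹ := by
          simp only [ha, mul_inv]; ring
      _ ≤ C⁻¹ * l / 4 * (1 / 2 ^ k) * (k + q + 1 : ℝ) ^ ⌈α⌉₊ := by gcongr
      _ = _ := by
          rw [one_div_pow, pow_add, pow_succ]
          field_simp
          ring
  refine ⟨C⁻¹ * l⁻¹ + ∑' k, a k, by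
    have := tsum_nonneg (L := .unconditional ℕ) ha0
    positivity, fun φ Φ hφ hΦ F => ?_⟩
  obtain ⟨n, hn⟩ := exists_subset_haarLevels F
  refine (Finset.sum_le_sum_of_subset_of_nonneg hn fun i _ _ => mul_nonneg
    (inv_nonneg.2 (haarWeight_pos α hC q i).le) (sq_nonneg _)).trans ?_
  rw [sum_haarLevels]
  have h0 : (haarWeight α C q none)⁻¹ * haar l Φ none ^ 2 = C⁻¹ * l⁻¹ * (Φ l - Φ 0) ^ 2 := by
    simp only [haarWeight, haar, smul_eq_mul]
    rw [mul_pow, inv_pow, Real.sq_sqrt hl.le, mul_assoc]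
  have hk : ∀ k, ∑ m : Fin (2 ^ k), (haarWeight α C q (some ⟨k, m⟩))⁻¹ *
      haar l Φ (some ⟨k, m⟩) ^ 2 ≤ a k * (φ 0 - φ l) ^ 2 := fun k => by
    have h1 := haar_sq_sum_le hl (k := k) (a := 0) (φ := φ) (Φ := Φ) (Nat.zero_le _)
      (by simpa using hφ) (by simpa using hΦ)
    simp only [Nat.zero_le, if_true, Nat.cast_zero, zero_mul] at h1
    simp only [haarWeight]
    rw [← Finset.mul_sum]
    simp only [ha]
    rw [mul_assoc]
    gcongr
  have h2 : ∑ k ∈ Finset.range n, a k ≤ ∑' k, a k := hsum.sum_le_tsum _ fun k _ => ha0 k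
  have hC' : 0 ≤ C⁻¹ * l⁻¹ := by positivity
  have hT : 0 ≤ ∑' k, a k := tsum_nonneg ha0
  rw [h0]
  calc _ ≤ C⁻¹ * l⁻¹ * (Φ l - Φ 0) ^ 2 + ∑ k ∈ Finset.range n, a k * (φ 0 - φ l) ^ 2 := by
        gcongr with k _
        exact hk k
    _ ≤ C⁻¹ * l⁻¹ * (Φ l - Φ 0) ^ 2 + (∑' k, a k) * (φ 0 - φ l) ^ 2 := by
        rw [← Finset.sum_mul]
        gcongr
    _ ≤ _ := by nlinarith [mul_nonneg hC' (sq_nonneg (φ 0 - φ l)),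
        mul_nonneg hT (sq_nonneg (Φ l - Φ 0))]

/-- `x ↦ min x b` is the primitive of the indicator of `(0, b)`. For a grid point `b` its increments
are `h` to the left of `b` and `0` to the right, so the sum telescopes. -/
theorem sum_dyadicInc_min {W : Type*} [AddCommGroup W] [Module ℝ W] {l : ℝ} (hl : 0 < l)
    (Ξ : ℝ → W) {n j : ℕ} (hj : j ≤ 2 ^ n) :
    (l / 2 ^ n)⁻¹ • ∑ m ∈ Finset.range (2 ^ n),
      dyadicInc l (fun x => min x (j * (l / 2 ^ n))) n m • dyadicInc l Ξ n m
      = Ξ (j * (l / 2 ^ n)) - Ξ 0 := by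
  set h := l / 2 ^ n with hh
  have hpos : 0 < h := by positivity
  have h1 : ∀ m : ℕ, dyadicInc l (fun x => min x (j * h)) n m = if m < j then h else 0 := by
    intro m
    simp only [dyadicInc, ← hh]
    split_ifs with hm
    · have h2 : ((m + 1 : ℕ) : ℝ) ≤ j := by exact_mod_cast hm
      have h3 : (m : ℝ) ≤ j := by exact_mod_cast hm.le
      rw [min_eq_left (by gcongr), min_eq_left (by gcongr)]
      push_cast; ring
    · have h2 : (j : ℝ) ≤ m := by exact_mod_cast not_lt.1 hm
      have h3 : (j : ℝ) ≤ (m + 1 : ℕ) := h2.trans (by push_cast; linarith)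
      rw [min_eq_right (by gcongr), min_eq_right (by gcongr), sub_self]
  simp only [h1, ite_smul, zero_smul]
  rw [← Finset.sum_filter, show (Finset.range (2 ^ n)).filter (· < j) = Finset.range j by
    ext m; simp; omega, ← Finset.smul_sum, smul_smul, inv_mul_cancel₀ hpos.ne', one_smul]
  have := Finset.sum_range_sub (fun m : ℕ => Ξ (m * h)) j
  simpa [dyadicInc] using this

theorem exists_dyadic_seq {l x : ℝ} (hl : 0 < l) (hx : x ∈ Icc 0 l) :
    ∃ j : ℕ → ℕ, (∀ n, j n ≤ 2 ^ n) ∧ Tendsto (fun n => j n * (l / 2 ^ n)) atTop (𝓝 x) := by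
  have h0 : 0 ≤ x / l := div_nonneg hx.1 hl.le
  refine ⟨fun n => ⌊x / l * 2 ^ n⌋₊, fun n => ?_, ?_⟩
  · refine Nat.floor_le_of_le ?_
    push_cast
    exact mul_le_of_le_one_left (by positivity) ((div_le_one hl).2 hx.2)
  · have h1 := ((tendsto_nat_floor_mul_div_atTop h0).comp
      (tendsto_pow_atTop_atTop_of_one_lt (one_lt_two : (1 : ℝ) < 2))).mul_const l
    rw [div_mul_cancel₀ _ hl.ne'] at h1
    refine h1.congr fun n => ?_
    simp only [Function.comp]
    ring

namespace TsirelsonKernel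

variable {α : ℝ} (K : TsirelsonKernel α)

theorem integral_prim (a b : ℝ) : ∫ x in a..b, K.prim x = K.primTwo b - K.primTwo a :=
  intervalIntegral.integral_eq_sub_of_hasDerivAt (fun x _ => K.hasDerivAt_primTwo x)
    (K.continuous_prim.intervalIntegrable _ _)

theorem inner_ind_eq_integral {a b c d : ℝ} (hab : a ≤ b) (hcd : c ≤ d) :
    ⟪K.ind a b, K.ind c d⟫ = ∫ x in a..b, (K.prim (x - c) - K.prim (x - d)) := by
  have hmem : ∀ a b : ℝ, MemLp ((Ioo a b).indicator fun _ => (1 : ℝ)) 2 := fun a b =>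
    memLp_indicator_const 2 measurableSet_Ioo 1 (Or.inr (by simp))
  rw [inner_def, kernelForm_congr (K.ind_coeFn a b) (K.ind_coeFn c d), kernelForm,
    Measure.volume_eq_prod, integral_prod _ (kernelForm_integrable K.integrable (hmem a b) (hmem c d)),
    intervalIntegral.integral_of_le hab, integral_Ioc_eq_integral_Ioo,
    ← integral_indicator measurableSet_Ioo]
  refine integral_congr_ae (Eventually.of_forall fun x => ?_)
  simp only [mul_assoc]
  rw [integral_const_mul]
  have h1 : ∫ y, (Ioo c d).indicator (fun _ => (1 : ℝ)) y * K.B (x - y)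
      = K.prim (x - c) - K.prim (x - d) := by
    rw [prim_sub, ← intervalIntegral.integral_comp_sub_left (fun y => K.B y) x,
      intervalIntegral.integral_of_le hcd, integral_Ioc_eq_integral_Ioo,
      ← integral_indicator measurableSet_Ioo]
    refine integral_congr_ae (Eventually.of_forall fun y => ?_)
    by_cases hy : y ∈ Ioo c d <;> simp [hy]
  rw [h1]
  by_cases hx : x ∈ Ioo a b <;> simp [hx]

theorem inner_ind {a b c d : ℝ} (hab : a ≤ b) (hcd : c ≤ d) :
    ⟪K.ind a b, K.ind c d⟫ = K.primTwo (b - c) - K.primTwo (a - c)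
      - (K.primTwo (b - d) - K.primTwo (a - d)) := by
  have hc := K.continuous_prim
  rw [inner_ind_eq_integral K hab hcd, intervalIntegral.integral_sub
    (Continuous.intervalIntegrable (by fun_prop) _ _)
    (Continuous.intervalIntegrable (by fun_prop) _ _),
    intervalIntegral.integral_comp_sub_right, intervalIntegral.integral_comp_sub_right,
    integral_prim, integral_prim]

/-- A bounded functional on a subspace of `L²(ℝ)` is represented by a vector. -/
theorem exists_riesz (U : Submodule ℝ K.Pre) (φ : K.Pre →ₗ[ℝ] ℝ) {C : ℝ} (hC : 0 ≤ C)
    (h : ∀ f ∈ U, |φ f| ≤ C * ‖f‖) :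
    ∃ Z : K.Space, ‖Z‖ ≤ C ∧ ∀ f ∈ U, ⟪Z, (f : K.Space)⟫ = φ f := by
  obtain ⟨g, hg, hgn⟩ := exists_extension_norm_eq U
    ((φ.domRestrict U).mkContinuous C fun f => h f f.2)
  have hgC : ‖g‖ ≤ C := hgn.le.trans (LinearMap.mkContinuous_norm_le _ hC _)
  set G : K.Space →L[ℝ] ℝ := g.extend (UniformSpace.Completion.toComplL (𝕜 := ℝ) (E := K.Pre))
    with hG
  have hGf : ∀ f : K.Pre, G (f : K.Space) = g f := fun f =>
    ContinuousLinearMap.extend_eq (e := UniformSpace.Completion.toComplL (𝕜 := ℝ) (E := K.Pre)) g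
      UniformSpace.Completion.denseRange_coe (UniformSpace.Completion.isUniformInducing_coe _) f
  refine ⟨(InnerProductSpace.toDual ℝ K.Space).symm G, ?_, fun f hf => ?_⟩
  · rw [LinearIsometryEquiv.norm_map]
    refine G.opNorm_le_bound hC fun x => ?_
    refine UniformSpace.Completion.induction_on x (isClosed_le (by fun_prop) (by fun_prop)) fun f => ?_
    rw [hGf, UniformSpace.Completion.norm_coe]
    exact g.le_of_opNorm_le hgC f
  · rw [InnerProductSpace.toDual_symm_apply, hGf]
    exact hg ⟨f, hf⟩

/-- The vectors `Y b` represent the functionals `f ↦ ∫₀ᵇ f` on `L²(0, l)`. -/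
def Represents (l : ℝ) (Y : ℝ → K.Space) : Prop :=
  ∀ b ∈ Icc 0 l, ∀ f ∈ K.L2on 0 l, ⟪Y b, (f : K.Space)⟫ = K.integ 0 b f

theorem exists_haarWeight_integ {l : ℝ} (hl : 0 < l) : ∃ C > 0, ∃ q : ℕ, ∀ f ∈ K.L2on 0 l,
    ∀ F : Finset HaarIndex, ∑ i ∈ F, haarWeight α C q i * haar l (fun x => K.integ 0 x f) i ^ 2
      ≤ ‖f‖ ^ 2 := by
  obtain ⟨C, hC, q, h⟩ := K.exists_haarWeight hl
  refine ⟨C, hC, q, fun f hf F => ?_⟩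
  have hae : (Ioo 0 l).indicator (K.toL2 f : ℝ → ℝ) =ᵐ[volume] K.toL2 f := by
    filter_upwards [hf] with x hx
    by_cases hxl : x ∈ Ioo 0 l
    · rw [indicator_of_mem hxl]
    · rw [indicator_of_notMem hxl, hx hxl]
  have h1 := h ((Ioo 0 l).indicator (K.toL2 f : ℝ → ℝ))
    ((Lp.memLp (K.toL2 f)).indicator measurableSet_Ioo)
    (fun x hx => indicator_of_notMem hx _) F
  rw [kernelForm_congr hae hae, ← norm_sq_eq] at h1
  refine le_trans (le_of_eq ?_) h1
  congr! 6 with i _ x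
  exact (intervalIntegral.integral_congr_ae (hae.mono fun _ h _ => h)).symm

/-- For dyadic `b`, Parseval writes `∫₀ᵇ f` through the Haar coefficients of the indicator of `(0,
b)` and of `f`. Weighted Cauchy-Schwarz applies: the indicator is monotone, so its inverse-weighted
square sum is finite, uniformly in `b`. Other `b` follow by continuity. -/
theorem exists_sq_integ_le {l : ℝ} (hl : 0 < l) : ∃ M ≥ 0, ∀ f ∈ K.L2on 0 l, ∀ b ∈ Icc 0 l,
    K.integ 0 b f ^ 2 ≤ M * ‖f‖ ^ 2 := by
  obtain ⟨C, hC, q, h⟩ := K.exists_haarWeight_integ hl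
  obtain ⟨M, hM, hMle⟩ := exists_sum_haarWeight_inv_le α hl hC q
  refine ⟨M * (l ^ 2 + 1), by positivity, fun f hf b hb => ?_⟩
  have hw := haarWeight_pos α hC q
  have hdy : ∀ n j : ℕ, j ≤ 2 ^ n → K.integ 0 (j * (l / 2 ^ n)) f ^ 2 ≤ M * (l ^ 2 + 1) * ‖f‖ ^ 2 := by
    intro n j hj
    set b := j * (l / 2 ^ n) with hbdef
    have hb0 : 0 ≤ b := by positivity
    have hbl : b ≤ l := by
      have h1 : (j : ℝ) ≤ 2 ^ n := by exact_mod_cast hj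
      calc b ≤ 2 ^ n * (l / 2 ^ n) := by rw [hbdef]; gcongr
        _ = l := by field_simp
    set Ψ : ℝ → ℝ := fun x => min x b
    set Φ : ℝ → ℝ := fun x => K.integ 0 x f
    have h1 : K.integ 0 b f = ∑ i ∈ haarLevels n, haar l Ψ i * haar l Φ i := by
      have h2 := haar_expansion hl Ψ Φ n
      simp only [Ψ, hbdef] at h2
      rw [sum_dyadicInc_min hl Φ hj] at h2
      have h3 : Φ 0 = 0 := intervalIntegral.integral_same
      rw [h3, sub_zero] at h2
      exact h2.symm
    have h4 := Finset.sum_mul_sq_le_sq_mul_sq (haarLevels n)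
      (fun i => (√(haarWeight α C q i))⁻¹ * haar l Ψ i) (fun i => √(haarWeight α C q i) * haar l Φ i)
    have e1 : ∀ i, (√(haarWeight α C q i))⁻¹ * haar l Ψ i * (√(haarWeight α C q i) * haar l Φ i)
        = haar l Ψ i * haar l Φ i := fun i => by
      have := (Real.sqrt_pos.2 (hw i)).ne'
      field_simp
    have e2 : ∀ i, ((√(haarWeight α C q i))⁻¹ * haar l Ψ i) ^ 2
        = (haarWeight α C q i)⁻¹ * haar l Ψ i ^ 2 := fun i => by
      rw [mul_pow, inv_pow, Real.sq_sqrt (hw i).le]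
    have e3 : ∀ i, (√(haarWeight α C q i) * haar l Φ i) ^ 2
        = haarWeight α C q i * haar l Φ i ^ 2 := fun i => by
      rw [mul_pow, Real.sq_sqrt (hw i).le]
    simp only [e1, e2, e3, ← h1] at h4
    refine h4.trans ?_
    have h5 := hMle (fun t => if t ≤ b then 1 else 0) Ψ ?_ ?_ (haarLevels n)
    · refine mul_le_mul (h5.trans ?_) (h f hf _) (Finset.sum_nonneg fun i _ =>
        mul_nonneg (hw i).le (sq_nonneg _)) (by positivity)
      gcongr
      · simp only [Ψ]
        rw [min_eq_right hbl, min_eq_left hb0]; linarith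
      · simp only [Ψ]
        rw [min_eq_right hbl, min_eq_left hb0]; linarith
      · rw [if_pos hb0]
        split_ifs <;> norm_num
    · intro x _ y _ hxy
      simp only
      split_ifs with h1 h2
      · exact le_rfl
      · exact absurd (hxy.trans h1) h2
      · norm_num
      · exact le_rfl
    · intro x y _ hxy _
      have e4 : (fun t => if t ≤ b then (1 : ℝ) else 0) = (Iic b).indicator fun _ => 1 := rfl
      rw [intervalIntegral.integral_of_le hxy, e4, integral_indicator measurableSet_Iic,
        Measure.restrict_restrict measurableSet_Iic, setIntegral_const, smul_eq_mul, mul_one,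
        inter_comm, Ioc_inter_Iic, Measure.real, Real.volume_Ioc]
      simp only [Ψ]
      rcases le_total x b with hxb | hxb
      · rw [min_eq_left hxb, ENNReal.toReal_ofReal (sub_nonneg.2 (le_min hxy hxb))]
      · rw [min_eq_right hxb, min_eq_right (hxb.trans hxy), sub_self,
          ENNReal.ofReal_of_nonpos (by linarith), ENNReal.toReal_zero]
  obtain ⟨j, hj, hlim⟩ := exists_dyadic_seq hl hb
  have hc : Tendsto (fun n => K.integ 0 (j n * (l / 2 ^ n)) f ^ 2) atTop (𝓝 (K.integ 0 b f ^ 2)) :=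
    ((K.continuous_integ 0 f).tendsto b |>.comp hlim).pow 2
  exact le_of_tendsto' hc fun n => hdy n _ (hj n)

theorem exists_represents {l : ℝ} (hl : 0 < l) :
    ∃ Y : ℝ → K.Space, K.Represents l Y ∧ ∃ M, ∀ b ∈ Icc 0 l, ‖Y b‖ ≤ M := by
  obtain ⟨M, hM, h⟩ := K.exists_sq_integ_le hl
  have h1 : ∀ b, ∃ Z : K.Space, b ∈ Icc 0 l → ‖Z‖ ≤ √M ∧
      ∀ f ∈ K.L2on 0 l, ⟪Z, (f : K.Space)⟫ = K.integ 0 b f := by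
    intro b
    by_cases hb : b ∈ Icc 0 l
    · obtain ⟨Z, hZ⟩ := K.exists_riesz (K.L2on 0 l) (K.integ 0 b) (Real.sqrt_nonneg M)
        fun f hf => by
          have := Real.abs_le_sqrt (h f hf b hb)
          rwa [Real.sqrt_mul' _ (sq_nonneg _), Real.sqrt_sq (norm_nonneg _)] at this
      exact ⟨Z, fun _ => hZ⟩
    · exact ⟨0, fun h => absurd h hb⟩
  choose Y hY using h1
  exact ⟨Y, fun b hb => (hY b hb).2, √M, fun b hb => (hY b hb).1⟩

/-! ### Haar expansion in `G_(0,l)` and separation of points -/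

/-- The indicator functions of the dyadic intervals `(0, b)`. -/
def dyadicInd (l : ℝ) : Set K.Pre := {g | ∃ n j : ℕ, j ≤ 2 ^ n ∧ g = K.ind 0 (j * (l / 2 ^ n))}

theorem dyadicInd_subset {l : ℝ} (hl : 0 < l) : K.dyadicInd l ⊆ K.L2on 0 l := by
  rintro _ ⟨n, j, hj, rfl⟩
  refine K.ind_mem le_rfl ?_
  have h1 : (j : ℝ) ≤ 2 ^ n := by exact_mod_cast hj
  calc j * (l / 2 ^ n) ≤ 2 ^ n * (l / 2 ^ n) := by gcongr
    _ = l := by field_simp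

theorem G_eq_closure_dyadic {l : ℝ} (hl : 0 < l) :
    K.G 0 l = (Submodule.span ℝ
      ((fun f : K.Pre => (f : K.Space)) '' K.dyadicInd l)).topologicalClosure := by
  refine K.G_eq_closure_span (K.dyadicInd_subset hl) fun f hf h => ?_
  have h0 : ∀ x ∈ Icc 0 l, K.integ 0 x f = 0 := by
    intro x hx
    obtain ⟨j, hj, hlim⟩ := exists_dyadic_seq hl hx
    have hc := (K.continuous_integ 0 f).tendsto x |>.comp hlim
    refine tendsto_nhds_unique hc (tendsto_const_nhds.congr fun n => ?_)
    rw [Function.comp, ← inner_toL2_ind K (by positivity)]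
    exact (h _ ⟨n, j n, hj n, rfl⟩).symm
  refine K.eq_zero_of_integ hf (c := 0) fun x hx => ?_
  rw [h0 x ⟨hx.1.le, hx.2.le⟩, h0 (l / 2) ⟨by linarith, by linarith⟩]

/-- `D` is the span of dyadic indicators, whose elements are step functions and hence finite Haar
sums. The dual vectors are the Haar transform of `Y`, because pairing with `Y b` gives the primitive
of `f` at `b`. -/
theorem exists_isWeightedExpansion {l : ℝ} (hl : 0 < l) : ∃ C > 0, ∃ q : ℕ, ∀ Y : ℝ → K.Space,
    K.Represents l Y → ∃ D : Set K.Space, (K.G 0 l : Set K.Space) ⊆ closure D ∧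
      IsWeightedExpansion D (haar l fun x => ((K.ind 0 x : K.Pre) : K.Space)) (haar l Y)
        (haarWeight α C q) := by
  obtain ⟨C, hC, q, h⟩ := K.exists_haarWeight_integ hl
  refine ⟨C, hC, q, fun Y hY => ?_⟩
  set ι : K.Pre →ₗ[ℝ] K.Space :=
    (UniformSpace.Completion.toComplL (𝕜 := ℝ) (E := K.Pre)).toLinearMap with hι
  set A := Submodule.span ℝ (K.dyadicInd l) with hA
  have hAsub : A ≤ K.L2on 0 l := Submodule.span_le.2 (K.dyadicInd_subset hl)
  have hcoef : ∀ f ∈ A, ∀ i, ⟪haar l Y i, (f : K.Space)⟫ = haar l (fun x => K.integ 0 x f) i := by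
    intro f hf i
    have h1 := haar_map l (innerₛₗ ℝ (f : K.Space) : K.Space →ₗ[ℝ] ℝ) Y i
    rw [real_inner_comm]
    refine h1.symm.trans (haar_congr hl (fun x hx => ?_) i)
    exact (real_inner_comm _ _).trans (hY x hx f (hAsub hf))
  refine ⟨ι '' A, ?_, haarWeight_pos α hC q, ?_, ?_⟩
  · rw [K.G_eq_closure_dyadic hl, Submodule.topologicalClosure_coe]
    refine closure_mono ?_
    rw [show (fun f : K.Pre => (f : K.Space)) = ι from rfl, ← Submodule.map_span]
    exact subset_rfl
  · rintro _ ⟨f, hf, rfl⟩ F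
    have h2 := h f (hAsub hf) F
    rw [show ι f = (f : K.Space) from rfl, UniformSpace.Completion.norm_coe]
    simp only [hcoef f hf]
    exact h2
  · rintro _ ⟨f, hf, rfl⟩
    -- Stated for all large `n`, so that two elements of the span can be treated on a common grid.
    have hev : ∀ᶠ n in atTop, f = (l / 2 ^ n)⁻¹ • ∑ m ∈ Finset.range (2 ^ n),
        dyadicInc l (fun x => K.integ 0 x f) n m • dyadicInc l (fun x => K.ind 0 x) n m := by
      induction hf using Submodule.span_induction with
      | mem f hf =>
        obtain ⟨n, j, hj, rfl⟩ := hf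
        filter_upwards [eventually_ge_atTop n] with n' hn'
        obtain ⟨r, rfl⟩ := Nat.exists_eq_add_of_le hn'
        have e : (j : ℝ) * (l / 2 ^ n) = (j * 2 ^ r : ℕ) * (l / 2 ^ (n + r)) := by
          push_cast; rw [pow_add]; field_simp
        have hj' : j * 2 ^ r ≤ 2 ^ (n + r) := by rw [pow_add]; gcongr
        have h3 := sum_dyadicInc_min hl (fun x => K.ind 0 x) hj'
        rw [e]
        have h4 : K.ind 0 0 = 0 := by
          have := K.ind_add (le_refl (0 : ℝ)) le_rfl
          simpa using this
        rw [h4, sub_zero] at h3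
        refine h3.symm.trans ?_
        congr 1
        refine Finset.sum_congr rfl fun m hm => ?_
        congr 1
        have hm2 := dyadic_endpoints hl (Finset.mem_range.1 hm)
        simp only [dyadicInc]
        rw [K.integ_ind hm2.1 (by positivity), K.integ_ind (hm2.1.trans hm2.2.1) (by positivity)]
      | zero => simp [dyadicInc]
      | add f g _ _ hf hg =>
        filter_upwards [hf, hg] with n hf hg
        conv_lhs => rw [hf, hg]
        rw [← smul_add, ← Finset.sum_add_distrib]
        congr 1
        refine Finset.sum_congr rfl fun m _ => ?_
        rw [← add_smul]
        congr 1
        simp only [dyadicInc, map_add]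
        ring
      | smul c f _ hf =>
        filter_upwards [hf] with n hf
        conv_lhs => rw [hf]
        rw [smul_comm, Finset.smul_sum]
        congr 1
        refine Finset.sum_congr rfl fun m _ => ?_
        rw [smul_smul]
        congr 1
        simp only [dyadicInc, map_smul, smul_eq_mul]
        ring
    obtain ⟨n, hn⟩ := hev.exists
    refine ⟨haarLevels n, ?_⟩
    rw [← haar_expansion hl] at hn
    conv_lhs => rw [hn]
    rw [map_sum]
    refine Finset.sum_congr rfl fun i _ => ?_
    rw [map_smul, ← haar_map, show ι f = (f : K.Space) from rfl, hcoef f hf]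
    rfl

/-- An element of the completion need not be a function, so this is not a statement about
primitives. By `inner_eq_zero`, `x` is orthogonal to every indicator of `(0, b)`, since `y ↦ ⟪ind 0
y, ind 0 b⟫` is a difference of primitives of monotone functions and so has a finite
inverse-weighted square sum. Indicators are total. -/
theorem eq_zero_of_represents {l : ℝ} (hl : 0 < l) {Y : ℝ → K.Space} (hY : K.Represents l Y)
    {x : K.Space} (hx : x ∈ K.G 0 l) (h : ∀ b ∈ Icc 0 l, ⟪Y b, x⟫ = 0) : x = 0 := by
  obtain ⟨C, hC, q, hexp⟩ := K.exists_isWeightedExpansion hl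
  obtain ⟨D, hD, hE⟩ := hexp Y hY
  obtain ⟨M, hM, hMle⟩ := exists_sum_haarWeight_inv_le α hl hC q
  have hyi : ∀ i, ⟪haar l Y i, x⟫ = 0 := fun i => by
    have h1 := haar_map l (innerₛₗ ℝ x : K.Space →ₗ[ℝ] ℝ) Y i
    rw [real_inner_comm]
    refine h1.symm.trans ((haar_congr hl (Ψ := fun _ => (0 : ℝ)) (fun b hb => ?_) i).trans ?_)
    · exact (real_inner_comm _ _).trans (h b hb)
    · rcases i with _ | ⟨k, m⟩ <;> simp [haar, dyadicInc]
  have hind : ∀ b, 0 ≤ b → ⟪x, ((K.ind 0 b : K.Pre) : K.Space)⟫ = 0 := by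
    intro b hb
    refine hE.inner_eq_zero ?_ (hD hx) hyi
    set Φ₁ : ℝ → ℝ := fun x => ∫ t in (0 : ℝ)..x, -K.prim t
    set Φ₂ : ℝ → ℝ := fun x => ∫ t in (0 : ℝ)..x, -K.prim (t - b)
    have hc := K.continuous_prim
    have hΦ₁ := hMle (fun t => -K.prim t) Φ₁ (fun u _ v _ huv => neg_le_neg (K.prim_monotone huv))
      fun u v _ _ _ => intervalIntegral.integral_interval_sub_left
        (Continuous.intervalIntegrable (by fun_prop) _ _)
        (Continuous.intervalIntegrable (by fun_prop) _ _)
    have hΦ₂ := hMle (fun t => -K.prim (t - b)) Φ₂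
      (fun u _ v _ huv => neg_le_neg (K.prim_monotone (by linarith)))
      fun u v _ _ _ => intervalIntegral.integral_interval_sub_left
        (Continuous.intervalIntegrable (by fun_prop) _ _)
        (Continuous.intervalIntegrable (by fun_prop) _ _)
    have hcoef : ∀ i, ⟪haar l (fun x => ((K.ind 0 x : K.Pre) : K.Space)) i,
        ((K.ind 0 b : K.Pre) : K.Space)⟫ = haar l Φ₂ i - haar l Φ₁ i := by
      intro i
      have h1 := haar_map l (innerₛₗ ℝ ((K.ind 0 b : K.Pre) : K.Space) : K.Space →ₗ[ℝ] ℝ)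
        (fun x => ((K.ind 0 x : K.Pre) : K.Space)) i
      rw [real_inner_comm]
      refine h1.symm.trans ((haar_congr hl (Ψ := fun x => Φ₂ x - Φ₁ x) (fun y hy => ?_) i).trans ?_)
      · refine (real_inner_comm ((K.ind 0 y : K.Pre) : K.Space) ((K.ind 0 b : K.Pre) : K.Space)).trans ?_
        rw [UniformSpace.Completion.inner_coe, K.inner_ind_eq_integral hy.1 hb]
        simp only [sub_zero, Φ₁, Φ₂]
        rw [← intervalIntegral.integral_sub (Continuous.intervalIntegrable (by fun_prop) _ _)
          (Continuous.intervalIntegrable (by fun_prop) _ _)]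
        refine intervalIntegral.integral_congr fun t _ => ?_
        ring
      · rcases i with _ | ⟨k, m⟩ <;> simp only [haar, dyadicInc, smul_eq_mul] <;> ring
    refine summable_of_sum_le (c := 2 * (M * ((Φ₁ l - Φ₁ 0) ^ 2 + (-K.prim 0 - -K.prim l) ^ 2))
      + 2 * (M * ((Φ₂ l - Φ₂ 0) ^ 2 + (-K.prim (0 - b) - -K.prim (l - b)) ^ 2)))
      (fun i => mul_nonneg (inv_nonneg.2 (hE.pos i).le) (sq_nonneg _)) fun F => ?_
    simp only [hcoef]
    refine le_trans ?_ (add_le_add (mul_le_mul_of_nonneg_left (hΦ₁ F) zero_le_two)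
      (mul_le_mul_of_nonneg_left (hΦ₂ F) zero_le_two))
    rw [Finset.mul_sum, Finset.mul_sum, ← Finset.sum_add_distrib]
    refine Finset.sum_le_sum fun i _ => ?_
    have := inv_nonneg.2 (hE.pos i).le
    nlinarith [mul_nonneg this (sq_nonneg (haar l Φ₂ i + haar l Φ₁ i))]
  have hself : ⟪x, x⟫ = 0 := by
    have h2 : K.G 0 l ≤ (Submodule.span ℝ {x})ᗮ := by
      rw [K.G_eq_closure_dyadic hl]
      refine Submodule.topologicalClosure_minimal _ (Submodule.span_le.2 ?_)
        (Submodule.isClosed_orthogonal _)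
      rintro _ ⟨_, ⟨n, j, hj, rfl⟩, rfl⟩
      exact Submodule.mem_orthogonal_singleton_iff_inner_right (𝕜 := ℝ) |>.2 (hind _ (by positivity))
    exact Submodule.mem_orthogonal_singleton_iff_inner_right (𝕜 := ℝ) |>.1 (h2 hx)
  exact inner_self_eq_zero.1 hself

end TsirelsonKernel

/-! ### Adjacent intervals: reflection, shift and quasi-orthogonality -/

theorem isQuasiOrthogonalSum_of_isHilbertSchmidt {V : Type*} [NormedAddCommGroup V]
    [InnerProductSpace ℝ V] [CompleteSpace V] {G₁ G₂ K : Submodule ℝ V} [CompleteSpace G₁]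
    [CompleteSpace G₂] [CompleteSpace K] (hdisj : G₁ ⊓ G₂ = ⊥) (hsup : G₁ ⊔ G₂ = K)
    (hs : IsHilbertSchmidt (G₁.starProjection ∘L G₂.subtypeL)) : IsQuasiOrthogonalSum G₁ G₂ K := by
  have h₁ : G₁ ≤ K := hsup ▸ le_sup_left
  have h₂ : G₂ ≤ K := hsup ▸ le_sup_right
  have c₁ : IsClosed (G₁ : Set V) := completeSpace_coe_iff_isComplete.1 ‹_› |>.isClosed
  have c₂ : IsClosed (G₂ : Set V) := completeSpace_coe_iff_isComplete.1 ‹_› |>.isClosed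
  have cK : IsClosed (K : Set V) := completeSpace_coe_iff_isComplete.1 ‹_› |>.isClosed
  refine ⟨h₁, h₂, ?_, ?_⟩
  · set G₁' : Submodule ℝ K := G₁.comap K.subtype with hG₁
    set G₂' : Submodule ℝ K := G₂.comap K.subtype with hG₂
    have c₁' : IsClosed (G₁' : Set K) := c₁.preimage continuous_subtype_val
    have c₂' : IsClosed (G₂' : Set K) := c₂.preimage continuous_subtype_val
    have : CompleteSpace G₁' := c₁'.completeSpace_coe
    have : CompleteSpace G₂' := c₂'.completeSpace_coe
    have hcompl : IsCompl G₁' G₂' := by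
      constructor
      · rw [Submodule.disjoint_def]
        intro x hx1 hx2
        have h3 : (x : V) ∈ G₁ ⊓ G₂ := ⟨hx1, hx2⟩
        rw [hdisj, Submodule.mem_bot] at h3
        exact Subtype.ext h3
      · rw [codisjoint_iff, eq_top_iff]
        intro x _
        have h3 : (x : V) ∈ G₁ ⊔ G₂ := hsup ▸ x.2
        obtain ⟨y, hy, z, hz, hyz⟩ := Submodule.mem_sup.1 h3
        exact Submodule.mem_sup.2 ⟨⟨y, h₁ hy⟩, hy, ⟨z, h₂ hz⟩, hz, Subtype.ext hyz⟩
    -- The operator must act on `K` itself, so everything is moved inside `K`. As `G₁ ≤ K`, the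
    -- projection onto `G₁` within `K` is the ambient one cut down to `K`.
    have hs' : IsHilbertSchmidt (E := G₂') (F := K) (G₁'.starProjection ∘L G₂'.subtypeL) := by
      have h4 := (hs.comp_left K.orthogonalProjectionOnto).comp_right (H := G₂')
        ((K.subtypeL ∘L G₂'.subtypeL).codRestrict G₂ fun x => x.2)
      convert h4 using 1
      ext1 x
      refine Submodule.eq_starProjection_of_mem_of_inner_eq_zero ?_ fun w hw => ?_
      · have h5 : ((K.orthogonalProjectionOnto (G₁.starProjection ((x : K) : V)) : K) : V)
            = G₁.starProjection ((x : K) : V) :=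
          Submodule.starProjection_eq_self_iff.2 (h₁ (Submodule.starProjection_apply_mem _ _))
        change ((K.orthogonalProjectionOnto (G₁.starProjection ((x : K) : V)) : K) : V) ∈ G₁
        rw [h5]
        exact Submodule.starProjection_apply_mem _ _
      · have h5 : ((K.orthogonalProjectionOnto (G₁.starProjection ((x : K) : V)) : K) : V)
            = G₁.starProjection ((x : K) : V) :=
          Submodule.starProjection_eq_self_iff.2 (h₁ (Submodule.starProjection_apply_mem _ _))
        change ⟪((x : K) : V) - ((K.orthogonalProjectionOnto (G₁.starProjection ((x : K) : V)) : K) : V),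
          (w : V)⟫ = 0
        rw [h5]
        exact Submodule.starProjection_inner_eq_zero _ _ hw
    obtain ⟨A, hA, hA'⟩ := IsHilbertSchmidt.exists_inPosS c₁' c₂' hcompl hs'
    exact ⟨A, hA, fun x y hx hy => hA' x hx y hy⟩
  · rw [hsup]
    exact cK.submodule_topologicalClosure_eq

theorem kernelForm_reflect {B : ℝ → ℝ} (he : ∀ t, B (-t) = B t) (f g : ℝ → ℝ) (c : ℝ) :
    kernelForm B (fun s => f (c - s)) (fun s => g (c - s)) = kernelForm B f g := by
  unfold kernelForm
  rw [← integral_sub_left_eq_self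
    (fun p : ℝ × ℝ => f p.1 * g p.2 * B (p.1 - p.2)) volume ((c, c) : ℝ × ℝ)]
  refine integral_congr_ae (Eventually.of_forall fun p => ?_)
  simp only [Prod.fst_sub, Prod.snd_sub]
  rw [← he]
  congr 2
  ring

theorem haar_sub {W : Type*} [AddCommGroup W] [Module ℝ W] (l : ℝ) (Φ Ψ : ℝ → W) (i : HaarIndex) :
    haar l (fun x => Φ x - Ψ x) i = haar l Φ i - haar l Ψ i := by
  rcases i with _ | ⟨k, m⟩ <;> simp only [haar, dyadicInc] <;> module

theorem inner_haar_haar {V : Type*} [NormedAddCommGroup V] [InnerProductSpace ℝ V] (l : ℝ)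
    (Φ Ψ : ℝ → V) (i j : HaarIndex) :
    ⟪haar l Φ i, haar l Ψ j⟫ = haar l (fun y => haar l (fun x => ⟪Φ x, Ψ y⟫) i) j := by
  have h1 : ∀ y, haar l (fun x => ⟪Φ x, Ψ y⟫) i = ⟪haar l Φ i, Ψ y⟫ := fun y => by
    have := haar_map l (innerₛₗ ℝ (Ψ y) : V →ₗ[ℝ] ℝ) Φ i
    simp only [innerₛₗ_apply_apply] at this
    rw [real_inner_comm, ← this]
    simp only [real_inner_comm]
  simp only [h1]
  exact (haar_map l (innerₛₗ ℝ (haar l Φ i) : V →ₗ[ℝ] ℝ) Ψ j).symm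

namespace TsirelsonKernel

variable {α : ℝ} (K : TsirelsonKernel α)

/-- The shift as an isometry of the completion. -/
def shiftLI (t : ℝ) : K.Space →ₗᵢ[ℝ] K.Space where
  toLinearMap := (K.shift t).toLinearMap
  norm_map' x := by
    refine UniformSpace.Completion.induction_on x
      (isClosed_eq (by simpa using (K.shift t).continuous.norm) (by fun_prop)) fun f => ?_
    change ‖K.shift t (f : K.Space)‖ = _
    rw [shift_coe, UniformSpace.Completion.norm_coe, UniformSpace.Completion.norm_coe]
    exact (K.shiftIsom t).norm_map f

@[simp] theorem shiftLI_apply (t : ℝ) (x : K.Space) : K.shiftLI t x = K.shift t x := rfl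

theorem shiftLM_ind (t a b : ℝ) : K.shiftLM t (K.ind a b) = K.ind (a + t) (b + t) := by
  refine K.pre_ext ?_
  have h := (measurePreserving_sub_right volume t).quasiMeasurePreserving.ae (K.ind_coeFn a b)
  filter_upwards [K.shiftLM_coeFn t (K.ind a b), h, K.ind_coeFn (a + t) (b + t)] with x h1 h2 h3
  rw [h1, h2, h3]
  simp only [indicator, mem_Ioo, lt_sub_iff_add_lt, sub_lt_iff_lt_add]

theorem shift_add (s t : ℝ) (x : K.Space) : K.shift s (K.shift t x) = K.shift (s + t) x := by
  refine UniformSpace.Completion.induction_on x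
    (isClosed_eq (by fun_prop) (by fun_prop)) fun f => ?_
  rw [shift_coe, shift_coe, shift_coe]
  congr 1
  refine K.pre_ext ?_
  have h := (measurePreserving_sub_right volume s).quasiMeasurePreserving.ae (K.shiftLM_coeFn t f)
  filter_upwards [K.shiftLM_coeFn s (K.shiftLM t f), h, K.shiftLM_coeFn (s + t) f] with x h1 h2 h3
  rw [h1, h2, h3, sub_sub]

theorem shift_zero (x : K.Space) : K.shift 0 x = x := by
  refine UniformSpace.Completion.induction_on x
    (isClosed_eq (by fun_prop) (by fun_prop)) fun f => ?_
  rw [shift_coe]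
  congr 1
  refine K.pre_ext ?_
  filter_upwards [K.shiftLM_coeFn 0 f] with x h1
  rw [h1, sub_zero]

/-- The reflection `f ↦ f (s - ·)`. -/
def reflectLM (s : ℝ) : K.Pre →ₗ[ℝ] K.Pre :=
  K.toL2.symm.toLinearMap ∘ₗ
    Lp.compMeasurePreservingₗ ℝ (fun u => s - u) (Measure.measurePreserving_sub_left volume s) ∘ₗ
    K.toL2.toLinearMap

theorem reflectLM_coeFn (s : ℝ) (f : K.Pre) :
    (K.toL2 (K.reflectLM s f) : ℝ → ℝ) =ᵐ[volume] fun u => (K.toL2 f : ℝ → ℝ) (s - u) :=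
  Lp.coeFn_compMeasurePreserving (K.toL2 f) (Measure.measurePreserving_sub_left volume s)

/-- The reflection is isometric for the scalar product. -/
def reflectIsom (s : ℝ) : K.Pre →ₗᵢ[ℝ] K.Pre :=
  (K.reflectLM s).isometryOfInner fun f g => by
    rw [inner_def, inner_def, kernelForm_congr (K.reflectLM_coeFn s f) (K.reflectLM_coeFn s g)]
    exact kernelForm_reflect K.even _ _ s

theorem reflect_coe (s : ℝ) (f : K.Pre) :
    (K.reflectIsom s).toContinuousLinearMap.completion (f : K.Space)
      = ((K.reflectLM s f : K.Pre) : K.Space) :=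
  UniformSpace.Completion.map_coe (K.reflectIsom s).toContinuousLinearMap.uniformContinuous f

/-- The reflection as an isometry of the completion. -/
def reflectLI (s : ℝ) : K.Space →ₗᵢ[ℝ] K.Space where
  toLinearMap := ((K.reflectIsom s).toContinuousLinearMap.completion).toLinearMap
  norm_map' x := by
    refine UniformSpace.Completion.induction_on x
      (isClosed_eq (by simpa using
        ((K.reflectIsom s).toContinuousLinearMap.completion).continuous.norm) (by fun_prop))
      fun f => ?_
    change ‖(K.reflectIsom s).toContinuousLinearMap.completion (f : K.Space)‖ = _
    rw [reflect_coe, UniformSpace.Completion.norm_coe, UniformSpace.Completion.norm_coe]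
    exact (K.reflectIsom s).norm_map f

theorem reflectLI_coe (s : ℝ) (f : K.Pre) :
    K.reflectLI s (f : K.Space) = ((K.reflectLM s f : K.Pre) : K.Space) := K.reflect_coe s f

theorem reflectLM_ind (s a b : ℝ) : K.reflectLM s (K.ind a b) = K.ind (s - b) (s - a) := by
  refine K.pre_ext ?_
  have h := (Measure.measurePreserving_sub_left volume s).quasiMeasurePreserving.ae (K.ind_coeFn a b)
  filter_upwards [K.reflectLM_coeFn s (K.ind a b), h, K.ind_coeFn (s - b) (s - a)] with x h1 h2 h3
  rw [h1, h2, h3]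
  simp only [indicator, mem_Ioo, lt_sub_comm (b := s), sub_lt_comm (a := s), and_comm]

theorem reflectLI_reflectLI (s : ℝ) (x : K.Space) : K.reflectLI s (K.reflectLI s x) = x := by
  refine UniformSpace.Completion.induction_on x
    (isClosed_eq ((K.reflectLI s).continuous.comp (K.reflectLI s).continuous) (by fun_prop))
    fun f => ?_
  rw [reflectLI_coe, reflectLI_coe]
  congr 1
  refine K.pre_ext ?_
  have h := (Measure.measurePreserving_sub_left volume s).quasiMeasurePreserving.ae
    (K.reflectLM_coeFn s f)
  filter_upwards [K.reflectLM_coeFn s (K.reflectLM s f), h] with x h1 h2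
  rw [h1, h2, sub_sub_cancel]

theorem reflectLI_mem {s a b : ℝ} {x : K.Space} (hx : x ∈ K.G a b) :
    K.reflectLI s x ∈ K.G (s - b) (s - a) := by
  have hmaps : MapsTo (K.reflectLI s)
      ((K.L2on a b).map (UniformSpace.Completion.toComplL (𝕜 := ℝ) (E := K.Pre)).toLinearMap :
        Set K.Space)
      ((K.L2on (s - b) (s - a)).map
        (UniformSpace.Completion.toComplL (𝕜 := ℝ) (E := K.Pre)).toLinearMap : Set K.Space) := by
    rintro _ ⟨f, hf, rfl⟩
    refine ⟨K.reflectLM s f, ?_, (K.reflectLI_coe s f).symm⟩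
    have h := (Measure.measurePreserving_sub_left volume s).quasiMeasurePreserving.ae hf
    change ∀ᵐ x : ℝ, x ∉ Ioo (s - b) (s - a) → (K.toL2 (K.reflectLM s f) : ℝ → ℝ) x = 0
    filter_upwards [h, K.reflectLM_coeFn s f] with x h1 h2 hx
    rw [h2]
    exact h1 fun hx' => hx ⟨by linarith [hx'.2], by linarith [hx'.1]⟩
  exact hmaps.closure (K.reflectLI s).continuous hx

instance (a b : ℝ) : CompleteSpace (K.G a b) :=
  (Submodule.isClosed_topologicalClosure _).completeSpace_coe

theorem isClosed_G (a b : ℝ) : IsClosed (K.G a b : Set K.Space) :=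
  Submodule.isClosed_topologicalClosure _

theorem prim_neg (x : ℝ) : K.prim (-x) = -K.prim x := by
  rw [prim, prim, ← intervalIntegral.integral_symm, ← neg_zero,
    ← intervalIntegral.integral_comp_neg, neg_zero]
  simp only [K.even]

theorem primTwo_neg (x : ℝ) : K.primTwo (-x) = K.primTwo x := by
  rw [primTwo, primTwo, ← neg_neg (∫ t in (0 : ℝ)..(-x), K.prim t),
    ← intervalIntegral.integral_symm, ← neg_zero (G := ℝ), ← intervalIntegral.integral_comp_neg]
  simp [prim_neg]

/-- Reflection and shift send `(0, x)` and `(0, y)` to `(s - x, s)` and `(s, s + y)`. The scalar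
product of these indicators is `primTwo (x + y) - primTwo x - primTwo y`, and Haar coefficients
annihilate the terms that depend on one variable only. -/
theorem inner_haar_reflect_shift {l : ℝ} (hl : 0 < l) (s : ℝ) (i j : HaarIndex) :
    ⟪K.reflectLI s (haar l (fun x => ((K.ind 0 x : K.Pre) : K.Space)) i),
      K.shiftLI s (haar l (fun x => ((K.ind 0 x : K.Pre) : K.Space)) j)⟫ = K.haarMatrix l i j := by
  rw [show ∀ x, K.reflectLI s x = (K.reflectLI s).toLinearMap x from fun _ => rfl,
    show ∀ x, K.shiftLI s x = (K.shiftLI s).toLinearMap x from fun _ => rfl, ← haar_map, ← haar_map,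
    inner_haar_haar, haarMatrix]
  have h0 : K.primTwo 0 = 0 := intervalIntegral.integral_same
  have h1 : ∀ x ∈ Icc 0 l, ∀ y ∈ Icc 0 l,
      ⟪(K.reflectLI s).toLinearMap ((K.ind 0 x : K.Pre) : K.Space),
        (K.shiftLI s).toLinearMap ((K.ind 0 y : K.Pre) : K.Space)⟫
        = K.primTwo (x + y) - K.primTwo x - K.primTwo y := by
    intro x hx y hy
    change ⟪K.reflectLI s ((K.ind 0 x : K.Pre) : K.Space), K.shift s ((K.ind 0 y : K.Pre) : K.Space)⟫ = _
    rw [reflectLI_coe, shift_coe, UniformSpace.Completion.inner_coe, reflectLM_ind, shiftLM_ind,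
      inner_ind K (by linarith [hx.1]) (by linarith [hy.1])]
    rw [show s - 0 - (0 + s) = 0 by ring, show s - x - (0 + s) = -x by ring,
      show s - 0 - (y + s) = -y by ring, show s - x - (y + s) = -(x + y) by ring,
      primTwo_neg, primTwo_neg, primTwo_neg, h0]
    ring
  have h2 : ∀ y ∈ Icc 0 l, haar l (fun x =>
      ⟪(K.reflectLI s).toLinearMap ((K.ind 0 x : K.Pre) : K.Space),
        (K.shiftLI s).toLinearMap ((K.ind 0 y : K.Pre) : K.Space)⟫) i
        = haar l (fun x => K.primTwo (x + y)) i - haar l K.primTwo i := by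
    intro y hy
    rw [haar_congr hl (fun x hx => h1 x hx y hy), haar_sub_const, haar_sub]
  rw [haar_congr hl h2, haar_sub_const]

/-- The Haar systems of `(s - l, s)` and `(s, s + l)` are images of a single one under isometries.
The choice of `l` makes these intervals large enough to contain `(0, s)` and `(s, u)`. -/
theorem isHilbertSchmidt_starProjection {s : ℝ} (hs : 0 < s) (u : ℝ) :
    IsHilbertSchmidt ((K.G 0 s).starProjection ∘L (K.G s u).subtypeL) := by
  set l := max s (u - s) with hldef
  have hl : 0 < l := lt_max_of_lt_left hs
  obtain ⟨C, hC, q, hexp⟩ := K.exists_isWeightedExpansion hl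
  obtain ⟨Y, hY, -⟩ := K.exists_represents hl
  obtain ⟨D, hD, hE⟩ := hexp Y hY
  refine (hE.map (K.reflectLI s)).isHilbertSchmidt (hE.map (K.shiftLI s)) ?_ _ _ ?_ ?_
  · simp only [Function.comp, K.inner_haar_reflect_shift hl]
    exact K.tsum_haarMatrix_ne_top hl hC q
  · intro x hx
    have h1 : K.reflectLI s x ∈ K.G 0 l := by
      refine K.G_mono ?_ ?_ (K.reflectLI_mem (s := s) hx)
      · simp
      · rw [sub_zero]; exact le_max_left _ _
    rw [← K.reflectLI_reflectLI s x]
    exact image_closure_subset_closure_image (K.reflectLI s).continuous ⟨_, hD h1, rfl⟩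
  · intro x hx
    have h1 : K.shift (-s) x ∈ K.G 0 l := by
      refine K.G_mono ?_ ?_ (K.shift_mem (s := -s) hx)
      · simp
      · exact le_max_right _ _
    have h2 : K.shiftLI s (K.shift (-s) x) = x := by
      rw [shiftLI_apply, shift_add, add_neg_cancel, shift_zero]
    rw [← h2]
    exact image_closure_subset_closure_image (K.shiftLI s).continuous ⟨_, hD h1, rfl⟩

theorem integ_eq_zero {a b c d : ℝ} {f : K.Pre} (hf : f ∈ K.L2on a b) (h : b ≤ c ∨ d ≤ a)
    (hcd : c ≤ d) : K.integ c d f = 0 := by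
  rw [integ_apply, intervalIntegral.integral_of_le hcd, integral_Ioc_eq_integral_Ioo]
  refine setIntegral_eq_zero_of_ae_eq_zero ?_
  filter_upwards [hf] with x hx hx'
  refine hx fun hx2 => ?_
  rcases h with h | h
  · linarith [hx'.1, hx2.2]
  · linarith [hx'.2, hx2.1]

theorem eq_on_G {a b : ℝ} {y z : K.Space} (h : ∀ f ∈ K.L2on a b, ⟪y, (f : K.Space)⟫ = ⟪z, (f : K.Space)⟫)
    {x : K.Space} (hx : x ∈ K.G a b) : ⟪y, x⟫ = ⟪z, x⟫ := by
  have hcl : IsClosed {x : K.Space | ⟪y, x⟫ = ⟪z, x⟫} := isClosed_eq (by fun_prop) (by fun_prop)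
  refine closure_minimal ?_ hcl hx
  rintro _ ⟨f, hf, rfl⟩
  exact h f hf

theorem L2on_mono {a b a' b' : ℝ} (h : a' ≤ a) (h' : b ≤ b') : K.L2on a b ≤ K.L2on a' b' :=
  fun f hf => by
    rw [mem_L2on] at *
    filter_upwards [hf] with x hx hx'
    exact hx fun hx2 => hx' (Ioo_subset_Ioo h h' hx2)

/-- Membership in `G_(s,u)` makes `⟪Y b, x⟫` vanish for `b ≤ s`; membership in `G_(0,s)` makes it
equal to `⟪Y s, x⟫` for `b ≥ s`. So all of them vanish, and the `Y b` separate points. -/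
theorem G_inf_G {s u : ℝ} (hs : 0 < s) (hu : s < u) : K.G 0 s ⊓ K.G s u = ⊥ := by
  rw [Submodule.eq_bot_iff]
  rintro x ⟨hx1, hx2⟩
  obtain ⟨Y, hY, -⟩ := K.exists_represents (hs.trans hu)
  have h2 : ∀ b ∈ Icc 0 s, ⟪Y b, x⟫ = 0 := by
    intro b hb
    rw [K.eq_on_G (z := 0) (fun f hf => ?_) hx2, inner_zero_left]
    rw [hY b ⟨hb.1, hb.2.trans hu.le⟩ f (K.L2on_mono hs.le le_rfl hf), inner_zero_left]
    exact K.integ_eq_zero hf (Or.inr hb.2) hb.1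
  refine K.eq_zero_of_represents (hs.trans hu) hY (K.G_mono le_rfl hu.le hx1) fun b hb => ?_
  rcases le_total b s with h | h
  · exact h2 b ⟨hb.1, h⟩
  · rw [K.eq_on_G (z := Y s) (fun f hf => ?_) hx1, h2 s ⟨hs.le, le_rfl⟩]
    have hf' := K.L2on_mono le_rfl hu.le hf
    rw [hY b hb f hf', hY s ⟨hs.le, hu.le⟩ f hf', ← K.integ_add 0 s b,
      K.integ_eq_zero hf (Or.inl le_rfl) h, add_zero]

/-- The sum contains every indicator of `(0, b)`, cut at `s` if necessary, and it is closed because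
the angle is Hilbert-Schmidt. Closedness is needed: the sum maps must be onto, not merely of dense
range. -/
theorem G_sup_G {s u : ℝ} (hs : 0 < s) (hu : s < u) : K.G 0 s ⊔ K.G s u = K.G 0 u := by
  refine le_antisymm (sup_le (K.G_mono le_rfl hu.le) (K.G_mono hs.le le_rfl)) ?_
  have hcl : IsClosed ((K.G 0 s ⊔ K.G s u : Submodule ℝ K.Space) : Set K.Space) :=
    IsHilbertSchmidt.isClosed_sup (K.isClosed_G _ _) (K.isClosed_G _ _)
      (K.isHilbertSchmidt_starProjection hs u)
  rw [K.G_eq_closure_dyadic (hs.trans hu)]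
  refine Submodule.topologicalClosure_minimal _ (Submodule.span_le.2 ?_) hcl
  rintro _ ⟨g, hg, rfl⟩
  have hg' := K.dyadicInd_subset (hs.trans hu) hg
  obtain ⟨n, j, hj, rfl⟩ := hg
  set b := j * (u / 2 ^ n) with hb
  have hbu : b ≤ u := by
    have h1 : (j : ℝ) ≤ 2 ^ n := by exact_mod_cast hj
    calc b ≤ 2 ^ n * (u / 2 ^ n) := by rw [hb]; have := hs.trans hu; gcongr
      _ = u := by field_simp
  rcases le_total b s with h | h
  · exact Submodule.mem_sup_left (K.coe_mem_G (K.ind_mem le_rfl h))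
  · change ((K.ind 0 b : K.Pre) : K.Space) ∈ K.G 0 s ⊔ K.G s u
    rw [← K.ind_add hs.le h, UniformSpace.Completion.coe_add]
    exact Submodule.add_mem_sup (K.coe_mem_G (K.ind_mem le_rfl le_rfl))
      (K.coe_mem_G (K.ind_mem le_rfl hbu))

theorem isQuasiOrthogonalSum {s u : ℝ} (hs : 0 < s) (hu : s < u) :
    IsQuasiOrthogonalSum (K.G 0 s) (K.G s u) (K.G 0 u) :=
  isQuasiOrthogonalSum_of_isHilbertSchmidt (K.G_inf_G hs hu) (K.G_sup_G hs hu)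
    (K.isHilbertSchmidt_starProjection hs u)

end TsirelsonKernel

/-! ### Invertibility of the sum maps -/

section Sums

theorem ContinuousLinearMap.IsInvertible.adjoint {E F : Type*} [NormedAddCommGroup E]
    [InnerProductSpace ℝ E] [CompleteSpace E] [NormedAddCommGroup F] [InnerProductSpace ℝ F]
    [CompleteSpace F] {A : E →L[ℝ] F} (h : A.IsInvertible) :
    (ContinuousLinearMap.adjoint A).IsInvertible := by
  obtain ⟨e, rfl⟩ := h
  refine ContinuousLinearMap.IsInvertible.of_inverse
    (g := ContinuousLinearMap.adjoint (e.symm : F →L[ℝ] E)) ?_ ?_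
  · rw [← ContinuousLinearMap.adjoint_comp, e.coe_symm_comp_coe, ContinuousLinearMap.adjoint_id]
  · rw [← ContinuousLinearMap.adjoint_comp, e.coe_comp_coe_symm, ContinuousLinearMap.adjoint_id]

theorem inS_of_linearIsometryEquiv {E F : Type*} [NormedAddCommGroup E]
    [InnerProductSpace ℝ E] [CompleteSpace E] [NormedAddCommGroup F] [InnerProductSpace ℝ F]
    [CompleteSpace F] (e : E ≃ₗᵢ[ℝ] F) : InS (e.toContinuousLinearEquiv : E →L[ℝ] F) := by
  refine ⟨⟨_, rfl⟩, ContinuousLinearMap.id ℝ E, ContinuousLinearMap.isPositive_one, ?_, ?_⟩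
  · exact ((ContinuousLinearMap.norm_map_iff_adjoint_comp_self _).1 e.norm_map).symm
  · rw [sub_self]
    exact isHilbertSchmidt_zero

variable {V : Type*} [NormedAddCommGroup V] [InnerProductSpace ℝ V]

theorem isInvertible_sumMap₂ {G₁ G₂ K : Submodule ℝ V} [CompleteSpace G₁] [CompleteSpace G₂]
    [CompleteSpace K] (h₁ : G₁ ≤ K) (h₂ : G₂ ≤ K) (hdisj : G₁ ⊓ G₂ = ⊥) (hsup : G₁ ⊔ G₂ = K) :
    (sumMap₂ h₁ h₂).IsInvertible := by
  refine ⟨ContinuousLinearEquiv.ofBijective (sumMap₂ h₁ h₂) ?_ ?_,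
    ContinuousLinearEquiv.coe_ofBijective _ _ _⟩
  · rw [Submodule.eq_bot_iff]
    intro p hp
    have h3 : (p.ofLp.1 : V) + p.ofLp.2 = 0 := congrArg Subtype.val hp
    have h4 : (p.ofLp.1 : V) ∈ G₁ ⊓ G₂ :=
      ⟨p.ofLp.1.2, by rw [eq_neg_of_add_eq_zero_left h3]; exact G₂.neg_mem p.ofLp.2.2⟩
    rw [hdisj, Submodule.mem_bot] at h4
    rw [h4, zero_add] at h3
    exact (WithLp.ofLp_injective 2) (Prod.ext (Subtype.ext h4) (Subtype.ext h3))
  · rw [eq_top_iff]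
    intro x _
    obtain ⟨y, hy, z, hz, hyz⟩ := Submodule.mem_sup.1 (hsup ▸ x.2 : (x : V) ∈ G₁ ⊔ G₂)
    exact ⟨WithLp.toLp 2 (⟨y, hy⟩, ⟨z, hz⟩), Subtype.ext hyz⟩

/-- Directness is checked in two stages, through the intermediate space `H`; a continuous bijection
of Hilbert spaces has a bounded inverse. -/
theorem isInvertible_sumMap₃ {G₁ G₂ G₃ H K : Submodule ℝ V} [CompleteSpace G₁] [CompleteSpace G₂]
    [CompleteSpace G₃] [CompleteSpace K] (h₁ : G₁ ≤ K) (h₂ : G₂ ≤ K) (h₃ : G₃ ≤ K)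
    (hdisj : G₁ ⊓ G₂ = ⊥) (hsup : G₁ ⊔ G₂ = H) (hdisj' : H ⊓ G₃ = ⊥) (hsup' : H ⊔ G₃ = K) :
    (sumMap₃ h₁ h₂ h₃).IsInvertible := by
  refine ⟨ContinuousLinearEquiv.ofBijective (sumMap₃ h₁ h₂ h₃) ?_ ?_,
    ContinuousLinearEquiv.coe_ofBijective _ _ _⟩
  · rw [Submodule.eq_bot_iff]
    intro p hp
    have h4 : (p.ofLp.1 : V) + (p.ofLp.2.ofLp.1 + p.ofLp.2.ofLp.2) = 0 := congrArg Subtype.val hp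
    rw [← add_assoc] at h4
    have h5 : (p.ofLp.1 : V) + p.ofLp.2.ofLp.1 ∈ H ⊓ G₃ :=
      ⟨hsup ▸ Submodule.add_mem_sup p.ofLp.1.2 p.ofLp.2.ofLp.1.2,
        by rw [eq_neg_of_add_eq_zero_left h4]; exact G₃.neg_mem p.ofLp.2.ofLp.2.2⟩
    rw [hdisj', Submodule.mem_bot] at h5
    rw [h5, zero_add] at h4
    have h6 : (p.ofLp.1 : V) ∈ G₁ ⊓ G₂ :=
      ⟨p.ofLp.1.2, by rw [eq_neg_of_add_eq_zero_left h5]; exact G₂.neg_mem p.ofLp.2.ofLp.1.2⟩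
    rw [hdisj, Submodule.mem_bot] at h6
    rw [h6, zero_add] at h5
    exact (WithLp.ofLp_injective 2) (Prod.ext (Subtype.ext h6)
      ((WithLp.ofLp_injective 2) (Prod.ext (Subtype.ext h5) (Subtype.ext h4))))
  · rw [eq_top_iff]
    intro x _
    obtain ⟨u, hu, z, hz, huz⟩ := Submodule.mem_sup.1 (hsup'.symm ▸ x.2 : (x : V) ∈ H ⊔ G₃)
    obtain ⟨y, hy, v, hv, hyv⟩ := Submodule.mem_sup.1 (hsup.symm ▸ hu : u ∈ G₁ ⊔ G₂)
    refine ⟨WithLp.toLp 2 (⟨y, hy⟩, WithLp.toLp 2 (⟨v, hv⟩, ⟨z, hz⟩)), Subtype.ext ?_⟩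
    change y + (v + z) = x
    rw [← add_assoc, hyv, huz]

end Sums

/-! ### The axioms of a sum system -/

namespace TsirelsonKernel

variable {α : ℝ} (K : TsirelsonKernel α)

theorem shiftLM_mem {s a b : ℝ} {f : K.Pre} (hf : f ∈ K.L2on a b) :
    K.shiftLM s f ∈ K.L2on (a + s) (b + s) := by
  rw [mem_L2on]
  have h := (measurePreserving_sub_right volume s).quasiMeasurePreserving.ae hf
  filter_upwards [h, K.shiftLM_coeFn s f] with x h1 h2 hx
  rw [h2]
  exact h1 fun hx' => hx ⟨by linarith [hx'.1], by linarith [hx'.2]⟩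

theorem integ_shiftLM (s a b : ℝ) (f : K.Pre) :
    K.integ a b (K.shiftLM s f) = K.integ (a - s) (b - s) f := by
  rw [integ_apply, integ_apply, ← intervalIntegral.integral_comp_sub_right]
  exact intervalIntegral.integral_congr_ae ((K.shiftLM_coeFn s f).mono fun x hx _ => hx)

theorem map_shift_G (t a b : ℝ) :
    (K.G a b).map (K.shift t).toLinearMap = K.G (a + t) (b + t) := by
  refine le_antisymm ?_ fun x hx => ⟨K.shift (-t) x, ?_, ?_⟩
  · rintro _ ⟨x, hx, rfl⟩
    exact K.shift_mem hx
  · have h := K.shift_mem (s := -t) hx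
    rwa [add_neg_cancel_right, add_neg_cancel_right] at h
  · change K.shift t (K.shift (-t) x) = x
    rw [shift_add, add_neg_cancel, shift_zero]

theorem norm_shift (t : ℝ) (x : K.Space) : ‖K.shift t x‖ = ‖x‖ := (K.shiftLI t).norm_map x

/-- Translation is continuous in `L²`, hence on a dense set of the completion; the shifts are
isometric, so an `ε/3` argument extends this to every vector. -/
theorem tendsto_shift (x : K.Space) : Tendsto (fun t => K.shift t x) (𝓝 0) (𝓝 x) := by
  rw [Metric.tendsto_nhds]
  intro ε hε
  obtain ⟨f, hf⟩ := UniformSpace.Completion.denseRange_coe.exists_dist_lt x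
    (show 0 < ε / 3 by positivity)
  have h1 : Tendsto (fun t : ℝ => K.toL2 (K.shiftLM t f)) (𝓝 0) (𝓝 (K.toL2 (K.shiftLM 0 f))) := by
    have hg : Continuous fun t : ℝ => (⟨fun s => s - t, by fun_prop⟩ : C(ℝ, ℝ)) :=
      ContinuousMap.continuous_of_continuous_uncurry _ (by
        change Continuous fun p : ℝ × ℝ => p.2 - p.1
        fun_prop)
    exact Filter.Tendsto.compMeasurePreservingLp (f := fun _ : ℝ => K.toL2 f)
      tendsto_const_nhds (hg.tendsto 0) (fun t => measurePreserving_sub_right volume t)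
      (measurePreserving_sub_right volume 0) (by simp)
  have h2 := (K.toSpace.continuous.tendsto _).comp h1
  have h3 : K.toSpace (K.toL2 (K.shiftLM 0 f)) = (f : K.Space) := by
    rw [toSpace_toL2, ← shift_coe, shift_zero]
  rw [h3] at h2
  filter_upwards [Metric.tendsto_nhds.1 h2 (ε / 3) (by positivity)] with t ht
  have e : (K.toSpace ∘ fun t => K.toL2 (K.shiftLM t f)) t = K.shift t (f : K.Space) := by
    rw [shift_coe]; rfl
  rw [e] at ht
  have h4 : dist (K.shift t x) (K.shift t (f : K.Space)) = dist x (f : K.Space) :=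
    (K.shiftLI t).dist_map _ _
  calc dist (K.shift t x) x ≤ dist (K.shift t x) (K.shift t (f : K.Space))
        + dist (K.shift t (f : K.Space)) (f : K.Space) + dist (f : K.Space) x := dist_triangle4 _ _ _ _
    _ < ε / 3 + ε / 3 + ε / 3 := by
        rw [h4, dist_comm (f : K.Space) x]
        gcongr
    _ = ε := by ring

theorem isSumSystem : K.sumSystem.IsSumSystem where
  semigroup s t _ _ := LinearMap.ext fun x => (K.shift_add s t x).symm
  shift_inS s t hs ht := by
    let u : K.G 0 t →ₗᵢ[ℝ] K.G s (s + t) :=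
      { toLinearMap := ((K.shift s).toLinearMap ∘ₗ (K.G 0 t).subtype).codRestrict _
          fun x => K.sumSystem.S_mem hs ht x x.2
        norm_map' := fun x => K.norm_shift s x }
    have hu : Function.Surjective u := by
      intro z
      have h := K.map_shift_G s 0 t
      rw [zero_add, add_comm t s] at h
      have hz : (z : K.Space) ∈ (K.G 0 t).map (K.shift s).toLinearMap := by
        rw [h]
        exact z.2
      obtain ⟨x, hx, hxz⟩ := hz
      exact ⟨⟨x, hx⟩, Subtype.ext hxz⟩
    exact ⟨_, fun x => rfl, inS_of_linearIsometryEquiv (LinearIsometryEquiv.ofSurjective u hu)⟩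
  quasi_sum s t hs ht := K.isQuasiOrthogonalSum hs (by linarith)
  local_continuous a b _ _ x hx := by
    refine ⟨1, one_pos, ?_, (K.tendsto_shift x).mono_left nhdsWithin_le_nhds⟩
    filter_upwards [Ioo_mem_nhdsGT (zero_lt_one (α := ℝ))] with t ht
    exact K.G_mono (by linarith [ht.1]) (by linarith [ht.2]) (K.shift_mem hx)

theorem isUnitaryShift : K.sumSystem.IsUnitaryShift := fun t a b _ _ _ =>
  ⟨fun x _ => K.norm_shift t x, K.map_shift_G t a b⟩

/-! ### Real and imaginary additive units -/

theorem norm_sub_ind_sq {t u : ℝ} (ht : 0 ≤ t) (hu : 0 ≤ u) :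
    ‖((K.ind 0 t : K.Pre) : K.Space) - ((K.ind 0 u : K.Pre) : K.Space)‖ ^ 2
      = 2 * K.primTwo (t - u) := by
  have h0 : K.primTwo 0 = 0 := intervalIntegral.integral_same
  rw [norm_sub_sq_real, ← real_inner_self_eq_norm_sq, ← real_inner_self_eq_norm_sq]
  simp only [UniformSpace.Completion.inner_coe]
  rw [inner_ind K ht ht, inner_ind K ht hu, inner_ind K hu hu]
  simp only [sub_zero, zero_sub, sub_self, primTwo_neg, h0]
  ring

theorem continuous_ind : Continuous fun t : Ioi (0 : ℝ) => ((K.ind 0 t : K.Pre) : K.Space) := by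
  refine continuous_iff_continuousAt.2 fun t => ?_
  rw [ContinuousAt, tendsto_iff_norm_sub_tendsto_zero]
  have h1 : Continuous fun u : Ioi (0 : ℝ) => √(2 * K.primTwo (u - t)) := by
    have := K.continuous_primTwo
    fun_prop
  have h2 := h1.tendsto t
  have h0 : K.primTwo 0 = 0 := intervalIntegral.integral_same
  rw [sub_self, h0, mul_zero, Real.sqrt_zero] at h2
  refine h2.congr fun u => ?_
  rw [← K.norm_sub_ind_sq (le_of_lt u.2) (le_of_lt t.2), Real.sqrt_sq (norm_nonneg _)]

theorem isRealAdditiveUnit_ind :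
    K.sumSystem.IsRealAdditiveUnit fun t => ((K.ind 0 t : K.Pre) : K.Space) where
  mem t _ := K.coe_mem_G (K.ind_mem le_rfl le_rfl)
  measurable v _ := (K.continuous_ind.inner continuous_const).measurable
  add s t hs ht := by
    change ((K.ind 0 s : K.Pre) : K.Space) + K.shift s ((K.ind 0 t : K.Pre) : K.Space) = _
    rw [shift_coe, shiftLM_ind, ← UniformSpace.Completion.coe_add, zero_add, add_comm t s,
      K.ind_add hs.le (by linarith)]

theorem exists_unitVec {t : ℝ} (ht : 0 < t) : ∃ y ∈ K.G 0 t,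
    ∀ f ∈ K.L2on 0 t, ⟪y, (f : K.Space)⟫ = K.integ 0 t f := by
  obtain ⟨Y, hY, -⟩ := K.exists_represents ht
  refine ⟨(K.G 0 t).starProjection (Y t), Submodule.starProjection_apply_mem _ _, fun f hf => ?_⟩
  rw [Submodule.inner_starProjection_left_eq_right,
    Submodule.starProjection_eq_self_iff.2 (K.coe_mem_G hf)]
  exact hY t ⟨ht.le, le_rfl⟩ f hf

/-- The vector of `G_(0,t)` that represents the functional `f ↦ ∫ f`. -/
def unitVec (t : ℝ) : K.Space := if ht : 0 < t then (K.exists_unitVec ht).choose else 0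

theorem unitVec_mem {t : ℝ} (ht : 0 < t) : K.unitVec t ∈ K.G 0 t := by
  rw [unitVec, dif_pos ht]
  exact (K.exists_unitVec ht).choose_spec.1

theorem inner_unitVec {t : ℝ} (ht : 0 < t) {f : K.Pre} (hf : f ∈ K.L2on 0 t) :
    ⟪K.unitVec t, (f : K.Space)⟫ = K.integ 0 t f := by
  rw [unitVec, dif_pos ht]
  exact (K.exists_unitVec ht).choose_spec.2 f hf

theorem inner_shift_unitVec {a b : ℝ} (hab : a < b) {f : K.Pre} (hf : f ∈ K.L2on a b) :
    ⟪K.shift a (K.unitVec (b - a)), (f : K.Space)⟫ = K.integ a b f := by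
  have h1 := K.shiftLM_mem (s := -a) hf
  rw [add_neg_cancel, ← sub_eq_add_neg] at h1
  have h2 : (f : K.Space) = K.shift a ((K.shiftLM (-a) f : K.Pre) : K.Space) := by
    rw [← shift_coe, shift_add, add_neg_cancel, shift_zero]
  have h3 := (K.shiftLI a).inner_map_map (K.unitVec (b - a)) ((K.shiftLM (-a) f : K.Pre) : K.Space)
  rw [shiftLI_apply, shiftLI_apply, ← h2, K.inner_unitVec (sub_pos.2 hab) h1, integ_shiftLM] at h3
  rw [h3, sub_neg_eq_add, sub_neg_eq_add, zero_add, sub_add_cancel]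

/-- A function supported in `(0, t)` has the same integral over `(0, t)` and `(0, u)`. The unit
vectors are thus compatible under projection, which yields their measurability in `t`. -/
theorem starProjection_unitVec {t u : ℝ} (ht : 0 < t) (htu : t ≤ u) :
    (K.G 0 t).starProjection (K.unitVec u) = K.unitVec t := by
  refine Submodule.eq_starProjection_of_mem_of_inner_eq_zero (K.unitVec_mem ht) fun x hx => ?_
  rw [inner_sub_left, sub_eq_zero]
  refine K.eq_on_G (fun f hf => ?_) hx
  rw [K.inner_unitVec (ht.trans_le htu) (K.L2on_mono le_rfl htu hf), K.inner_unitVec ht hf,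
    ← K.integ_add 0 t u, K.integ_eq_zero hf (Or.inl le_rfl) htu, add_zero]

/-- By polarization it is enough to treat `‖P_t z‖`, which is monotone in `t` because the spaces
`G_(0,t)` increase. -/
theorem measurable_inner_starProjection (z v : K.Space) :
    Measurable fun t : ℝ => ⟪(K.G 0 t).starProjection z, v⟫ := by
  have h1 : ∀ z : K.Space, Monotone fun t : ℝ => ‖(K.G 0 t).starProjection z‖ := by
    intro z t u htu
    have h2 := Submodule.starProjection_comp_starProjection_of_le (K.G_mono (le_refl (0 : ℝ)) htu)
    change ‖(K.G 0 t).starProjection z‖ ≤ ‖(K.G 0 u).starProjection z‖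
    conv_lhs => rw [← h2]
    exact Submodule.norm_starProjection_apply_le _ _
  have h2 : ∀ t : ℝ, ⟪(K.G 0 t).starProjection z, v⟫
      = (‖(K.G 0 t).starProjection (z + v)‖ ^ 2 - ‖(K.G 0 t).starProjection (z - v)‖ ^ 2) / 4 := by
    intro t
    have h3 : ⟪(K.G 0 t).starProjection z, v⟫
        = ⟪(K.G 0 t).starProjection z, (K.G 0 t).starProjection v⟫ := by
      rw [Submodule.inner_starProjection_left_eq_right, Submodule.inner_starProjection_left_eq_right,
        Submodule.starProjection_eq_self_iff.2 (Submodule.starProjection_apply_mem _ _)]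
    rw [h3, map_add, map_sub, norm_add_sq_real, norm_sub_sq_real]
    ring
  simp only [h2]
  exact (((h1 _).measurable.pow_const 2).sub ((h1 _).measurable.pow_const 2)).div_const 4

theorem isImaginaryAdditiveUnit_unitVec : K.sumSystem.IsImaginaryAdditiveUnit K.unitVec where
  mem t ht := K.unitVec_mem ht
  measurable v _ := by
    -- For each `t` the sequence is constant as soon as `n ≥ t`, by `starProjection_unitVec`.
    refine measurable_of_tendsto_metrizable (f := fun (n : ℕ) (t : Ioi (0 : ℝ)) =>
      ⟪(K.G 0 t).starProjection (K.unitVec n), v⟫) (fun n =>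
        (K.measurable_inner_starProjection _ v).comp measurable_subtype_coe) ?_
    rw [tendsto_pi_nhds]
    intro t
    refine tendsto_const_nhds.congr' ?_
    filter_upwards [eventually_ge_atTop ⌈(t : ℝ)⌉₊] with n hn
    rw [K.starProjection_unitVec t.2 (Nat.ceil_le.1 hn)]
  add s t hs ht := by
    have hinv : (ContinuousLinearMap.adjoint (K.sumSystem.sumMap hs ht)).IsInvertible :=
      (isInvertible_sumMap₂ _ _ (K.G_inf_G hs (by linarith)) (K.G_sup_G hs (by linarith))).adjoint
    -- Inverting the adjoint amounts to checking `A* y_{s+t} = y_s ⊕ S_s y_t`. Tested on each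
    -- summand, this says that the integral over `(0, s + t)` of a function supported in `(0, s)` or
    -- in `(s, s + t)` is the integral over that part.
    refine congrArg Subtype.val (a₂ := (⟨K.unitVec (s + t), K.unitVec_mem (by linarith)⟩ :
      K.sumSystem.G 0 (s + t))) (hinv.inverse_apply_eq.2 ?_)
    refine ext_inner_right ℝ fun p => ?_
    rw [ContinuousLinearMap.adjoint_inner_left, WithLp.prod_inner_apply]
    change ⟪K.unitVec s, (p.ofLp.1 : K.Space)⟫ + ⟪K.shift s (K.unitVec t), (p.ofLp.2 : K.Space)⟫
      = ⟪K.unitVec (s + t), (p.ofLp.1 : K.Space) + p.ofLp.2⟫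
    have hst : 0 < s + t := by linarith
    rw [inner_add_right]
    congr 1
    · refine K.eq_on_G (fun f hf => ?_) p.ofLp.1.2
      rw [K.inner_unitVec hs hf, K.inner_unitVec hst (K.L2on_mono le_rfl (by linarith) hf),
        ← K.integ_add 0 s (s + t), K.integ_eq_zero hf (Or.inl le_rfl) (by linarith), add_zero]
    · refine K.eq_on_G (fun f hf => ?_) p.ofLp.2.2
      have h1 := K.inner_shift_unitVec (by linarith : s < s + t) hf
      rw [add_sub_cancel_left] at h1
      rw [h1, K.inner_unitVec hst (K.L2on_mono hs.le le_rfl hf),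
        ← K.integ_add 0 s (s + t), K.integ_eq_zero hf (Or.inr le_rfl) hs.le, zero_add]

/-! ### Density of the vectors given by additive units -/

theorem real_generate {s : ℝ} (hs : 0 < s) :
    K.G 0 s = (Submodule.span ℝ {z : K.Space | ∃ x : ℝ → K.Space,
      K.sumSystem.IsRealAdditiveUnit x ∧ ∃ s₁ s₂ : ℝ, 0 < s₁ ∧ s₁ < s₂ ∧ s₂ < s ∧
        z = K.sumSystem.S s₁ (x (s₂ - s₁))}).topologicalClosure := by
  apply le_antisymm
  · rw [K.G_eq_closure_span (A := {g | ∃ s₁ s₂ : ℝ, 0 < s₁ ∧ s₁ < s₂ ∧ s₂ < s ∧ g = K.ind s₁ s₂})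
      ?_ fun f hf h => ?_]
    · refine Submodule.topologicalClosure_mono (Submodule.span_mono ?_)
      rintro _ ⟨_, ⟨s₁, s₂, h₁, h₁₂, h₂, rfl⟩, rfl⟩
      refine ⟨_, K.isRealAdditiveUnit_ind, s₁, s₂, h₁, h₁₂, h₂, ?_⟩
      change _ = K.shift s₁ _
      rw [shift_coe, shiftLM_ind, zero_add, sub_add_cancel]
    · rintro _ ⟨s₁, s₂, h₁, h₁₂, h₂, rfl⟩
      exact K.ind_mem h₁.le h₂.le
    · have h0 : ∀ a b, 0 < a → a < b → b < s → K.integ a b f = 0 := fun a b ha hab hb => by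
        rw [← inner_toL2_ind K hab.le]
        exact h _ ⟨a, b, ha, hab, hb, rfl⟩
      -- The base point is interior because only intervals with `0 < s₁` and `s₂ < s` are available.
      refine K.eq_zero_of_integ hf (c := s / 2) fun x hx => ?_
      have h1 : K.integ (s / 2) (s / 2) f = 0 := intervalIntegral.integral_same
      rw [h1]
      rcases lt_trichotomy x (s / 2) with h2 | h2 | h2
      · have h3 := K.integ_add (s / 2) x (s / 2) f
        rw [h1, h0 x (s / 2) hx.1 h2 (by linarith), add_zero] at h3
        exact h3
      · rw [h2, h1]
      · exact h0 _ _ (by linarith) h2 hx.2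
  · refine Submodule.topologicalClosure_minimal _ (Submodule.span_le.2 ?_) (K.isClosed_G _ _)
    rintro _ ⟨x, hx, s₁, s₂, h₁, h₁₂, h₂, rfl⟩
    exact K.G_mono h₁.le h₂.le (K.sumSystem.S_mem_sub h₁ h₁₂ (hx.mem _ (sub_pos.2 h₁₂)))

/-- For `f ∈ L²(0, l)` this is continuity of the primitive. The uniform bound on `Y` makes the
approximation of `x` by such `f` uniform in `b`. -/
theorem continuousOn_inner_represents {l M : ℝ} {Y : ℝ → K.Space} (hY : K.Represents l Y)
    (hM : ∀ b ∈ Icc 0 l, ‖Y b‖ ≤ M) {x : K.Space} (hx : x ∈ K.G 0 l) :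
    ContinuousOn (fun b => ⟪Y b, x⟫) (Icc 0 l) := by
  refine continuousOn_of_uniform_approx_of_continuousOn fun u hu => ?_
  obtain ⟨ε, hε, hu⟩ := Metric.mem_uniformity_dist.1 hu
  obtain ⟨_, ⟨f, hf, rfl⟩, hxf⟩ := Metric.mem_closure_iff.1 hx (ε / (|M| + 1)) (by positivity)
  refine ⟨fun b => ⟪Y b, (f : K.Space)⟫, ?_, fun b hb => hu ?_⟩
  · exact (K.continuous_integ 0 f).continuousOn.congr fun b hb => hY b hb f hf
  · rw [Real.dist_eq, ← inner_sub_right]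
    change dist x (f : K.Space) < _ at hxf
    rw [dist_eq_norm, lt_div_iff₀ (by positivity)] at hxf
    calc |⟪Y b, x - (f : K.Space)⟫| ≤ ‖Y b‖ * ‖x - (f : K.Space)‖ := abs_real_inner_le_norm _ _
      _ ≤ (|M| + 1) * ‖x - (f : K.Space)‖ := by
          gcongr
          linarith [hM b hb, le_abs_self M]
      _ < ε := by linarith

/-- The imaginary vector represents `f ↦ ∫ f` over `(s₁, s₂)` on all of `L²(0, s)`, just as `Y s₂ -
Y s₁` does. The adjoint equation gives this on each of the three summands, which together fill
`G_(0,s)`. -/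
theorem inner_imagVector {s₁ s₂ s : ℝ} (h₁ : 0 < s₁) (h₁₂ : s₁ < s₂) (h₂ : s₂ < s)
    {Y : ℝ → K.Space} (hY : K.Represents s Y) {x : K.Space} (hx : x ∈ K.G 0 s) :
    ⟪(K.sumSystem.imagVector K.isImaginaryAdditiveUnit_unitVec h₁ h₁₂ h₂ : K.Space), x⟫
      = ⟪Y s₂ - Y s₁, x⟫ := by
  set w := K.sumSystem.imagVector K.isImaginaryAdditiveUnit_unitVec h₁ h₁₂ h₂ with hw
  have hinv : (ContinuousLinearMap.adjoint (K.sumSystem.sumMapThree h₁ h₁₂ h₂)).IsInvertible :=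
    (isInvertible_sumMap₃ _ _ _ (K.G_inf_G h₁ h₁₂) (K.G_sup_G h₁ h₁₂)
      (K.G_inf_G (h₁.trans h₁₂) h₂) (K.G_sup_G (h₁.trans h₁₂) h₂)).adjoint
  have hadj := (hinv.inverse_apply_eq).1 hw.symm
  have hs2 : 0 < s₂ := h₁.trans h₁₂
  have hY' : ∀ f ∈ K.L2on 0 s, ⟪Y s₂ - Y s₁, (f : K.Space)⟫ = K.integ s₁ s₂ f := fun f hf => by
    rw [inner_sub_left, hY s₂ ⟨hs2.le, h₂.le⟩ f hf, hY s₁ ⟨h₁.le, (h₁₂.trans h₂).le⟩ f hf,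
      ← K.integ_add 0 s₁ s₂, add_sub_cancel_left]
  have hx' := hx
  rw [← K.G_sup_G hs2 h₂, ← K.G_sup_G h₁ h₁₂] at hx'
  obtain ⟨u, hu, x₃, hx₃, rfl⟩ := Submodule.mem_sup.1 hx'
  obtain ⟨x₁, hx₁, x₂, hx₂, rfl⟩ := Submodule.mem_sup.1 hu
  have key := congrArg (fun z => ⟪z, (WithLp.toLp 2 ((⟨x₁, hx₁⟩ : K.sumSystem.G 0 s₁),
    WithLp.toLp 2 ((⟨x₂, hx₂⟩ : K.sumSystem.G s₁ s₂), (⟨x₃, hx₃⟩ : K.sumSystem.G s₂ s))) :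
    WithLp 2 (K.sumSystem.G 0 s₁ × WithLp 2 (K.sumSystem.G s₁ s₂ × K.sumSystem.G s₂ s)))⟫) hadj
  simp only [ContinuousLinearMap.adjoint_inner_left, WithLp.prod_inner_apply, inner_zero_left,
    zero_add, add_zero] at key
  have e1 : ⟪(w : K.Space), x₁ + x₂ + x₃⟫ = ⟪K.shift s₁ (K.unitVec (s₂ - s₁)), x₂⟫ := by
    rw [add_assoc]
    exact key.symm
  rw [e1, inner_add_right, inner_add_right]
  have f1 : ⟪Y s₂ - Y s₁, x₁⟫ = 0 := by
    rw [K.eq_on_G (z := 0) (fun f hf => ?_) hx₁, inner_zero_left]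
    rw [hY' f (K.L2on_mono le_rfl (h₁₂.trans h₂).le hf), inner_zero_left,
      K.integ_eq_zero hf (Or.inl le_rfl) h₁₂.le]
  have f3 : ⟪Y s₂ - Y s₁, x₃⟫ = 0 := by
    rw [K.eq_on_G (z := 0) (fun f hf => ?_) hx₃, inner_zero_left]
    rw [hY' f (K.L2on_mono hs2.le le_rfl hf), inner_zero_left,
      K.integ_eq_zero hf (Or.inr le_rfl) h₁₂.le]
  rw [f1, f3, zero_add, add_zero]
  refine K.eq_on_G (fun f hf => ?_) hx₂
  rw [K.inner_shift_unitVec h₁₂ hf, hY' f (K.L2on_mono h₁.le h₂.le hf)]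

/-- For the residual `r` of a vector after projection to the closed span, orthogonality makes `b ↦
⟪Y b, r⟫` constant on `(0, s)`. By continuity the constant is the value at `b = 0`, which is `0`;
then `eq_zero_of_represents` gives `r = 0`. -/
theorem imag_generate {s : ℝ} (hs : 0 < s) :
    K.G 0 s = (Submodule.span ℝ {z : K.Space | ∃ (y : ℝ → K.Space)
      (hy : K.sumSystem.IsImaginaryAdditiveUnit y) (s₁ s₂ : ℝ) (h₁ : 0 < s₁) (h₁₂ : s₁ < s₂)
      (h₂ : s₂ < s), z = K.sumSystem.imagVector hy h₁ h₁₂ h₂}).topologicalClosure := by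
  set N := (Submodule.span ℝ {z : K.Space | ∃ (y : ℝ → K.Space)
      (hy : K.sumSystem.IsImaginaryAdditiveUnit y) (s₁ s₂ : ℝ) (h₁ : 0 < s₁) (h₁₂ : s₁ < s₂)
      (h₂ : s₂ < s), z = K.sumSystem.imagVector hy h₁ h₁₂ h₂}).topologicalClosure with hN
  have hNle : N ≤ K.G 0 s := by
    refine Submodule.topologicalClosure_minimal _ (Submodule.span_le.2 ?_) (K.isClosed_G _ _)
    rintro _ ⟨y, hy, s₁, s₂, h₁, h₁₂, h₂, rfl⟩
    exact Subtype.property _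
  refine le_antisymm (fun x hx => ?_) hNle
  have : CompleteSpace N := (Submodule.isClosed_topologicalClosure _).completeSpace_coe
  set r := x - N.starProjection x with hr
  have hrG : r ∈ K.G 0 s := (K.G 0 s).sub_mem hx (hNle (Submodule.starProjection_apply_mem _ _))
  obtain ⟨Y, hY, M, hM⟩ := K.exists_represents hs
  have hcont := K.continuousOn_inner_represents hY hM hrG
  have hstep : ∀ s₁ s₂, 0 < s₁ → s₁ < s₂ → s₂ < s → ⟪Y s₁, r⟫ = ⟪Y s₂, r⟫ := by
    intro s₁ s₂ h₁ h₁₂ h₂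
    have h3 := K.inner_imagVector h₁ h₁₂ h₂ hY hrG
    have hmem : (K.sumSystem.imagVector K.isImaginaryAdditiveUnit_unitVec h₁ h₁₂ h₂ : K.Space) ∈ N :=
      subset_closure (Submodule.subset_span
        ⟨K.unitVec, K.isImaginaryAdditiveUnit_unitVec, s₁, s₂, h₁, h₁₂, h₂, rfl⟩)
    rw [real_inner_comm, Submodule.starProjection_inner_eq_zero _ _ hmem, inner_sub_left] at h3
    linarith
  have hconst : EqOn (fun b => ⟪Y b, r⟫) (fun _ => ⟪Y (s / 2), r⟫) (Ioo 0 s) := by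
    intro b hb
    rcases lt_trichotomy b (s / 2) with h | h | h
    · exact hstep _ _ hb.1 h (by linarith)
    · simp only [h]
    · exact (hstep _ _ (by linarith) h hb.2).symm
  have hconst' := hconst.of_subset_closure hcont continuousOn_const Ioo_subset_Icc_self
    (by rw [closure_Ioo hs.ne])
  have h0 : ⟪Y 0, r⟫ = 0 := by
    rw [K.eq_on_G (z := 0) (fun f hf => ?_) hrG, inner_zero_left]
    rw [hY 0 ⟨le_rfl, hs.le⟩ f hf, inner_zero_left]
    exact intervalIntegral.integral_same
  have hr0 : r = 0 := K.eq_zero_of_represents hs hY hrG fun b hb =>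
    (hconst' hb).trans ((hconst' ⟨le_rfl, hs.le⟩).symm.trans h0)
  rw [sub_eq_zero.1 hr0]
  exact Submodule.starProjection_apply_mem _ _

end TsirelsonKernel

end

theorem corollary4p4 (α : ℝ) (K : TsirelsonKernel α) : K.sumSystem.IsDivisible := by
  exact ⟨K.isSumSystem, K.isUnitaryShift, fun _ hs => K.real_generate hs, fun _ hs => K.imag_generate hs⟩
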